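/- Let $d\in\{2,3\}$ and let $\Omega\subset\mathbb{R}^d$ be an open and bounded polytopal domain with Lipschitz boundary, not necessarily convex. For a conforming partition $\mathscr{T}$ of $\bar\Omega$ into finitely many nondegenerate simplices $T$, let $h_T=\operatorname{diam}(T)$. Fix an initial mesh $\mathscr{T}_0$ of this kind and $\sigma>0$, and let $\mathbb{T}$ be the collection of the conforming refinements $\mathscr{T}$ of $\mathscr{T}_0$ that are shape regular with parameter $\sigma$, i.e. each $T\in\mathscr{T}$ contains a ball of some radius $\rho_T>0$ with $h_T\le\sigma\rho_T$. For $\mathscr{T}\in\mathbb{T}$ put $$\mathbb{V}(\mathscr{T})=\{v\in C(\bar\Omega): v|_T \text{ is affine for all } T\in\mathscr{T}\}\cap H_0^1(\Omega).$$ **Theorem 3.2.** There is a constant $C>0$, depending only on $d$, $\Omega$, $\mathscr{T}_0$ and $\sigma$, such that the following holds. Let $f\in L^2(\Omega)$, and let $a=a(x,y):\Omega\times\mathbb{R}\to\mathbb{R}$ be a Carathéodory function that is monotone increasing (i.e. nondecreasing) in $y$ for a.e. $x\in\Omega$, with $a(\cdot,0)\in L^2(\Omega)$, and locally Lipschitz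 in $y$: for every $M>0$ there is $C_M>0$ such that $|a(x,v)-a(x,w)|\le C_M|v-w|$ for a.e. $x\in\Omega$ and all $|v|,|w|\le M$. Let $y\in H_0^1(\Omega)\cap L^\infty(\Omega)$ be the solution to $$(\nabla y,\nabla v)_{L^2(\Omega)}+(a(\cdot,y),v)_{L^2(\Omega)}=(f,v)_{L^2(\Omega)}\quad\forall v\in H_0^1(\Omega),$$ let $\mathscr{T}\in\mathbb{T}$, and let $y_{\mathscr{T}}\in\mathbb{V}(\mathscr{T})$ be its Galerkin approximation, which satisfies $$(\nabla y_{\mathscr{T}},\nabla v)_{L^2(\Omega)}+(a(\cdot,y_{\mathscr{T}}),v)_{L^2(\Omega)}=(f,v)_{L^2(\Omega)}\quad\forall v\in\mathbb{V}(\mathscr{T}).$$ Then $$\|\nabla(y-y_{\mathscr{T}})\|_{L^2(\Omega)}\le C\,\mathcal{E}_{\mathscr{T}},\qquad \mathcal{E}_{\mathscr{T}}^2=\sum_{T\in\mathscr{T}}\Big(h_T^2\|f-a(\cdot,y_{\mathscr{T}})\|_{L^2(T)}^2+h_T\|[\![\nabla y_{\mathscr{T}}\cdot\boldsymbol{\nu}]\!]\|_{L^2(\partial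 T\setminus\partial\Omega)}^2\Big).$$ Here, on an internal side $S=T^+\cap T^-$ shared by two distinct simplices $T^\pm\in\mathscr{T}$, $[\![\nabla v\cdot\boldsymbol{\nu}]\!]=\boldsymbol{\nu}^+\cdot\nabla v|_{T^+}+\boldsymbol{\nu}^-\cdot\nabla v|_{T^-}$, where $\boldsymbol{\nu}^\pm$ is the unit normal to $S$ pointing towards $T^\pm$. In particular, $C$ is independent of $y$, $y_{\mathscr{T}}$, the size of the elements of $\mathscr{T}$ and $\#\mathscr{T}$. -/

import Mathlib

open MeasureTheory Filter Topology
open scoped ENNReal NNReal ContDiff RealInnerProductSpace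

noncomputable section

namespace SemilinearFEM

/-- `ℝᵈ` with the Euclidean norm. -/
abbrev E (d : ℕ) : Type := EuclideanSpace ℝ (Fin d)

/-- `φ ∈ C_c^∞(Ω)`. -/
structure IsTestFunction {d : ℕ} (Ω : Set (E d)) (φ : E d → ℝ) : Prop where
  contDiff : ContDiff ℝ ∞ φ
  hasCompactSupport : HasCompactSupport φ
  tsupport_subset : tsupport φ ⊆ Ω

/-- `g` is the weak gradient of `u` in `Ω`. (Used only for `u` and `g` in `L²(Ω)`.) -/
def HasWeakGradient {d : ℕ} (Ω : Set (E d)) (u : E d → ℝ) (g : E d → E d) : Prop :=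
  ∀ φ : E d → ℝ, IsTestFunction Ω φ →
    (∫ x in Ω, u x • gradient φ x) = -(∫ x in Ω, φ x • g x)

/-- `u ∈ H¹(Ω)`, with weak gradient `g ∈ L²(Ω)ᵈ`. -/
structure MemH1 {d : ℕ} (Ω : Set (E d)) (u : E d → ℝ) (g : E d → E d) : Prop where
  memLp : MemLp u 2 (volume.restrict Ω)
  memLp_grad : MemLp g 2 (volume.restrict Ω)
  hasWeakGradient : HasWeakGradient Ω u g

/-- `u ∈ H₀¹(Ω)`, the closure of `C_c^∞(Ω)` in `H¹(Ω)`; the weak gradient of `u` is `g`. -/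
structure MemH10 {d : ℕ} (Ω : Set (E d)) (u : E d → ℝ) (g : E d → E d) : Prop
    extends MemH1 Ω u g where
  exists_approx : ∃ φ : ℕ → E d → ℝ, (∀ n, IsTestFunction Ω (φ n)) ∧
    Tendsto (fun n => eLpNorm (fun x => u x - φ n x) 2 (volume.restrict Ω)) atTop (𝓝 0) ∧
    Tendsto (fun n => eLpNorm (fun x => g x - gradient (φ n) x) 2 (volume.restrict Ω))
      atTop (𝓝 0)

/-- Lipschitz boundary: near each boundary point, `Ω` is, after a rotation of the coordinates, the
set above the graph of a Lipschitz function. Here `e` is the vertical direction, and the component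
of `x` orthogonal to `e` is the horizontal variable. -/
def HasLipschitzBoundary {d : ℕ} (Ω : Set (E d)) : Prop :=
  ∀ x₀ ∈ frontier Ω, ∃ (e : E d) (r : ℝ) (K : ℝ≥0) (γ : E d → ℝ),
    ‖e‖ = 1 ∧ 0 < r ∧ LipschitzWith K γ ∧
      ∀ x ∈ Metric.ball x₀ r, x ∈ Ω ↔ γ (x - ⟪e, x⟫ • e) < ⟪e, x⟫

/-- A conforming partition of the closure of `Ω` into finitely many nondegenerate `d`-simplices.
A simplex is given by its set `T` of `d + 1` vertices, and is the set `convexHull ℝ T`. Conformity: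
two simplices intersect in the simplex spanned by their common vertices (which may be empty). -/
structure Mesh {d : ℕ} (Ω : Set (E d)) where
  elems : Finset (Finset (E d))
  card_eq : ∀ T ∈ elems, T.card = d + 1
  affineIndependent : ∀ T ∈ elems, AffineIndependent ℝ ((↑) : T → E d)
  conforming : ∀ T ∈ elems, ∀ T' ∈ elems,
    convexHull ℝ (T : Set (E d)) ∩ convexHull ℝ (T' : Set (E d)) =
      convexHull ℝ ((T : Set (E d)) ∩ (T' : Set (E d)))
  cover : ⋃ T ∈ elems, convexHull ℝ (T : Set (E d)) = closure Ω

/-- `h_T`, the diameter of the simplex with vertex set `T`. -/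
def size {d : ℕ} (T : Finset (E d)) : ℝ := Metric.diam (convexHull ℝ (T : Set (E d)))

/-- The barycenter of the simplex with vertex set `T`. -/
def barycenter {d : ℕ} (T : Finset (E d)) : E d := (T.card : ℝ)⁻¹ • ∑ p ∈ T, p

namespace Mesh

variable {d : ℕ} {Ω : Set (E d)}

/-- `𝒯` is a refinement of `𝒯₀`: each simplex of `𝒯` is contained in a simplex of `𝒯₀`. -/
def IsRefinement (𝒯 𝒯₀ : Mesh Ω) : Prop :=
  ∀ T ∈ 𝒯.elems, ∃ T₀ ∈ 𝒯₀.elems,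
    convexHull ℝ (T : Set (E d)) ⊆ convexHull ℝ (T₀ : Set (E d))

/-- Shape regularity with parameter `σ`: each simplex `T` contains a ball of radius `ρ > 0` with
`h_T ≤ σ ρ`. -/
def IsShapeRegular (σ : ℝ) (𝒯 : Mesh Ω) : Prop :=
  ∀ T ∈ 𝒯.elems, ∃ (c : E d) (ρ : ℝ), 0 < ρ ∧
    Metric.ball c ρ ⊆ convexHull ℝ (T : Set (E d)) ∧ size T ≤ σ * ρ

/-- The collection `𝕋` of the conforming refinements of the initial mesh `𝒯₀` that are shape
regular with parameter `σ`. -/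
def family (𝒯₀ : Mesh Ω) (σ : ℝ) : Set (Mesh Ω) :=
  {𝒯 | 𝒯.IsRefinement 𝒯₀ ∧ 𝒯.IsShapeRegular σ}

/-- `v` belongs to `𝕍(𝒯)`, the space of the functions of `H₀¹(Ω)` that are continuous on the closure
of `Ω` and affine on each simplex of `𝒯`; its weak gradient is `g`. -/
structure MemV (𝒯 : Mesh Ω) (v : E d → ℝ) (g : E d → E d) : Prop where
  continuousOn : ContinuousOn v (closure Ω)
  affine : ∀ T ∈ 𝒯.elems, ∃ (b : E d) (c : ℝ),
    ∀ x ∈ convexHull ℝ (T : Set (E d)), v x = ⟪b, x⟫ + c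
  memH10 : MemH10 Ω v g

open Classical in
/-- The simplices `T'` of `𝒯` that share an interelement side with `T`. The internal sides of `T`
are the sets `T ∩ T'` (of `d` vertices), for `T'` in this finset. -/
def neighbors (𝒯 : Mesh Ω) (T : Finset (E d)) : Finset (Finset (E d)) :=
  𝒯.elems.filter fun T' => T' ≠ T ∧ (T ∩ T').card = d

end Mesh

/-- The value on the simplex `T` of the gradient of a function `v` that is affine on `T` (hence
differentiable at the barycenter, with the same gradient as on the whole interior of `T`). -/
def elementGradient {d : ℕ} (v : E d → ℝ) (T : Finset (E d)) : E d := gradient v (barycenter T)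

/-- The unit normal to the side `S` of the simplex `T` that points towards `T`: the normalized
component, orthogonal to `S`, of the vector from the barycenter of `S` to the barycenter of `T`. -/
def unitNormal {d : ℕ} (S T : Finset (E d)) : E d :=
  let w : E d := (vectorSpan ℝ (S : Set (E d)))ᗮ.starProjection (barycenter T - barycenter S)
  ‖w‖⁻¹ • w

/-- The jump `⟦∇v · ν⟧ = ν⁺ · ∇v|_{T⁺} + ν⁻ · ∇v|_{T⁻}` on the side `S` shared by `T⁺` and `T⁻`,
where `ν⁺` and `ν⁻` are the unit normals to `S` that point towards `T⁺` and `T⁻`. -/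
def jump {d : ℕ} (v : E d → ℝ) (S Tp Tm : Finset (E d)) : ℝ :=
  ⟪unitNormal S Tp, elementGradient v Tp⟫ + ⟪unitNormal S Tm, elementGradient v Tm⟫

open Classical in
/-- The square of `‖⟦∇v · ν⟧‖` in `L²(∂T \ ∂Ω)`: the sum over the internal sides `S` of `T` of the
squared norms in `L²(S)` with respect to the `(d - 1)`-dimensional surface measure. -/
def jumpNormSq {d : ℕ} {Ω : Set (E d)} (𝒯 : Mesh Ω) (v : E d → ℝ) (T : Finset (E d)) : ℝ :=
  ∑ T' ∈ 𝒯.neighbors T,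
    lpNorm (fun _ : E d => jump v (T ∩ T') T T') 2
      ((Measure.euclideanHausdorffMeasure (d - 1)).restrict
        (convexHull ℝ ((T ∩ T' : Finset (E d)) : Set (E d)))) ^ 2

/-- The square of the local error indicator:
`h_T² ‖f - a(·, v)‖²` in `L²(T)` plus `h_T ‖⟦∇v · ν⟧‖²` in `L²(∂T \ ∂Ω)`. -/
def indicatorSq {d : ℕ} {Ω : Set (E d)} (𝒯 : Mesh Ω) (a : E d → ℝ → ℝ) (f v : E d → ℝ)
    (T : Finset (E d)) : ℝ :=
  size T ^ 2 *
      lpNorm (fun x => f x - a x (v x)) 2 (volume.restrict (convexHull ℝ (T : Set (E d)))) ^ 2 +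
    size T * jumpNormSq 𝒯 v T

/-- The error estimator, the square root of the sum of the squared local indicators. -/
def estimator {d : ℕ} {Ω : Set (E d)} (𝒯 : Mesh Ω) (a : E d → ℝ → ℝ) (f v : E d → ℝ) : ℝ :=
  Real.sqrt (∑ T ∈ 𝒯.elems, indicatorSq 𝒯 a f v T)

/-- `a : Ω × ℝ → ℝ` is a Carathéodory function: measurable in `x` for all `y`, and continuous in `y`
for almost all `x ∈ Ω`. -/
structure IsCaratheodory {d : ℕ} (Ω : Set (E d)) (a : E d → ℝ → ℝ) : Prop where
  aemeasurable : ∀ y : ℝ, AEMeasurable (fun x => a x y) (volume.restrict Ω)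
  continuous : ∀ᵐ x ∂(volume.restrict Ω), Continuous (a x)

/-- `a` is locally Lipschitz with respect to `y`, uniformly in `x`. -/
def IsLocallyLipschitzInY {d : ℕ} (Ω : Set (E d)) (a : E d → ℝ → ℝ) : Prop :=
  ∀ M : ℝ, 0 < M → ∃ C : ℝ, 0 < C ∧ ∀ᵐ x ∂(volume.restrict Ω),
    ∀ v w : ℝ, |v| ≤ M → |w| ≤ M → |a x v - a x w| ≤ C * |v - w|

/-- The equation `(∇y, ∇v) + (a(·, y), v) = (f, v)` in `L²(Ω)`, for `y` with gradient `gy` and the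
test function `v` with gradient `gv`. -/
def WeakEquation {d : ℕ} (Ω : Set (E d)) (a : E d → ℝ → ℝ) (f y : E d → ℝ) (gy : E d → E d)
    (v : E d → ℝ) (gv : E d → E d) : Prop :=
  (∫ x in Ω, ⟪gy x, gv x⟫) + (∫ x in Ω, a x (y x) * v x) = ∫ x in Ω, f x * v x

/-- `y ∈ H₀¹(Ω)`, with weak gradient `gy`, solves the semilinear Dirichlet problem. -/
def IsWeakSolution {d : ℕ} (Ω : Set (E d)) (a : E d → ℝ → ℝ) (f y : E d → ℝ)
    (gy : E d → E d) : Prop :=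
  MemH10 Ω y gy ∧ ∀ v gv, MemH10 Ω v gv → WeakEquation Ω a f y gy v gv

/-- `y ∈ 𝕍(𝒯)`, with weak gradient `gy`, is the Galerkin approximation. -/
def IsGalerkinSolution {d : ℕ} {Ω : Set (E d)} (𝒯 : Mesh Ω) (a : E d → ℝ → ℝ) (f y : E d → ℝ)
    (gy : E d → E d) : Prop :=
  𝒯.MemV y gy ∧ ∀ v gv, 𝒯.MemV v gv → WeakEquation Ω a f y gy v gv

end SemilinearFEM

end

/-! Write `R(φ) = ∫ (f - a(·, y_T)) φ - ∫ ∇y_T · ∇φ` for the residual of the Galerkin solution.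
Testing the continuous equation with `y` and with `y_T`, and using that `a` is monotone, gives `‖∇(y
- y_T)‖² ≤ R(y - y_T)` (`sq_lpNorm_le_residual`). It therefore suffices to prove `|R(φ)| ≤ C *
estimator * ‖∇φ‖` for test functions (`Mesh.exists_residual_bound`) and to pass to the limit in
`H₀¹(Ω)` (`abs_residual_le_of_tendsto`). The nonlinearity enters this bound only through the fixed
`L²` function `f - a(·, y_T)`, so no Lipschitz constant of `a` reaches `C`.

No quasi-interpolation and no trace inequality is needed. The hat functions `λ_z` of all vertices
form a partition of unity, so `R(φ)` is the sum of the `R(λ_z φ)`. At an interior vertex, Galerkin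
orthogonality allows `φ` to be replaced by `φ - m` for any constant `m`; at a boundary vertex `m =
0` is kept. The volume term is then handled by Cauchy-Schwarz and a Poincaré inequality on the star
of `z`. In the gradient term, `∇y_T` is a constant `b_T` on each element, and the mean of `∇(λ_z (φ
- m))` over `Ω` vanishes (`Mesh.integral_hatGrad`); hence the gradient `b_{T₀}` of one fixed element
of the star can be subtracted from every `b_T`. The differences are sums of jumps across sides, and
because `y_T` is continuous a gradient jump is purely normal, so its norm is the absolute value of
the scalar jump in the estimator (`Mesh.PwAffine.norm_sub_eq_abs_jump`).

The geometry comes from shape regularity and the Lipschitz boundary. A star can be traversed through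
sides (`Mesh.exists_neighbor_of_split`), since sets of codimension two do not disconnect the part of
`Ω` above a Lipschitz graph. Consequently the elements of a star are of comparable size, their
number is bounded, and the star fills a ball around `z` of comparable radius, up to points outside
the closure of `Ω` (`Mesh.exists_isLocalScale`). For the Poincaré inequality, `m` is an average over
a small ball near `z`; for a boundary vertex that ball lies outside `Ω`, where the extended `φ`
vanishes, so `m = 0` automatically. -/

noncomputable section

namespace SemilinearFEM

open scoped Classical

variable {d : ℕ}

/-! ### Simplices and barycentric coordinates -/

/-- A nondegenerate `d`-simplex in `ℝᵈ`, given by its vertices. -/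
structure IsSimplex (T : Finset (E d)) : Prop where
  card_eq : T.card = d + 1
  indep : AffineIndependent ℝ ((↑) : T → E d)

/-- The vertices of a nondegenerate simplex as an affine basis. -/
def IsSimplex.basis {T : Finset (E d)} (h : IsSimplex T) : AffineBasis T ℝ (E d) :=
  ⟨(↑), h.indep, by
    rw [h.indep.affineSpan_eq_top_iff_card_eq_finrank_add_one]
    simp [h.card_eq]⟩

/-- The barycentric coordinate of the simplex `T` attached to its vertex `z`. -/
def bc (T : Finset (E d)) (z : E d) : E d →ᵃ[ℝ] ℝ :=
  -- The default `0` for `z ∉ T` makes hat functions vanish on elements without the vertex `z`, and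
  -- lets sums over the vertices of `T` be extended to all vertices of the mesh.
  if h : IsSimplex T ∧ z ∈ T then h.1.basis.coord ⟨z, h.2⟩ else 0

/-- The gradient of the barycentric coordinate `bc T z`. -/
def bg (T : Finset (E d)) (z : E d) : E d :=
  (InnerProductSpace.toDual ℝ (E d)).symm (LinearMap.toContinuousLinearMap (bc T z).linear)

lemma bc_sub (T : Finset (E d)) (z x y : E d) : bc T z x - bc T z y = ⟪bg T z, x - y⟫ := by
  rw [bg, InnerProductSpace.toDual_symm_apply]
  simp [AffineMap.linearMap_vsub, ← vsub_eq_sub]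

lemma bc_eq (T : Finset (E d)) (z x : E d) : bc T z x = ⟪bg T z, x⟫ + bc T z 0 := by
  have := bc_sub T z x 0
  rw [sub_zero] at this
  linarith

lemma continuous_bc (T : Finset (E d)) (z : E d) : Continuous (bc T z) :=
  (bc T z).continuous_of_finiteDimensional

lemma bc_of_notMem {T : Finset (E d)} {z : E d} (hz : z ∉ T) : bc T z = 0 := by
  simp [bc, hz]

lemma bg_of_notMem {T : Finset (E d)} {z : E d} (hz : z ∉ T) : bg T z = 0 := by
  simp [bg, bc_of_notMem hz]

lemma bc_of_mem {T : Finset (E d)} (hT : IsSimplex T) {z : E d} (hz : z ∈ T) :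
    bc T z = hT.basis.coord ⟨z, hz⟩ := by
  simp [bc, hT, hz]

lemma bc_vertex {T : Finset (E d)} (hT : IsSimplex T) {z p : E d} (hp : p ∈ T) :
    bc T z p = if p = z then 1 else 0 := by
  by_cases hz : z ∈ T
  · rw [bc_of_mem hT hz]
    have : p = hT.basis ⟨p, hp⟩ := rfl
    conv_lhs => rw [this]
    rw [AffineBasis.coord_apply]
    simp [eq_comm]
  · have : p ≠ z := by rintro rfl; exact hz hp
    simp [bc_of_notMem hz, this]

lemma sum_bc {T : Finset (E d)} (hT : IsSimplex T) (x : E d) : ∑ z ∈ T, bc T z x = 1 := by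
  rw [← hT.basis.sum_coord_apply_eq_one x, ← Finset.sum_coe_sort]
  exact Finset.sum_congr rfl fun z _ => by rw [bc_of_mem hT z.2]

lemma sum_bc_smul {T : Finset (E d)} (hT : IsSimplex T) (x : E d) :
    ∑ z ∈ T, bc T z x • z = x := by
  conv_rhs => rw [← hT.basis.linear_combination_coord_eq_self x]
  rw [← Finset.sum_coe_sort]
  exact Finset.sum_congr rfl fun z _ => by rw [bc_of_mem hT z.2]; rfl

lemma range_basis {T : Finset (E d)} (hT : IsSimplex T) : Set.range hT.basis = T := by
  change Set.range ((↑) : T → E d) = T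
  simp

lemma mem_convexHull_iff {T : Finset (E d)} (hT : IsSimplex T) {x : E d} :
    x ∈ convexHull ℝ (T : Set (E d)) ↔ ∀ z, 0 ≤ bc T z x := by
  rw [← range_basis hT, AffineBasis.convexHull_eq_nonneg_coord]
  constructor
  · intro h z
    by_cases hz : z ∈ T
    · rw [bc_of_mem hT hz]; exact h _
    · simp [bc_of_notMem hz]
  · rintro h ⟨z, hz⟩
    rw [← bc_of_mem hT hz]; exact h z

lemma mem_interior_convexHull_iff {T : Finset (E d)} (hT : IsSimplex T) {x : E d} :
    x ∈ interior (convexHull ℝ (T : Set (E d))) ↔ ∀ z ∈ T, 0 < bc T z x := by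
  rw [← range_basis hT, AffineBasis.interior_convexHull]
  constructor
  · intro h z hz
    rw [bc_of_mem hT hz]; exact h _
  · rintro h ⟨z, hz⟩
    rw [← bc_of_mem hT hz]; exact h z hz

lemma bc_le_one {T : Finset (E d)} (hT : IsSimplex T) {x : E d}
    (hx : x ∈ convexHull ℝ (T : Set (E d))) (z : E d) : bc T z x ≤ 1 := by
  by_cases hz : z ∈ T
  · rw [← sum_bc hT x]
    exact Finset.single_le_sum (f := fun z => bc T z x)
      (fun i _ => (mem_convexHull_iff hT).1 hx i) hz
  · simp [bc_of_notMem hz]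

/-- Two affine functions that agree on a set agree on its convex hull. -/
lemma affine_eq_on_convexHull {f g : E d →ᵃ[ℝ] ℝ} {s : Set (E d)} (h : ∀ p ∈ s, f p = g p)
    {x : E d} (hx : x ∈ convexHull ℝ s) : f x = g x := by
  have : convexHull ℝ s ⊆ (f - g) ⁻¹' {0} :=
    convexHull_min (fun p hp => by simp [h p hp]) ((convex_singleton (0 : ℝ)).affine_preimage (f - g))
  have := this hx
  simpa [sub_eq_zero] using this

/-- Dropping the vanishing coordinates leaves a convex combination of vertices in `s`. This is how a
point is recognized as lying on a face. -/
lemma mem_convexHull_of_bc {T : Finset (E d)} (hT : IsSimplex T) {s : Set (E d)} {x : E d}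
    (hx : x ∈ convexHull ℝ (T : Set (E d))) (h : ∀ z ∈ T, z ∉ s → bc T z x = 0) :
    x ∈ convexHull ℝ s := by
  have h1 : ∑ z ∈ T.filter (· ∈ s), bc T z x = 1 := by
    rw [← sum_bc hT x, Finset.sum_filter]
    refine Finset.sum_congr rfl fun z hz => ?_
    split_ifs with hzs
    · rfl
    · exact (h z hz hzs).symm
  have h2 : ∑ z ∈ T.filter (· ∈ s), bc T z x • z = x := by
    conv_rhs => rw [← sum_bc_smul hT x]
    rw [Finset.sum_filter]
    refine Finset.sum_congr rfl fun z hz => ?_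
    split_ifs with hzs
    · rfl
    · rw [h z hz hzs, zero_smul]
  rw [← h2]
  refine (convex_convexHull ℝ s).sum_mem (fun i _ => (mem_convexHull_iff hT).1 hx i) h1 ?_
  intro i hi
  exact subset_convexHull ℝ s (Finset.mem_filter.1 hi).2

/-- The gradients of the barycentric coordinates are controlled by the inradius. -/
lemma norm_bg_le {T : Finset (E d)} (hT : IsSimplex T) {c : E d} {ρ : ℝ} (hρ : 0 < ρ)
    (hb : Metric.ball c ρ ⊆ convexHull ℝ (T : Set (E d))) (z : E d) : ‖bg T z‖ ≤ ρ⁻¹ := by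
  by_contra! hlt
  have hpos : 0 < ‖bg T z‖ := (inv_pos.2 hρ).trans hlt
  set v : E d := ‖bg T z‖⁻¹ • bg T z with hv
  have hvn : ‖v‖ = 1 := by rw [hv, norm_smul, norm_inv, norm_norm, inv_mul_cancel₀ hpos.ne']
  have hvi : ⟪bg T z, v⟫ = ‖bg T z‖ := by
    rw [hv, inner_smul_right, real_inner_self_eq_norm_sq]; field_simp
  -- A step of length `s < ρ` along the gradient stays in the ball, yet raises the coordinate by
  -- more than `1`, which is impossible because coordinates lie in `[0, 1]` on the simplex.
  obtain ⟨s, hs1, hs2⟩ := exists_between (inv_lt_of_inv_lt₀ hρ hlt)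
  have hs0 : 0 < s := (inv_pos.2 hpos).trans hs1
  have hmem : c + s • v ∈ Metric.ball c ρ := by
    simp [norm_smul, hvn, abs_of_pos hs0, hs2]
  have h1 := bc_le_one hT (hb hmem) z
  have h0 := (mem_convexHull_iff hT).1 (hb (Metric.mem_ball_self hρ)) z
  have := bc_sub T z (c + s • v) c
  rw [add_sub_cancel_left, inner_smul_right, hvi] at this
  have h2 : 1 < s * ‖bg T z‖ := by
    have := mul_lt_mul_of_pos_right hs1 hpos
    rwa [inv_mul_cancel₀ hpos.ne'] at this
  linarith

lemma measurableSet_simplex (T : Finset (E d)) :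
    MeasurableSet (convexHull ℝ (T : Set (E d))) :=
  (T.finite_toSet.isCompact_convexHull (𝕜 := ℝ)).measurableSet

lemma isCompact_simplex (T : Finset (E d)) : IsCompact (convexHull ℝ (T : Set (E d))) :=
  T.finite_toSet.isCompact_convexHull (𝕜 := ℝ)

lemma IsSimplex.nonempty {T : Finset (E d)} (hT : IsSimplex T) : T.Nonempty :=
  Finset.card_pos.1 (by rw [hT.card_eq]; omega)

lemma bc_barycenter {T s : Finset (E d)} (hT : IsSimplex T) (hs : s ⊆ T) (hne : s.Nonempty)
    (z : E d) : bc T z (barycenter s) = if z ∈ s then (s.card : ℝ)⁻¹ else 0 := by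
  have hc : (s.card : ℝ) ≠ 0 := by exact_mod_cast hne.card_pos.ne'
  have key : bc T z (barycenter s) - bc T z 0 = (s.card : ℝ)⁻¹ * ∑ p ∈ s, (bc T z p - bc T z 0) := by
    rw [bc_sub, sub_zero, barycenter, inner_smul_right, inner_sum]
    congr 1
    exact Finset.sum_congr rfl fun p _ => by rw [bc_sub, sub_zero]
  have h2 : ∑ p ∈ s, bc T z p = if z ∈ s then 1 else 0 := by
    rw [Finset.sum_congr rfl fun p hp => bc_vertex hT (hs hp)]
    simp
  rw [Finset.sum_sub_distrib, h2, Finset.sum_const, nsmul_eq_mul, mul_sub, inv_mul_cancel_left₀ hc] at key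
  have : bc T z (barycenter s) = (s.card : ℝ)⁻¹ * (if z ∈ s then 1 else 0) := by linarith
  rw [this]; split_ifs <;> simp

lemma barycenter_mem_convexHull {s : Finset (E d)} (hne : s.Nonempty) :
    barycenter s ∈ convexHull ℝ (s : Set (E d)) := by
  have hc : (s.card : ℝ) ≠ 0 := by exact_mod_cast hne.card_pos.ne'
  rw [barycenter, Finset.smul_sum]
  refine (convex_convexHull ℝ _).sum_mem (fun _ _ => by positivity) ?_
    fun i hi => subset_convexHull ℝ _ hi
  simp [hc]

lemma barycenter_mem_interior {T : Finset (E d)} (hT : IsSimplex T) :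
    barycenter T ∈ interior (convexHull ℝ (T : Set (E d))) := by
  rw [mem_interior_convexHull_iff hT]
  intro z hz
  rw [bc_barycenter hT subset_rfl hT.nonempty, if_pos hz]
  have := hT.nonempty.card_pos
  positivity

/-- The barycentric coordinate of a vertex is positive at points closer to it than the inradius. -/
lemma bc_pos_of_dist_lt {T : Finset (E d)} (hT : IsSimplex T) {c : E d} {ρ : ℝ} (hρ : 0 < ρ)
    (hb : Metric.ball c ρ ⊆ convexHull ℝ (T : Set (E d))) {z x : E d} (hz : z ∈ T)
    (hx : dist x z < ρ) : 0 < bc T z x := by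
  have h1 := bc_sub T z x z
  rw [bc_vertex hT hz, if_pos rfl] at h1
  have h2 : |⟪bg T z, x - z⟫| < 1 := by
    refine (abs_real_inner_le_norm _ _).trans_lt ?_
    rw [← dist_eq_norm]
    calc ‖bg T z‖ * dist x z ≤ ρ⁻¹ * dist x z := by gcongr; exact norm_bg_le hT hρ hb z
      _ < ρ⁻¹ * ρ := by gcongr
      _ = 1 := inv_mul_cancel₀ hρ.ne'
  have := (abs_lt.1 h2).1
  linarith

lemma dist_le_size {T : Finset (E d)} {x y : E d} (hx : x ∈ convexHull ℝ (T : Set (E d)))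
    (hy : y ∈ convexHull ℝ (T : Set (E d))) : dist x y ≤ size T :=
  Metric.dist_le_diam_of_mem (isCompact_simplex T).isBounded hx hy

/-- The coordinate of `z` vanishes at the other vertices but is positive within distance `ρ` of `z`.
-/
lemma le_dist_vertices {T : Finset (E d)} (hT : IsSimplex T) {c : E d} {ρ : ℝ} (hρ : 0 < ρ)
    (hb : Metric.ball c ρ ⊆ convexHull ℝ (T : Set (E d))) {z p : E d} (hz : z ∈ T) (hp : p ∈ T)
    (hpz : p ≠ z) : ρ ≤ dist p z := by
  by_contra! h
  have := bc_pos_of_dist_lt hT hρ hb hz h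
  rw [bc_vertex hT hp, if_neg hpz] at this
  exact lt_irrefl _ this

lemma size_nonneg (T : Finset (E d)) : 0 ≤ size T := Metric.diam_nonneg

/-! ### Conformity -/

namespace Mesh

variable {Ω : Set (E d)} (𝒯 : Mesh Ω)

lemma isSimplex {T : Finset (E d)} (hT : T ∈ 𝒯.elems) : IsSimplex T :=
  ⟨𝒯.card_eq T hT, 𝒯.affineIndependent T hT⟩

lemma simplex_subset {T : Finset (E d)} (hT : T ∈ 𝒯.elems) :
    convexHull ℝ (T : Set (E d)) ⊆ closure Ω := by
  rw [← 𝒯.cover]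
  exact Set.subset_biUnion_of_mem (u := fun T : Finset (E d) => convexHull ℝ (T : Set (E d))) hT

lemma exists_simplex {x : E d} (hx : x ∈ closure Ω) :
    ∃ T ∈ 𝒯.elems, x ∈ convexHull ℝ (T : Set (E d)) := by
  rw [← 𝒯.cover] at hx
  simpa using hx

variable {𝒯}

/-- By conformity `x` lies in the hull of the common vertices, where both coordinates are affine
with the same vertex values. This makes the hat functions well defined. -/
lemma bc_congr {T T' : Finset (E d)} (hT : T ∈ 𝒯.elems) (hT' : T' ∈ 𝒯.elems) {x : E d}
    (hx : x ∈ convexHull ℝ (T : Set (E d))) (hx' : x ∈ convexHull ℝ (T' : Set (E d))) (z : E d) :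
    bc T z x = bc T' z x := by
  have h : x ∈ convexHull ℝ ((T : Set (E d)) ∩ (T' : Set (E d))) := by
    rw [← 𝒯.conforming T hT T' hT']; exact ⟨hx, hx'⟩
  exact affine_eq_on_convexHull (fun p hp => by
    rw [bc_vertex (𝒯.isSimplex hT) hp.1, bc_vertex (𝒯.isSimplex hT') hp.2]) h

/-- The coordinate of `z` agrees in both simplices, and in `T'` it would be the default `0` if `z`
were not a vertex. So every simplex containing `x` has all the vertices that carry `x`. -/
lemma mem_of_bc_pos {T T' : Finset (E d)} (hT : T ∈ 𝒯.elems) (hT' : T' ∈ 𝒯.elems) {x : E d}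
    (hx : x ∈ convexHull ℝ (T : Set (E d))) (hx' : x ∈ convexHull ℝ (T' : Set (E d))) {z : E d}
    (hz : 0 < bc T z x) : z ∈ T' := by
  by_contra h
  rw [bc_congr hT hT' hx hx', bc_of_notMem h] at hz
  simp at hz

lemma mem_of_vertex_mem {T T' : Finset (E d)} (hT : T ∈ 𝒯.elems) (hT' : T' ∈ 𝒯.elems) {z : E d}
    (hz : z ∈ T) (hz' : z ∈ convexHull ℝ (T' : Set (E d))) : z ∈ T' :=
  mem_of_bc_pos hT hT' (subset_convexHull ℝ _ hz) hz' (by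
    rw [bc_vertex (𝒯.isSimplex hT) hz, if_pos rfl]; exact one_pos)

/-- Near a point `p`, only the simplices that contain `p` are met. -/
lemma eventually_mem_simplex (𝒯 : Mesh Ω) (p : E d) : ∀ᶠ x in 𝓝 p, ∀ T ∈ 𝒯.elems,
    x ∈ convexHull ℝ (T : Set (E d)) → p ∈ convexHull ℝ (T : Set (E d)) := by
  rw [Filter.eventually_all_finset]
  intro T _
  by_cases hp : p ∈ convexHull ℝ (T : Set (E d))
  · exact Eventually.of_forall fun _ _ => hp
  · filter_upwards [(isCompact_simplex T).isClosed.isOpen_compl.mem_nhds hp] with x hx h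
    exact absurd h hx

/-- The affine span of at most `d` points is a null set. -/
lemma _root_.SemilinearFEM.volume_affineSpan_eq_zero {s : Finset (E d)} (hs : s.card ≤ d) :
    volume (affineSpan ℝ (s : Set (E d)) : Set (E d)) = 0 := by
  apply Measure.addHaar_affineSubspace
  intro htop
  rcases s.eq_empty_or_nonempty with rfl | hne
  · simp at htop
  · have h1 : Module.finrank ℝ (vectorSpan ℝ (s : Set (E d))) + 1 ≤ s.card := by
      have := finrank_vectorSpan_image_finset_le ℝ (fun x : E d => x) s
        (n := s.card - 1) (by have := hne.card_pos; omega)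
      rw [show s.image (fun x : E d => x) = s from Finset.image_id] at this
      have h2 := hne.card_pos
      omega
    rw [← direction_affineSpan, htop, AffineSubspace.direction_top, finrank_top,
      finrank_euclideanSpace_fin] at h1
    omega

lemma card_inter_le {T T' : Finset (E d)} (hT : T ∈ 𝒯.elems) (hT' : T' ∈ 𝒯.elems) (h : T ≠ T') :
    (T ∩ T').card ≤ d := by
  by_contra! hlt
  have h1 := 𝒯.card_eq T hT
  have h2 := 𝒯.card_eq T' hT'
  have e1 : T ∩ T' = T := Finset.eq_of_subset_of_card_le Finset.inter_subset_left (by omega)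
  have e2 : T ∩ T' = T' := Finset.eq_of_subset_of_card_le Finset.inter_subset_right (by omega)
  exact h (e1.symm.trans e2)

lemma inter_subset_affineSpan {T T' : Finset (E d)} (hT : T ∈ 𝒯.elems) (hT' : T' ∈ 𝒯.elems) :
    convexHull ℝ (T : Set (E d)) ∩ convexHull ℝ (T' : Set (E d)) ⊆
      affineSpan ℝ ((T ∩ T' : Finset (E d)) : Set (E d)) := by
  rw [𝒯.conforming T hT T' hT', ← Finset.coe_inter]
  exact convexHull_subset_affineSpan _

/-- Conformity puts the overlap in the span of at most `d` points. Besides splitting integrals, this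
rules out overlapping interiors. -/
lemma volume_inter_eq_zero {T T' : Finset (E d)} (hT : T ∈ 𝒯.elems) (hT' : T' ∈ 𝒯.elems)
    (h : T ≠ T') :
    volume (convexHull ℝ (T : Set (E d)) ∩ convexHull ℝ (T' : Set (E d))) = 0 :=
  measure_mono_null (inter_subset_affineSpan hT hT') (volume_affineSpan_eq_zero (card_inter_le hT hT' h))

end Mesh

end SemilinearFEM

namespace SemilinearFEM

open scoped Classical

variable {d : ℕ}

/-! ### Lipschitz boundaries -/

/-- In the ball `B(z, r)`, the set `Ω` is where `F > 0`, for an `L`-Lipschitz function `F` that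
grows with unit speed in the direction `e`. -/
structure IsGraphDomain (Ω : Set (E d)) (z : E d) (r : ℝ) (L : ℝ≥0) (e : E d) (F : E d → ℝ) :
    Prop where
  norm_eq : ‖e‖ = 1
  lipschitz : LipschitzWith L F
  add_smul : ∀ x (t : ℝ), F (x + t • e) = F x + t
  mem_iff : ∀ x ∈ Metric.ball z r, x ∈ Ω ↔ 0 < F x

/-- `F` is the vertical height above the graph. The horizontal projection is bounded crudely by the
Lipschitz constant `2`. -/
lemma exists_isGraphDomain_of_mem_frontier {Ω : Set (E d)} (h : HasLipschitzBoundary Ω) {z : E d}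
    (hz : z ∈ frontier Ω) :
    ∃ (r : ℝ) (L : ℝ≥0) (e : E d) (F : E d → ℝ), 0 < r ∧ IsGraphDomain Ω z r L e F := by
  obtain ⟨e, r, K, γ, he, hr, hγ, hΩ⟩ := h z hz
  have hproj : LipschitzWith 2 fun x : E d => x - ⟪e, x⟫ • e := by
    refine LipschitzWith.of_dist_le_mul fun x y => ?_
    have e1 : x - ⟪e, x⟫ • e - (y - ⟪e, y⟫ • e) = (x - y) - ⟪e, x - y⟫ • e := by
      rw [inner_sub_right, sub_smul]; abel
    rw [dist_eq_norm, e1, dist_eq_norm]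
    refine (norm_sub_le _ _).trans ?_
    rw [norm_smul, he, mul_one, Real.norm_eq_abs]
    have := abs_real_inner_le_norm e (x - y)
    rw [he, one_mul] at this
    simp only [NNReal.coe_ofNat]
    linarith
  have hin : LipschitzWith 1 fun x : E d => ⟪e, x⟫ := by
    refine LipschitzWith.of_dist_le_mul fun x y => ?_
    rw [Real.dist_eq, ← inner_sub_right, dist_eq_norm]
    have := abs_real_inner_le_norm e (x - y)
    rw [he] at this
    simpa using this
  refine ⟨r, 1 + K * 2, e, fun x => ⟪e, x⟫ - γ (x - ⟪e, x⟫ • e), hr, he,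
    hin.sub (hγ.comp hproj), fun x t => ?_, fun x hx => ?_⟩
  · have h1 : ⟪e, x + t • e⟫ = ⟪e, x⟫ + t := by
      rw [inner_add_right, inner_smul_right, real_inner_self_eq_norm_sq, he]; ring
    rw [h1, show x + t • e - (⟪e, x⟫ + t) • e = x - ⟪e, x⟫ • e by rw [_root_.add_smul]; abel]
    ring
  · rw [hΩ x hx, sub_pos]

/-- A ball inside `Ω` is described by an affine `F` that is positive throughout it, so that interior
and boundary vertices can be treated alike. -/
lemma exists_isGraphDomain_of_mem (hd : 0 < d) {Ω : Set (E d)} (hΩ : IsOpen Ω) {z : E d}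
    (hz : z ∈ Ω) :
    ∃ (r : ℝ) (L : ℝ≥0) (e : E d) (F : E d → ℝ), 0 < r ∧ IsGraphDomain Ω z r L e F := by
  obtain ⟨r, hr, hball⟩ := Metric.isOpen_iff.1 hΩ z hz
  set e : E d := EuclideanSpace.single ⟨0, hd⟩ (1 : ℝ) with he'
  have he : ‖e‖ = 1 := by simp [e]
  refine ⟨r, 1, e, fun x => ⟪e, x - z⟫ + r, hr, he, ?_, fun x t => ?_, fun x hx => ?_⟩
  · refine LipschitzWith.of_dist_le_mul fun x y => ?_
    rw [Real.dist_eq, add_sub_add_right_eq_sub, ← inner_sub_right, sub_sub_sub_cancel_right,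
      dist_eq_norm]
    have := abs_real_inner_le_norm e (x - y)
    rw [he] at this
    simpa using this
  · have : x + t • e - z = (x - z) + t • e := by abel
    rw [this, inner_add_right, inner_smul_right, real_inner_self_eq_norm_sq, he]; ring
  · refine iff_of_true (hball hx) ?_
    have := abs_real_inner_le_norm e (x - z)
    rw [he, one_mul, ← dist_eq_norm] at this
    have h2 := Metric.mem_ball.1 hx
    have h3 := (abs_le.1 this).1
    linarith

lemma IsGraphDomain.mono {Ω : Set (E d)} {z z' : E d} {r r' : ℝ} {L L' : ℝ≥0} {e : E d}
    {F : E d → ℝ} (h : IsGraphDomain Ω z r L e F) (hL : L ≤ L')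
    (hb : Metric.ball z' r' ⊆ Metric.ball z r) : IsGraphDomain Ω z' r' L' e F :=
  ⟨h.norm_eq, h.lipschitz.weaken hL, h.add_smul, fun x hx => h.mem_iff x (hb hx)⟩

/-- The local description of a bounded Lipschitz domain holds with uniform constants. -/
lemma exists_uniform_isGraphDomain (hd : 0 < d) {Ω : Set (E d)} (hΩ : IsOpen Ω)
    (hb : Bornology.IsBounded Ω) (hlip : HasLipschitzBoundary Ω) :
    ∃ (r : ℝ) (L : ℝ≥0), 0 < r ∧ 1 ≤ L ∧ ∀ z ∈ closure Ω, ∃ e F, IsGraphDomain Ω z r L e F := by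
  have hc : IsCompact (closure Ω) := hb.isCompact_closure
  refine hc.induction_on (p := fun s => ∃ (r : ℝ) (L : ℝ≥0), 0 < r ∧ 1 ≤ L ∧
    ∀ z ∈ s, ∃ e F, IsGraphDomain Ω z r L e F) ⟨1, 1, one_pos, le_rfl, by simp⟩ ?_ ?_ ?_
  · rintro s t hst ⟨r, L, hr, hL, h⟩
    exact ⟨r, L, hr, hL, fun z hz => h z (hst hz)⟩
  · rintro s t ⟨r, L, hr, hL, h⟩ ⟨r', L', hr', hL', h'⟩
    refine ⟨min r r', max L L', lt_min hr hr', hL.trans (le_max_left _ _), ?_⟩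
    rintro z (hz | hz)
    · obtain ⟨e, F, hF⟩ := h z hz
      exact ⟨e, F, hF.mono (le_max_left _ _) (Metric.ball_subset_ball (min_le_left _ _))⟩
    · obtain ⟨e, F, hF⟩ := h' z hz
      exact ⟨e, F, hF.mono (le_max_right _ _) (Metric.ball_subset_ball (min_le_right _ _))⟩
  · intro x hx
    obtain ⟨r, L, e, F, hr, hF⟩ : ∃ (r : ℝ) (L : ℝ≥0) (e : E d) (F : E d → ℝ),
        0 < r ∧ IsGraphDomain Ω x r L e F := by
      by_cases hxΩ : x ∈ Ω
      · exact exists_isGraphDomain_of_mem hd hΩ hxΩ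
      · exact exists_isGraphDomain_of_mem_frontier hlip (by rw [hΩ.frontier_eq]; exact ⟨hx, hxΩ⟩)
    -- Half the radius is given up, so that one chart serves all centres in a neighbourhood of `x`.
    refine ⟨Metric.ball x (r / 2), mem_nhdsWithin_of_mem_nhds (Metric.ball_mem_nhds _ (by positivity)),
      r / 2, max L 1, by positivity, le_max_right _ _, fun z hz => ⟨e, F, ?_⟩⟩
    refine hF.mono (le_max_left _ _) (Metric.ball_subset_ball' ?_)
    have := Metric.mem_ball.1 hz
    linarith

namespace IsGraphDomain

variable {Ω : Set (E d)} {z : E d} {r : ℝ} {L : ℝ≥0} {e : E d} {F : E d → ℝ}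

lemma dist_add_smul (h : IsGraphDomain Ω z r L e F) (x : E d) (t : ℝ) :
    dist (x + t • e) x = |t| := by
  simp [norm_smul, h.norm_eq]

lemma mem_closure_of_nonneg (h : IsGraphDomain Ω z r L e F) {x : E d} (hx : x ∈ Metric.ball z r)
    (hF : 0 ≤ F x) : x ∈ closure Ω := by
  rw [Metric.mem_closure_iff]
  intro ε hε
  obtain ⟨t, ht0, ht⟩ := exists_between (lt_min hε (sub_pos.2 (Metric.mem_ball.1 hx)))
  refine ⟨x + t • e, ?_, ?_⟩
  · rw [h.mem_iff, h.add_smul]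
    · linarith
    · have := dist_triangle (x + t • e) x z
      rw [h.dist_add_smul, abs_of_pos ht0] at this
      have h2 := lt_min_iff.1 ht
      rw [Metric.mem_ball]
      linarith
  · rw [dist_comm, h.dist_add_smul, abs_of_pos ht0]
    exact (lt_min_iff.1 ht).1

lemma nonneg_of_mem_closure (h : IsGraphDomain Ω z r L e F) {x : E d} (hx : x ∈ Metric.ball z r)
    (hc : x ∈ closure Ω) : 0 ≤ F x := by
  by_contra! hlt
  have h1 : ∀ᶠ y in 𝓝 x, F y < 0 := h.lipschitz.continuous.continuousAt.eventually_lt_const hlt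
  have h2 : ∀ᶠ y in 𝓝 x, y ∈ Metric.ball z r := Metric.isOpen_ball.mem_nhds hx
  obtain ⟨y, hy, hy1, hy2⟩ := (mem_closure_iff_frequently.1 hc).and_eventually (h1.and h2) |>.exists
  exact absurd ((h.mem_iff y hy2).1 hy) (by linarith)

/-- If `F z = 0`, points just below `z` would still lie in the closure of `Ω` although `F` is
negative there. Lipschitz domains thus have no slits: they contain the interior of their closure. -/
lemma mem_of_mem_interior_closure (h : IsGraphDomain Ω z r L e F) (hr : 0 < r)
    (hz : z ∈ interior (closure Ω)) : z ∈ Ω := by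
  have hzb := Metric.mem_ball_self (x := z) hr
  rw [h.mem_iff z hzb]
  refine lt_of_le_of_ne (h.nonneg_of_mem_closure hzb (interior_subset hz)) fun h0 => ?_
  obtain ⟨ε, hε, hball⟩ := Metric.isOpen_iff.1 isOpen_interior z hz
  obtain ⟨t, ht0, ht⟩ := exists_between (lt_min hε hr)
  have hd : dist (z + (-t) • e) z = t := by rw [h.dist_add_smul, abs_neg, abs_of_pos ht0]
  have h1 := h.nonneg_of_mem_closure (x := z + (-t) • e)
    (by rw [Metric.mem_ball, hd]; exact (lt_min_iff.1 ht).2)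
    (interior_subset (hball (by rw [Metric.mem_ball, hd]; exact (lt_min_iff.1 ht).1)))
  rw [h.add_smul, ← h0] at h1
  linarith

/-- A ball below a boundary point lies outside of `Ω`. -/
lemma ball_disjoint (h : IsGraphDomain Ω z r L e F) (hr : 0 < r) (hL : 1 ≤ L) (hz : z ∉ Ω) {t : ℝ}
    (ht : 0 < t) (htr : 2 * t ≤ r) :
    ∀ x ∈ Metric.ball (z + (-t) • e) (t / L), x ∉ Ω ∧ x ∈ Metric.ball z (2 * t) := by
  intro x hx
  have hL0 : (0 : ℝ) < L := lt_of_lt_of_le one_pos (by exact_mod_cast hL)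
  have hL1 : (1 : ℝ) ≤ L := by exact_mod_cast hL
  have hzF : F z ≤ 0 := by
    by_contra! h0
    exact hz ((h.mem_iff z (Metric.mem_ball_self hr)).2 h0)
  rw [Metric.mem_ball] at hx
  have hxz : dist x z < 2 * t := by
    have h1 := dist_triangle x (z + (-t) • e) z
    rw [h.dist_add_smul, abs_neg, abs_of_pos ht] at h1
    have : t / L ≤ t := div_le_self ht.le hL1
    linarith
  refine ⟨fun hxΩ => ?_, hxz⟩
  have hF := (h.mem_iff x (Metric.mem_ball.2 (hxz.trans_le htr))).1 hxΩ
  have h2 := h.lipschitz.dist_le_mul x (z + (-t) • e)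
  rw [Real.dist_eq, h.add_smul] at h2
  -- At the centre `F ≤ -t`, and over the radius `t / L` it rises by less than `t`, so it stays
  -- negative.
  have h3 : (L : ℝ) * dist x (z + (-t) • e) < t := by
    calc (L : ℝ) * dist x (z + (-t) • e) < L * (t / L) := by gcongr
      _ = t := by field_simp
  have h4 := le_abs_self (F x - (F z + -t))
  linarith

/-- Two points near `z` can be joined near `z` without leaving the superlevel sets of `F`. -/
lemma exists_connecting (h : IsGraphDomain Ω z r L e F) {δ : ℝ} {x x' : E d}
    (hx : x ∈ Metric.ball z δ) (hx' : x' ∈ Metric.ball z δ) :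
    ∃ V : Set (E d), IsPreconnected V ∧ x ∈ V ∧ x' ∈ V ∧ V ⊆ Metric.ball z ((1 + 2 * L) * δ) ∧
      ∀ y ∈ V, F x ≤ F y ∨ F x' ≤ F y := by
  have hδ : 0 < δ := dist_nonneg.trans_lt hx
  -- The path goes up by `t`, across, and down. Going across changes `F` by at most `L * 2δ`, which
  -- is exactly what the ascent has gained.
  set t : ℝ := 2 * L * δ with ht
  have ht0 : 0 ≤ t := by positivity
  have hup : ∀ w ∈ Metric.ball z δ, w + t • e ∈ Metric.ball z ((1 + 2 * L) * δ) := by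
    intro w hw
    have h1 := dist_triangle (w + t • e) w z
    rw [h.dist_add_smul, abs_of_nonneg ht0] at h1
    have := Metric.mem_ball.1 hw
    rw [Metric.mem_ball]
    linarith
  have hlow : ∀ w ∈ Metric.ball z δ, w ∈ Metric.ball z ((1 + 2 * L) * δ) := by
    intro w hw
    refine Metric.ball_subset_ball ?_ hw
    nlinarith [L.2, hδ]
  have hseg : ∀ w, ∀ y ∈ segment ℝ w (w + t • e), F w ≤ F y := by
    intro w y hy
    rw [segment_eq_image'] at hy
    obtain ⟨s, hs, rfl⟩ := hy
    have : w + s • (w + t • e - w) = w + (s * t) • e := by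
      rw [add_sub_cancel_left, smul_smul]
    simp only [this, h.add_smul]
    have := mul_nonneg hs.1 ht0
    linarith
  refine ⟨segment ℝ x (x + t • e) ∪ segment ℝ (x + t • e) (x' + t • e) ∪
    segment ℝ x' (x' + t • e), ?_, ?_, ?_, ?_, ?_⟩
  · refine IsPreconnected.union (x' + t • e) (Or.inr (right_mem_segment _ _ _))
      (right_mem_segment _ _ _) (IsPreconnected.union (x + t • e) (right_mem_segment _ _ _)
      (left_mem_segment _ _ _) (convex_segment _ _).isPreconnected
      (convex_segment _ _).isPreconnected) (convex_segment _ _).isPreconnected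
  · exact Or.inl (Or.inl (left_mem_segment _ _ _))
  · exact Or.inr (left_mem_segment _ _ _)
  · refine Set.union_subset (Set.union_subset ?_ ?_) ?_ <;>
      refine (convex_ball z _).segment_subset ?_ ?_
    exacts [hlow x hx, hup x hx, hup x hx, hup x' hx', hlow x' hx', hup x' hx']
  · rintro y ((hy | hy) | hy)
    · exact Or.inl (hseg x y hy)
    · left
      rw [segment_eq_image'] at hy
      obtain ⟨s, hs, rfl⟩ := hy
      have e1 : x + t • e + s • (x' + t • e - (x + t • e)) = (x + s • (x' - x)) + t • e := by
        rw [add_sub_add_right_eq_sub]; abel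
      simp only [e1, h.add_smul]
      have h2 := h.lipschitz.dist_le_mul x (x + s • (x' - x))
      have h3 : dist x (x + s • (x' - x)) ≤ 2 * δ := by
        rw [dist_eq_norm, sub_add_cancel_left, norm_neg, norm_smul, Real.norm_eq_abs,
          abs_of_nonneg hs.1, ← dist_eq_norm]
        have h4 := dist_triangle x' z x
        rw [dist_comm z x] at h4
        have h5 := Metric.mem_ball.1 hx
        have h6 := Metric.mem_ball.1 hx'
        have h7 : s * dist x' x ≤ 1 * dist x' x := by gcongr; exact hs.2
        linarith
      rw [Real.dist_eq] at h2
      have h4 := le_abs_self (F x - F (x + s • (x' - x)))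
      have h5 : (L : ℝ) * dist x (x + s • (x' - x)) ≤ L * (2 * δ) := by gcongr
      linarith
    · exact Or.inr (hseg x' y hy)

end IsGraphDomain

/-! ### The mesh near a vertex and near the boundary -/

namespace Mesh

variable {Ω : Set (E d)} {𝒯 : Mesh Ω}

lemma interior_simplex_subset
    (hreg : interior (closure Ω) ⊆ Ω) {T : Finset (E d)} (hT : T ∈ 𝒯.elems) :
    interior (convexHull ℝ (T : Set (E d))) ⊆ Ω :=
  (interior_mono (𝒯.simplex_subset hT)).trans hreg

/-- A frontier point lies in some simplex but not in its interior, which is contained in `Ω`. The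
frontier is thus covered by finitely many boundaries of convex sets. -/
lemma volume_frontier_eq_zero (𝒯 : Mesh Ω) (hΩ : IsOpen Ω) (hreg : interior (closure Ω) ⊆ Ω) :
    volume (frontier Ω) = 0 := by
  refine measure_mono_null (t := ⋃ T ∈ 𝒯.elems, frontier (convexHull ℝ (T : Set (E d)))) ?_ ?_
  · intro x hx
    rw [hΩ.frontier_eq] at hx
    obtain ⟨T, hT, hxT⟩ := 𝒯.exists_simplex hx.1
    refine Set.mem_biUnion hT ⟨subset_closure hxT, fun hi => hx.2 (interior_simplex_subset hreg hT hi)⟩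
  · exact (measure_biUnion_null_iff 𝒯.elems.countable_toSet).2
      fun T _ => (convex_convexHull ℝ _).addHaar_frontier _

/-- Points of the closure of the domain that are close to a vertex belong to its star. -/
lemma exists_mem_star {z : E d} {r : ℝ} {L : ℝ≥0} {e : E d} {F : E d → ℝ}
    (h : IsGraphDomain Ω z r L e F) {T₀ : Finset (E d)} (hT₀ : T₀ ∈ 𝒯.elems) (hz₀ : z ∈ T₀)
    {ρ δ : ℝ} (hρ : 0 < ρ) (hin : ∀ T ∈ 𝒯.elems, z ∈ T → ∃ c ρ', ρ ≤ ρ' ∧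
      Metric.ball c ρ' ⊆ convexHull ℝ (T : Set (E d)))
    (hδr : (1 + 2 * L) * δ ≤ r) (hδρ : (1 + 2 * L) * δ ≤ ρ) {x : E d} (hx : x ∈ Metric.ball z δ)
    (hxc : x ∈ closure Ω) : ∀ T ∈ 𝒯.elems, x ∈ convexHull ℝ (T : Set (E d)) → z ∈ T := by
  have hδ : 0 < δ := dist_nonneg.trans_lt hx
  have hr : 0 < r := lt_of_lt_of_le (by positivity) hδr
  have hzT₀ : z ∈ convexHull ℝ (T₀ : Set (E d)) := subset_convexHull ℝ _ hz₀
  have hzc : z ∈ closure Ω := 𝒯.simplex_subset hT₀ hzT₀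
  obtain ⟨V, hV, hzV, hxV, hVb, hVF⟩ := h.exists_connecting (Metric.mem_ball_self hδ) hx
  have hVc : V ⊆ closure Ω := by
    intro y hy
    have hyr : y ∈ Metric.ball z r := Metric.ball_subset_ball hδr (hVb hy)
    refine h.mem_closure_of_nonneg hyr ?_
    have h1 := h.nonneg_of_mem_closure (Metric.mem_ball_self hr) hzc
    have h2 := h.nonneg_of_mem_closure
      (Metric.ball_subset_ball hδr (hVb hxV)) hxc
    rcases hVF y hy with h3 | h3 <;> linarith
  let far : Finset (Finset (E d)) := 𝒯.elems.filter (z ∉ ·)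
  let near : Finset (Finset (E d)) := 𝒯.elems.filter (z ∈ ·)
  have hO : ∀ s : Finset (Finset (E d)),
      IsOpen (⋃ T ∈ s, convexHull ℝ (T : Set (E d)))ᶜ := fun s =>
    (s.finite_toSet.isClosed_biUnion fun T _ => (isCompact_simplex T).isClosed).isOpen_compl
  -- A point shared by a near and a far simplex would be within the inradius of `z`, hence have a
  -- positive `z`-coordinate in the near one, and then `z` would be a vertex of the far one. So near
  -- and far simplices separate `V`, and `V` stays on the side of `z`.
  have hcov : V ⊆ (⋃ T ∈ far, convexHull ℝ (T : Set (E d)))ᶜ ∪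
      (⋃ T ∈ near, convexHull ℝ (T : Set (E d)))ᶜ := by
    intro p hp
    by_contra hcon
    rw [Set.mem_union, not_or, Set.notMem_compl_iff, Set.notMem_compl_iff] at hcon
    simp only [Set.mem_iUnion, exists_prop, far, near, Finset.mem_filter] at hcon
    obtain ⟨⟨T', ⟨hT', hz'⟩, hpT'⟩, ⟨T, ⟨hT, hzT⟩, hpT⟩⟩ := hcon
    obtain ⟨c, ρ', hρ', hb⟩ := hin T hT hzT
    refine hz' (mem_of_bc_pos hT hT' hpT hpT' ?_)
    refine bc_pos_of_dist_lt (𝒯.isSimplex hT) (hρ.trans_le hρ') hb hzT ?_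
    exact (Metric.mem_ball.1 (hVb hp)).trans_le (hδρ.trans hρ')
  have hdis : V ∩ ((⋃ T ∈ far, convexHull ℝ (T : Set (E d)))ᶜ ∩
      (⋃ T ∈ near, convexHull ℝ (T : Set (E d)))ᶜ) = ∅ := by
    rw [Set.eq_empty_iff_forall_notMem]
    rintro p ⟨hp, hp1, hp2⟩
    obtain ⟨T, hT, hpT⟩ := 𝒯.exists_simplex (hVc hp)
    by_cases hzT : z ∈ T
    · exact hp2 (Set.mem_biUnion (Finset.mem_coe.2 (Finset.mem_filter.2 ⟨hT, hzT⟩)) hpT)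
    · exact hp1 (Set.mem_biUnion (Finset.mem_coe.2 (Finset.mem_filter.2 ⟨hT, hzT⟩)) hpT)
  rcases isPreconnected_iff_subset_of_disjoint.1 hV _ _ (hO _) (hO _) hcov hdis with h1 | h1
  · intro T hT hxT
    by_contra hzT
    exact h1 hxV (Set.mem_biUnion (Finset.mem_coe.2 (Finset.mem_filter.2 ⟨hT, hzT⟩)) hxT)
  · exact absurd (Set.mem_biUnion (Finset.mem_coe.2 (Finset.mem_filter.2 ⟨hT₀, hz₀⟩)) hzT₀) (h1 hzV)

/-- The barycentric coordinate of an interior vertex vanishes on the boundary. -/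
lemma mem_of_bc_pos_of_vertex_mem (hΩ : IsOpen Ω) (hreg : interior (closure Ω) ⊆ Ω) {z : E d}
    (hz : z ∈ Ω) {T : Finset (E d)} (hT : T ∈ 𝒯.elems) {x : E d}
    (hx : x ∈ convexHull ℝ (T : Set (E d))) (hpos : 0 < bc T z x) : x ∈ Ω := by
  have hTs := 𝒯.isSimplex hT
  have hzT : z ∈ T := by
    by_contra h
    simp [bc_of_notMem h] at hpos
  set β := bc T z x with hβ
  have hβ1 : β ≤ 1 := bc_le_one hTs hx z
  -- Going beyond `x`, away from `z`, by the factor `β` stays in `T`: the `z`-coordinate becomes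
  -- `β²` and the others are multiplied by `1 + β`.
  set x' : E d := x + β • (x - z) with hx'
  have hbcz : ∀ w, bc T w z = if z = w then 1 else 0 := fun w => bc_vertex hTs hzT
  have hbx' : ∀ w, bc T w x' = (1 + β) * bc T w x - β * bc T w z := by
    intro w
    have h1 := bc_sub T w x' x
    have h2 := bc_sub T w x z
    rw [hx', add_sub_cancel_left, inner_smul_right, ← h2] at h1
    rw [← hx'] at h1
    linarith
  have hx'T : x' ∈ convexHull ℝ (T : Set (E d)) := by
    rw [mem_convexHull_iff hTs]
    intro w
    rw [hbx', hbcz]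
    have := (mem_convexHull_iff hTs).1 hx w
    split_ifs with hw
    · subst hw; rw [← hβ]; nlinarith
    · nlinarith
  have hlim : Tendsto (fun s : ℝ => z + s • (x - z)) (𝓝[>] 0) (𝓝 z) := by
    have : Tendsto (fun s : ℝ => z + s • (x - z)) (𝓝 0) (𝓝 (z + (0 : ℝ) • (x - z))) :=
      (by fun_prop : Continuous fun s : ℝ => z + s • (x - z)).tendsto 0
    rw [zero_smul, add_zero] at this
    exact this.mono_left nhdsWithin_le_nhds
  have hs01 : ∀ᶠ s : ℝ in 𝓝[>] 0, s ∈ Set.Ioo (0 : ℝ) 1 := Ioo_mem_nhdsGT one_pos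
  obtain ⟨s, hqΩ, hs⟩ := ((hlim.eventually (hΩ.mem_nhds hz)).and hs01).exists
  set q : E d := z + s • (x - z) with hq
  have hbq : ∀ w, bc T w q = s * bc T w x + (1 - s) * bc T w z := by
    intro w
    have h1 := bc_sub T w q z
    have h2 := bc_sub T w x z
    rw [hq, add_sub_cancel_left, inner_smul_right, ← h2, ← hq] at h1
    linarith
  have hqT : q ∈ convexHull ℝ (T : Set (E d)) := by
    rw [mem_convexHull_iff hTs]
    intro w
    rw [hbq]
    have h1 := (mem_convexHull_iff hTs).1 hx w
    have h2 := (mem_convexHull_iff hTs).1 (subset_convexHull ℝ _ hzT) w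
    have h3 := hs.1
    have h4 := hs.2
    exact add_nonneg (mul_nonneg h3.le h1) (mul_nonneg (by linarith) h2)
  -- The point `q`, between `z` and `x` and close to `z`, is carried by `z` together with the
  -- vertices that carry `x`. A simplex containing `q` has all of these, hence contains `x'`.
  have hx'mem : ∀ T' ∈ 𝒯.elems, q ∈ convexHull ℝ (T' : Set (E d)) →
      x' ∈ convexHull ℝ (T' : Set (E d)) := by
    intro T' hT' hqT'
    refine mem_convexHull_of_bc hTs hx'T fun w hw hwT' => ?_
    have h0 : bc T w q = 0 := by
      refine le_antisymm ?_ ((mem_convexHull_iff hTs).1 hqT w)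
      by_contra! hp
      exact hwT' (mem_of_bc_pos hT hT' hqT hqT' hp)
    rw [hbq] at h0
    have h1 := (mem_convexHull_iff hTs).1 hx w
    have h2 := (mem_convexHull_iff hTs).1 (subset_convexHull ℝ _ hzT) w
    have h3 := mul_nonneg hs.1.le h1
    have h4 : 0 ≤ (1 - s) * bc T w z := mul_nonneg (by linarith [hs.2]) h2
    have h5 : bc T w x = 0 := by
      have : s * bc T w x = 0 := by linarith
      exact (mul_eq_zero.1 this).resolve_left hs.1.ne'
    have h6 : bc T w z = 0 := by
      have : (1 - s) * bc T w z = 0 := by linarith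
      exact (mul_eq_zero.1 this).resolve_left (by linarith [hs.2])
    rw [hbx', h5, h6]; ring
  -- This weight solves `x = κ q + (1 - κ) x'`. The homothety with centre `x'` and ratio `κ` maps a
  -- neighbourhood of `q` in `Ω` onto a neighbourhood of `x`, and it stays in the simplices that
  -- contain both `x'` and the point near `q`. So `x` is interior to the closure of `Ω`.
  set κ : ℝ := β / (1 + β - s) with hκ
  have hden : 0 < 1 + β - s := by linarith [hs.2]
  have hκ0 : 0 < κ := div_pos hpos hden
  have hκ1 : κ ≤ 1 := by rw [hκ, div_le_one hden]; linarith [hs.2]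
  apply hreg
  rw [mem_interior_iff_mem_nhds]
  have hcont : Tendsto (fun y : E d => q + κ⁻¹ • (y - x)) (𝓝 x) (𝓝 q) := by
    have : Tendsto (fun y : E d => q + κ⁻¹ • (y - x)) (𝓝 x) (𝓝 (q + κ⁻¹ • (x - x))) :=
      (by fun_prop : Continuous fun y : E d => q + κ⁻¹ • (y - x)).tendsto x
    simpa using this
  filter_upwards [hcont.eventually (𝒯.eventually_mem_simplex q),
    hcont.eventually (hΩ.mem_nhds hqΩ)] with y hy1 hy2
  obtain ⟨T', hT', hyT'⟩ := 𝒯.exists_simplex (subset_closure hy2)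
  have hx'T' := hx'mem T' hT' (hy1 T' hT' hyT')
  refine 𝒯.simplex_subset hT' ?_
  have hcomb := (convex_convexHull ℝ (T' : Set (E d))) hyT' hx'T' hκ0.le (sub_nonneg.2 hκ1)
    (by ring)
  have : κ • (q + κ⁻¹ • (y - x)) + (1 - κ) • x' = y := by
    rw [smul_add, smul_inv_smul₀ hκ0.ne']
    have h1 : κ • q + (1 - κ) • x' = x := by
      have h2 : q = x + (s - 1) • (x - z) := by rw [hq]; module
      have h3 : κ • q + (1 - κ) • x' = x + (κ * (s - 1) + (1 - κ) * β) • (x - z) := by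
        rw [h2, hx']; module
      have h4 : κ * (s - 1) + (1 - κ) * β = 0 := by
        rw [hκ]; field_simp; ring
      rw [h3, h4, zero_smul, add_zero]
    rw [add_right_comm, h1]; abel
  rwa [this] at hcomb

end Mesh

end SemilinearFEM

namespace SemilinearFEM

open scoped Classical

variable {d : ℕ}

/-! ### Connectedness away from sets of codimension two -/

lemma subset_or_subset_of_isPreconnected {X : Type*} [TopologicalSpace X] {A B C : Set X}
    (hC : IsPreconnected C) (hA : IsClosed A) (hB : IsClosed B) (hcov : C ⊆ A ∪ B)
    (hdis : C ∩ (A ∩ B) = ∅) : C ⊆ A ∨ C ⊆ B :=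
  isPreconnected_iff_subset_of_disjoint_closed.1 hC A B hA hB hcov hdis

/-- If the segment met the span of `s`, the line through `p` and the meeting point would carry `r`
into the span of `p` and `s`. -/
lemma disjoint_segment_affineSpan {p r : E d} {s : Set (E d)} (hp : p ∉ affineSpan ℝ s)
    (hr : r ∉ affineSpan ℝ (insert p s)) {x : E d} (hx : x ∈ segment ℝ p r) :
    x ∉ affineSpan ℝ s := by
  intro hxs
  rw [segment_eq_image_lineMap] at hx
  obtain ⟨t, _, rfl⟩ := hx
  have ht : t ≠ 0 := by
    rintro rfl
    rw [AffineMap.lineMap_apply_zero] at hxs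
    exact hp hxs
  have h1 : AffineMap.lineMap p r t ∈ affineSpan ℝ (insert p s) :=
    affineSpan_mono ℝ (Set.subset_insert _ _) hxs
  have h2 : p ∈ affineSpan ℝ (insert p s) := subset_affineSpan ℝ _ (Set.mem_insert _ _)
  have h3 := AffineMap.lineMap_mem t⁻¹ h2 h1
  rw [AffineMap.lineMap_lineMap_right, inv_mul_cancel₀ ht, AffineMap.lineMap_apply_one] at h3
  exact hr h3

lemma exists_mem_notMem_of_null {U N : Set (E d)} (hU : IsOpen U) (hne : U.Nonempty)
    (hN : volume N = 0) : ∃ x ∈ U, x ∉ N := by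
  by_contra! h
  exact (hU.measure_pos volume hne).ne' (measure_mono_null h hN)

/-- If two closed sets cover a ball and meet in a set of codimension two only, then one of them
contains the ball. -/
lemma ball_subset_or_subset {A B : Set (E d)} (hA : IsClosed A) (hB : IsClosed B)
    {𝒮 : Finset (Finset (E d))} (h𝒮 : ∀ s ∈ 𝒮, s.card < d) {c : E d} {ε : ℝ}
    (hcov : Metric.ball c ε ⊆ A ∪ B)
    (hint : ∀ x ∈ Metric.ball c ε, x ∈ A → x ∈ B → ∃ s ∈ 𝒮, x ∈ affineSpan ℝ (s : Set (E d))) :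
    Metric.ball c ε ⊆ A ∨ Metric.ball c ε ⊆ B := by
  rcases Set.eq_empty_or_nonempty (Metric.ball c ε) with he | hne
  · left; simp [he]
  set U := Metric.ball c ε with hU
  have hUo : IsOpen U := Metric.isOpen_ball
  let N : Set (E d) := ⋃ s ∈ 𝒮, (affineSpan ℝ (s : Set (E d)) : Set (E d))
  have hN : volume N = 0 := (measure_biUnion_null_iff 𝒮.countable_toSet).2 fun s hs =>
    volume_affineSpan_eq_zero (h𝒮 s hs).le
  -- Since `s` has fewer than `d` points, one more point still spans at most a hyperplane. Almost
  -- every `r` is therefore joined to `p` by a segment avoiding all the exceptional spans.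
  have hNp : ∀ p : E d, volume
      (⋃ s ∈ 𝒮, (affineSpan ℝ (insert p s : Set (E d)) : Set (E d))) = 0 := fun p =>
    (measure_biUnion_null_iff 𝒮.countable_toSet).2 fun s hs => by
      have := volume_affineSpan_eq_zero (s := insert p s)
        ((Finset.card_insert_le _ _).trans (h𝒮 s hs))
      simpa using this
  have hside : ∀ p ∈ U, p ∉ N → ∀ r ∈ U,
      r ∉ (⋃ s ∈ 𝒮, (affineSpan ℝ (insert p s : Set (E d)) : Set (E d))) →
      segment ℝ p r ⊆ A ∨ segment ℝ p r ⊆ B := by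
    intro p hp hpN r hr hrN
    have hsub : segment ℝ p r ⊆ U := (convex_ball c ε).segment_subset hp hr
    refine subset_or_subset_of_isPreconnected (convex_segment p r).isPreconnected hA hB
      (hsub.trans hcov) ?_
    rw [Set.eq_empty_iff_forall_notMem]
    rintro x ⟨hx, hxA, hxB⟩
    obtain ⟨s, hs, hxs⟩ := hint x (hsub hx) hxA hxB
    simp only [N, Set.mem_iUnion, not_exists] at hpN hrN
    exact disjoint_segment_affineSpan (hpN s hs) (hrN s hs) hx hxs
  have hexcl : ∀ p ∈ U, p ∉ N → p ∈ A → p ∉ B := by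
    intro p hp hpN hpA hpB
    obtain ⟨s, hs, h⟩ := hint p hp hpA hpB
    exact hpN (Set.mem_biUnion (Finset.mem_coe.2 hs) h)
  -- Two generic points are joined through a third one, chosen generic with respect to both; neither
  -- segment can change from `A` to `B`.
  have htrans : ∀ p ∈ U, p ∉ N → ∀ q ∈ U, q ∉ N → p ∈ A → q ∈ A := by
    intro p hp hpN q hq hqN hpA
    obtain ⟨r, hr, hrN⟩ := exists_mem_notMem_of_null hUo hne
      (measure_union_null (hNp p) (hNp q))
    rw [Set.mem_union, not_or] at hrN
    have hrA : r ∈ A := by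
      rcases hside p hp hpN r hr hrN.1 with h | h
      · exact h (right_mem_segment _ _ _)
      · exact absurd (h (left_mem_segment _ _ _)) (hexcl p hp hpN hpA)
    have hrNN : r ∉ N := by
      intro h
      simp only [N, Set.mem_iUnion] at h
      obtain ⟨s, hs, h⟩ := h
      exact hrN.1 (Set.mem_biUnion (Finset.mem_coe.2 hs)
        (affineSpan_mono ℝ (Set.subset_insert _ _) h))
    rcases hside q hq hqN r hr hrN.2 with h | h
    · exact h (left_mem_segment _ _ _)
    · exact absurd (h (right_mem_segment _ _ _)) (hexcl r hr hrNN hrA)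
  -- The exceptional set is null, so a closed set that contains all generic points of the ball
  -- contains the ball.
  have hdense : ∀ D : Set (E d), IsClosed D → (∀ q ∈ U, q ∉ N → q ∈ D) → U ⊆ D := by
    intro D hD h x hx
    by_contra hxD
    obtain ⟨y, hy, hyN⟩ := exists_mem_notMem_of_null (hUo.inter hD.isOpen_compl) ⟨x, hx, hxD⟩ hN
    exact hy.2 (h y hy.1 hyN)
  by_cases hex : ∃ p ∈ U, p ∉ N ∧ p ∈ A
  · obtain ⟨p, hp, hpN, hpA⟩ := hex
    exact Or.inl (hdense A hA fun q hq hqN => htrans p hp hpN q hq hqN hpA)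
  · push Not at hex
    exact Or.inr (hdense B hB fun q hq hqN => (hcov hq).resolve_left (hex q hq hqN))

/-- The dichotomy on small balls shows that the two interiors cover `V`. They do not meet in `U`,
because the overlap of `A` and `B` there is null, so connectedness of `V` decides. -/
lemma subset_interior_or_subset_interior {A B U V : Set (E d)} (hA : IsClosed A) (hB : IsClosed B)
    {𝒮 : Finset (Finset (E d))} (h𝒮 : ∀ s ∈ 𝒮, s.card < d) (hU : IsOpen U)
    (hcov : U ⊆ A ∪ B)
    (hint : ∀ x ∈ U, x ∈ A → x ∈ B → ∃ s ∈ 𝒮, x ∈ affineSpan ℝ (s : Set (E d)))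
    (hV : IsPreconnected V) (hVU : V ⊆ U) : V ⊆ interior A ∨ V ⊆ interior B := by
  refine isPreconnected_iff_subset_of_disjoint.1 hV _ _ isOpen_interior isOpen_interior ?_ ?_
  · intro x hx
    obtain ⟨ε, hε, hball⟩ := Metric.isOpen_iff.1 hU x (hVU hx)
    rcases ball_subset_or_subset hA hB h𝒮 (hball.trans hcov) (fun y hy => hint y (hball hy))
      with h | h
    · exact Or.inl (mem_interior.2 ⟨_, h, Metric.isOpen_ball, Metric.mem_ball_self hε⟩)
    · exact Or.inr (mem_interior.2 ⟨_, h, Metric.isOpen_ball, Metric.mem_ball_self hε⟩)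
  · rw [Set.eq_empty_iff_forall_notMem]
    rintro x ⟨hx, hxA, hxB⟩
    obtain ⟨y, ⟨hyA, hyB, hyU⟩, hy⟩ := exists_mem_notMem_of_null
      (isOpen_interior.inter (isOpen_interior.inter hU)) ⟨x, hxA, hxB, hVU hx⟩
      (N := ⋃ s ∈ 𝒮, (affineSpan ℝ (s : Set (E d)) : Set (E d)))
      ((measure_biUnion_null_iff 𝒮.countable_toSet).2 fun s hs =>
        volume_affineSpan_eq_zero (h𝒮 s hs).le)
    obtain ⟨s, hs, h⟩ := hint y hyU (interior_subset hyA) (interior_subset hyB)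
    exact hy (Set.mem_biUnion (Finset.mem_coe.2 hs) h)

/-! ### Vertex stars: connectedness through sides, comparable sizes, cardinality -/

namespace Mesh

variable {Ω : Set (E d)} {𝒯 : Mesh Ω}

/-- The simplices of the mesh with vertex `z`. -/
def star (𝒯 : Mesh Ω) (z : E d) : Finset (Finset (E d)) := 𝒯.elems.filter (z ∈ ·)

lemma mem_star {z : E d} {T : Finset (E d)} : T ∈ 𝒯.star z ↔ T ∈ 𝒯.elems ∧ z ∈ T :=
  Finset.mem_filter

lemma mem_neighbors {T T' : Finset (E d)} :
    T' ∈ 𝒯.neighbors T ↔ T' ∈ 𝒯.elems ∧ T' ≠ T ∧ (T ∩ T').card = d := Finset.mem_filter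

/-- The star of a vertex cannot be split into two parts without common sides. -/
lemma exists_neighbor_of_split {z : E d} {r : ℝ} (hr : 0 < r) {L : ℝ≥0} {e : E d} {F : E d → ℝ}
    (h : IsGraphDomain Ω z r L e F) (hΩ : IsOpen Ω) (hreg : interior (closure Ω) ⊆ Ω)
    (P : Finset (E d) → Prop) {T T' : Finset (E d)}
    (hT : T ∈ 𝒯.star z) (hT' : T' ∈ 𝒯.star z) (hP : P T) (hP' : ¬ P T') :
    ∃ T₁ ∈ 𝒯.star z, ∃ T₂ ∈ 𝒯.star z, P T₁ ∧ ¬ P T₂ ∧ T₂ ∈ 𝒯.neighbors T₁ := by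
  by_contra! hno
  obtain ⟨ε, hε, hball⟩ := Metric.eventually_nhds_iff_ball.1 (𝒯.eventually_mem_simplex z)
  let 𝒜 := (𝒯.star z).filter P
  let ℬ := (𝒯.star z).filter (¬ P ·)
  let A : Set (E d) := ⋃ T ∈ 𝒜, convexHull ℝ (T : Set (E d))
  let B : Set (E d) := ⋃ T ∈ ℬ, convexHull ℝ (T : Set (E d))
  have hcl : ∀ s : Finset (Finset (E d)), IsClosed (⋃ T ∈ s, convexHull ℝ (T : Set (E d))) :=
    fun s => s.finite_toSet.isClosed_biUnion fun T _ => (isCompact_simplex T).isClosed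
  have hmemA : ∀ T ∈ 𝒯.star z, P T → convexHull ℝ (T : Set (E d)) ⊆ A := fun T hT hPT =>
    Set.subset_biUnion_of_mem (u := fun T : Finset (E d) => convexHull ℝ (T : Set (E d)))
      (Finset.mem_coe.2 (Finset.mem_filter.2 ⟨hT, hPT⟩))
  have hmemB : ∀ T ∈ 𝒯.star z, ¬ P T → convexHull ℝ (T : Set (E d)) ⊆ B := fun T hT hPT =>
    Set.subset_biUnion_of_mem (u := fun T : Finset (E d) => convexHull ℝ (T : Set (E d)))
      (Finset.mem_coe.2 (Finset.mem_filter.2 ⟨hT, hPT⟩))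
  set ε' := min ε r with hε'
  have hε'0 : 0 < ε' := lt_min hε hr
  set δ := ε' / (1 + 2 * L) with hδ
  have hL : (0 : ℝ) < 1 + 2 * L := by positivity
  have hδ0 : 0 < δ := div_pos hε'0 hL
  have hδε : (1 + 2 * L) * δ = ε' := by rw [hδ]; field_simp
  have hpt : ∀ T ∈ 𝒯.star z, ∃ p ∈ interior (convexHull ℝ (T : Set (E d))),
      p ∈ Metric.ball z δ := by
    intro T hT
    have hTs := 𝒯.isSimplex (mem_star.1 hT).1
    have hz : z ∈ closure (interior (convexHull ℝ (T : Set (E d)))) := by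
      rw [(convex_convexHull ℝ (T : Set (E d))).closure_interior_eq_closure_of_nonempty_interior
        ⟨_, barycenter_mem_interior hTs⟩]
      exact subset_closure (subset_convexHull ℝ _ (mem_star.1 hT).2)
    obtain ⟨p, hp, hpz⟩ := Metric.mem_closure_iff.1 hz δ hδ0
    exact ⟨p, hp, by rwa [Metric.mem_ball, dist_comm]⟩
  obtain ⟨p, hp, hpδ⟩ := hpt T hT
  obtain ⟨p', hp', hpδ'⟩ := hpt T' hT'
  obtain ⟨V, hV, hpV, hpV', hVb, hVF⟩ := h.exists_connecting hpδ hpδ'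
  rw [hδε] at hVb
  have hVr : V ⊆ Metric.ball z r := hVb.trans (Metric.ball_subset_ball (min_le_right _ _))
  have hpos : ∀ x ∈ V, x ∈ Ω → 0 < F x := fun x hx hxΩ => (h.mem_iff x (hVr hx)).1 hxΩ
  -- `F` is positive at both end points and the connecting set never drops below the smaller of the
  -- two values, so it does not leave `Ω`.
  have hVΩ : V ⊆ Ω := by
    intro y hy
    rw [h.mem_iff y (hVr hy)]
    have h1 := hpos p hpV (interior_simplex_subset hreg (mem_star.1 hT).1 hp)
    have h2 := hpos p' hpV' (interior_simplex_subset hreg (mem_star.1 hT').1 hp')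
    rcases hVF y hy with h3 | h3 <;> linarith
  let 𝒮 : Finset (Finset (E d)) := (𝒜 ×ˢ ℬ).image fun q => q.1 ∩ q.2
  -- If no element of `A` has a neighbour in `B`, they meet only in faces with fewer than `d`
  -- vertices, that is, in codimension two.
  have key : V ⊆ interior A ∨ V ⊆ interior B := by
    refine subset_interior_or_subset_interior (hcl 𝒜) (hcl ℬ) (𝒮 := 𝒮) (U := Ω ∩ Metric.ball z ε')
      ?_ (hΩ.inter Metric.isOpen_ball) ?_ ?_ hV (Set.subset_inter hVΩ hVb)
    · intro s hs
      obtain ⟨⟨T₁, T₂⟩, hq, rfl⟩ := Finset.mem_image.1 hs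
      obtain ⟨hq1, hq2⟩ := Finset.mem_product.1 hq
      obtain ⟨h1, h1P⟩ := Finset.mem_filter.1 hq1
      obtain ⟨h2, h2P⟩ := Finset.mem_filter.1 hq2
      have hne : T₂ ≠ T₁ := by rintro rfl; exact h2P h1P
      refine lt_of_le_of_ne (card_inter_le (mem_star.1 h1).1 (mem_star.1 h2).1 hne.symm) fun hc => ?_
      exact hno T₁ h1 T₂ h2 h1P h2P (mem_neighbors.2 ⟨(mem_star.1 h2).1, hne, hc⟩)
    · rintro x ⟨hxΩ, hxb⟩
      obtain ⟨T₁, hT₁, hx⟩ := 𝒯.exists_simplex (subset_closure hxΩ)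
      have hz := hball x (Metric.ball_subset_ball (min_le_left _ _) hxb) T₁ hT₁ hx
      have hTz : T ∈ 𝒯.elems ∧ z ∈ T := mem_star.1 hT
      have hst : T₁ ∈ 𝒯.star z := mem_star.2 ⟨hT₁, mem_of_vertex_mem hTz.1 hT₁ hTz.2 hz⟩
      by_cases hPT : P T₁
      · exact Or.inl (hmemA T₁ hst hPT hx)
      · exact Or.inr (hmemB T₁ hst hPT hx)
    · rintro x - hxA hxB
      obtain ⟨T₁, hT₁, hx₁⟩ := Set.mem_iUnion₂.1 hxA
      obtain ⟨T₂, hT₂, hx₂⟩ := Set.mem_iUnion₂.1 hxB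
      refine ⟨T₁ ∩ T₂, Finset.mem_image.2 ⟨(T₁, T₂), Finset.mem_product.2 ⟨hT₁, hT₂⟩, rfl⟩, ?_⟩
      exact inter_subset_affineSpan (mem_star.1 (Finset.mem_filter.1 hT₁).1).1
        (mem_star.1 (Finset.mem_filter.1 hT₂).1).1 ⟨hx₁, hx₂⟩
  -- An interior point of an element cannot be interior to a union of other elements, since overlaps
  -- are null. Applied to `p` and `p'`, this contradicts both alternatives of `key`.
  have hfin : ∀ (s : Finset (Finset (E d))) (T₀ : Finset (E d)) (p : E d), s ⊆ 𝒯.star z →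
      T₀ ∈ 𝒯.star z → T₀ ∉ s → p ∈ interior (convexHull ℝ (T₀ : Set (E d))) →
      p ∉ interior (⋃ T ∈ s, convexHull ℝ (T : Set (E d))) := by
    intro s T₀ p hs hT₀ hnot hp hps
    obtain ⟨y, ⟨hy1, hy2⟩, hyN⟩ := exists_mem_notMem_of_null
      (isOpen_interior.inter isOpen_interior) ⟨p, hp, hps⟩
      (N := ⋃ T ∈ s, convexHull ℝ (T : Set (E d)) ∩ convexHull ℝ (T₀ : Set (E d)))
      ((measure_biUnion_null_iff s.countable_toSet).2 fun T hT =>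
        volume_inter_eq_zero (mem_star.1 (hs hT)).1 (mem_star.1 hT₀).1
          (by rintro rfl; exact hnot hT))
    have hy3 := interior_subset hy2
    simp only [Set.mem_iUnion, exists_prop] at hy3
    obtain ⟨T₁, hT₁, hyT₁⟩ := hy3
    exact hyN (Set.mem_biUnion (Finset.mem_coe.2 hT₁) ⟨hyT₁, interior_subset hy1⟩)
  rcases key with hk | hk
  · exact hfin 𝒜 T' p' (Finset.filter_subset _ _) hT' (fun hm => hP' (Finset.mem_filter.1 hm).2)
      hp' (hk hpV')
  · exact hfin ℬ T p (Finset.filter_subset _ _) hT (fun hm => (Finset.mem_filter.1 hm).2 hP)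
      hp (hk hpV)

/-- Quantities that change little across sides change little in the star of a vertex. -/
lemma star_induction {z : E d} {r : ℝ} (hr : 0 < r) {L : ℝ≥0} {e : E d} {F : E d → ℝ}
    (h : IsGraphDomain Ω z r L e F) (hΩ : IsOpen Ω) (hreg : interior (closure Ω) ⊆ Ω)
    {T : Finset (E d)} (hT : T ∈ 𝒯.star z) (Q : ℕ → Finset (E d) → Prop) (h0 : Q 0 T)
    (hmono : ∀ n T', Q n T' → Q (n + 1) T')
    (hstep : ∀ n, ∀ T₁ ∈ 𝒯.star z, ∀ T₂ ∈ 𝒯.star z, T₂ ∈ 𝒯.neighbors T₁ → Q n T₁ → Q (n + 1) T₂) :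
    ∀ T' ∈ 𝒯.star z, Q (𝒯.star z).card T' := by
  have hmono' : ∀ n m T', n ≤ m → Q n T' → Q m T' := by
    intro n m T' hnm hn
    induction m, hnm using Nat.le_induction with
    | base => exact hn
    | succ k _ ih => exact hmono k T' ih
  let S : ℕ → Finset (Finset (E d)) := fun n => (𝒯.star z).filter (Q n ·)
  -- As long as the set where `Q n` holds is not the whole star, the next round adds at least one
  -- element; hence as many rounds as there are elements suffice.
  have key : ∀ n, S n = 𝒯.star z ∨ n + 1 ≤ (S n).card := by
    intro n
    induction n with
    | zero =>
      right
      exact Finset.card_pos.2 ⟨T, Finset.mem_filter.2 ⟨hT, h0⟩⟩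
    | succ n ih =>
      have hsub : S n ⊆ S (n + 1) := fun T' hT' =>
        Finset.mem_filter.2 ⟨(Finset.mem_filter.1 hT').1, hmono n T' (Finset.mem_filter.1 hT').2⟩
      by_cases hall : S n = 𝒯.star z
      · left
        exact (Finset.filter_subset _ _).antisymm (hall.symm.trans_subset hsub)
      · right
        have ih := ih.resolve_left hall
        have : ∃ T' ∈ 𝒯.star z, ¬ Q n T' := by
          by_contra! hcon
          exact hall (Finset.filter_true_of_mem hcon)
        obtain ⟨T', hT', hQ'⟩ := this
        obtain ⟨T₁, hT₁, T₂, hT₂, hQ1, hQ2, hnb⟩ := exists_neighbor_of_split hr h hΩ hreg (Q n)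
          hT hT' (hmono' 0 n T (Nat.zero_le _) h0) hQ'
        have hss : S n ⊂ S (n + 1) := (Finset.ssubset_iff_of_subset hsub).2
          ⟨T₂, Finset.mem_filter.2 ⟨hT₂, hstep n T₁ hT₁ T₂ hT₂ hnb hQ1⟩,
            fun hm => hQ2 (Finset.mem_filter.1 hm).2⟩
        have := Finset.card_lt_card hss
        omega
  intro T' hT'
  rcases key (𝒯.star z).card with hk | hk
  · rw [← hk] at hT'
    exact (Finset.mem_filter.1 hT').2
  · have := Finset.card_le_card (Finset.filter_subset (Q (𝒯.star z).card ·) (𝒯.star z))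
    exact absurd (hk.trans this) (by omega)

lemma IsShapeRegular.size_pos {σ : ℝ} (h : 𝒯.IsShapeRegular σ) (hd : 0 < d) {T : Finset (E d)}
    (hT : T ∈ 𝒯.elems) : 0 < size T := by
  obtain ⟨c, ρ, hρ, hb, -⟩ := h T hT
  have hTs := 𝒯.isSimplex hT
  obtain ⟨p, hp, q, hq, hpq⟩ := Finset.one_lt_card.1 (show 1 < T.card by rw [hTs.card_eq]; omega)
  exact hρ.trans_le ((le_dist_vertices hTs hρ hb hq hp hpq).trans
    (dist_le_size (subset_convexHull ℝ _ hp) (subset_convexHull ℝ _ hq)))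

/-- Simplices that share an edge have comparable sizes. -/
lemma IsShapeRegular.size_le_of_edge {σ : ℝ} (h : 𝒯.IsShapeRegular σ) (hσ : 0 ≤ σ)
    {T T' : Finset (E d)} (hT : T ∈ 𝒯.elems)
    {p q : E d} (hp : p ∈ T) (hq : q ∈ T) (hpq : p ≠ q) (hp' : p ∈ T') (hq' : q ∈ T') :
    size T ≤ σ * size T' := by
  obtain ⟨c, ρ, hρ, hb, hs⟩ := h T hT
  refine hs.trans (mul_le_mul_of_nonneg_left ?_ hσ)
  exact (le_dist_vertices (𝒯.isSimplex hT) hρ hb hq hp hpq).trans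
    (dist_le_size (subset_convexHull ℝ _ hp') (subset_convexHull ℝ _ hq'))

/-- All simplices at a vertex have comparable sizes. -/
lemma IsShapeRegular.size_le_of_star {σ : ℝ} (h : 𝒯.IsShapeRegular σ) (hσ : 1 ≤ σ) (hd : 2 ≤ d)
    {z : E d} {r : ℝ} (hr : 0 < r) {L : ℝ≥0} {e : E d} {F : E d → ℝ}
    (hg : IsGraphDomain Ω z r L e F) (hΩ : IsOpen Ω) (hreg : interior (closure Ω) ⊆ Ω)
    {T T' : Finset (E d)} (hT : T ∈ 𝒯.star z) (hT' : T' ∈ 𝒯.star z) :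
    size T' ≤ σ ^ (𝒯.star z).card * size T := by
  refine star_induction hr hg hΩ hreg hT (fun n T' => size T' ≤ σ ^ n * size T) (by simp) ?_ ?_
    T' hT'
  · intro n T' hn
    refine hn.trans (mul_le_mul_of_nonneg_right ?_ (size_nonneg T))
    exact pow_le_pow_right₀ hσ (Nat.le_succ n)
  · intro n T₁ hT₁ T₂ hT₂ hnb hn
    have hcard := (mem_neighbors.1 hnb).2.2
    have hz : z ∈ T₁ ∩ T₂ := Finset.mem_inter.2 ⟨(mem_star.1 hT₁).2, (mem_star.1 hT₂).2⟩
    -- Here `d ≥ 2` matters: the common side has a vertex besides `z`, hence an edge through which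
    -- sizes can be compared.
    obtain ⟨p, hp, hpz⟩ := Finset.exists_mem_ne (by omega : 1 < (T₁ ∩ T₂).card) z
    have h1 := h.size_le_of_edge (by linarith) (mem_star.1 hT₂).1 (Finset.mem_inter.1 hp).2
      (Finset.mem_inter.1 hz).2 hpz (Finset.mem_inter.1 hp).1 (Finset.mem_inter.1 hz).1
    calc size T₂ ≤ σ * size T₁ := h1
      _ ≤ σ * (σ ^ n * size T) := by gcongr
      _ = σ ^ (n + 1) * size T := by ring

/-- The number of simplices at a vertex is bounded in terms of the shape regularity. -/
lemma IsShapeRegular.card_star_le {σ : ℝ} (h : 𝒯.IsShapeRegular σ) (hσ : 1 ≤ σ) (hd : 0 < d)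
    (z : E d) : ((𝒯.star z).card : ℝ) ≤ (2 * σ) ^ d := by
  rcases (𝒯.star z).eq_empty_or_nonempty with he | hne
  · rw [he]; simp; positivity
  have hσ0 : 0 < σ := by linarith
  obtain ⟨T₀, hT₀, hmin⟩ := Finset.exists_min_image (𝒯.star z) size hne
  set s := size T₀ with hs
  have hs0 : 0 < s := h.size_pos hd (mem_star.1 hT₀).1
  -- Each element is shrunk towards `z` until its size is the minimal one, `s`. Its inscribed ball
  -- then has radius at least `s / σ` and lies in `B(z, 2s)`. As the elements overlap in null sets,
  -- comparing volumes bounds their number.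
  have hball : ∀ T ∈ 𝒯.star z, ∃ c, Metric.ball c (s / σ) ⊆
      convexHull ℝ (T : Set (E d)) ∩ Metric.ball z (2 * s) := by
    intro T hT
    obtain ⟨c, ρ, hρ, hb, hsz⟩ := h T (mem_star.1 hT).1
    have hT0 := h.size_pos hd (mem_star.1 hT).1
    have hzT : z ∈ convexHull ℝ (T : Set (E d)) := subset_convexHull ℝ _ (mem_star.1 hT).2
    set t := s / size T with ht
    have ht0 : 0 < t := div_pos hs0 hT0
    have ht1 : t ≤ 1 := (div_le_one hT0).2 (hmin T hT)
    have hts : t * size T = s := by rw [ht]; field_simp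
    have hcz : dist c z ≤ size T := dist_le_size (hb (Metric.mem_ball_self hρ)) hzT
    have hsσ : s / σ ≤ t * ρ := by
      rw [div_le_iff₀ hσ0, ← hts]
      calc t * size T ≤ t * (σ * ρ) := by gcongr
        _ = t * ρ * σ := by ring
    refine ⟨z + t • (c - z), fun x hx => ⟨?_, ?_⟩⟩
    · have hx' : z + t⁻¹ • (x - z) ∈ Metric.ball c ρ := by
        rw [Metric.mem_ball, dist_eq_norm] at hx ⊢
        have e1 : z + t⁻¹ • (x - z) - c = t⁻¹ • (x - (z + t • (c - z))) := by
          rw [← sub_sub, smul_sub _ (x - z), inv_smul_smul₀ ht0.ne']; abel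
        rw [e1, norm_smul, norm_inv, Real.norm_eq_abs, abs_of_pos ht0, inv_mul_lt_iff₀ ht0]
        exact hx.trans_le hsσ
      have := (convex_convexHull ℝ (T : Set (E d))).add_smul_sub_mem hzT (hb hx') ⟨ht0.le, ht1⟩
      rwa [add_sub_cancel_left, smul_inv_smul₀ ht0.ne', add_sub_cancel] at this
    · rw [Metric.mem_ball] at hx ⊢
      have h1 := dist_triangle x (z + t • (c - z)) z
      have h2 : dist (z + t • (c - z)) z ≤ s := by
        rw [dist_eq_norm, add_sub_cancel_left, norm_smul, Real.norm_eq_abs, abs_of_pos ht0,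
          ← dist_eq_norm, ← hts]
        gcongr
      have h3 : s / σ ≤ s := div_le_self hs0.le hσ
      linarith
  have hvol : ∑ T ∈ 𝒯.star z, volume (convexHull ℝ (T : Set (E d)) ∩ Metric.ball z (2 * s)) ≤
      volume (Metric.ball z (2 * s)) := by
    rw [← measure_biUnion_finset₀]
    · exact measure_mono (Set.iUnion₂_subset fun _ _ => Set.inter_subset_right)
    · intro T hT T' hT' hne
      refine measure_mono_null ?_ (volume_inter_eq_zero (mem_star.1 hT).1 (mem_star.1 hT').1 hne)
      exact Set.inter_subset_inter Set.inter_subset_left Set.inter_subset_left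
    · intro T _
      exact ((measurableSet_simplex T).inter Metric.isOpen_ball.measurableSet).nullMeasurableSet
  have hsσ0 : 0 < s / σ := div_pos hs0 hσ0
  have hlow : ((𝒯.star z).card : ℝ≥0∞) * volume (Metric.ball (0 : E d) (s / σ)) ≤
      volume (Metric.ball (0 : E d) (2 * s)) := by
    rw [← Measure.addHaar_ball_center volume z (2 * s)]
    refine le_trans ?_ hvol
    rw [← nsmul_eq_mul, ← Finset.sum_const]
    refine Finset.sum_le_sum fun T hT => ?_
    obtain ⟨c, hc⟩ := hball T hT
    rw [← Measure.addHaar_ball_center volume c (s / σ)]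
    exact measure_mono hc
  rw [Measure.addHaar_ball_of_pos _ _ hsσ0, Measure.addHaar_ball_of_pos _ _ (by positivity : 0 < 2 * s),
    finrank_euclideanSpace_fin, ← mul_assoc,
    ENNReal.mul_le_mul_iff_left (Metric.measure_ball_pos volume _ one_pos).ne'
      measure_ball_lt_top.ne] at hlow
  rw [← ENNReal.ofReal_natCast, ← ENNReal.ofReal_mul (by positivity),
    ENNReal.ofReal_le_ofReal_iff (by positivity)] at hlow
  have : ((𝒯.star z).card : ℝ) ≤ (2 * s) ^ d / (s / σ) ^ d := by
    rwa [le_div_iff₀ (by positivity)]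
  refine this.trans (le_of_eq ?_)
  rw [← div_pow]
  congr 1
  field_simp

end Mesh

end SemilinearFEM

namespace SemilinearFEM

open scoped Classical

variable {d : ℕ}

/-! ### Gluing Lipschitz functions -/

/-- A function whose increments at each point are locally bounded by `L` is `L`-Lipschitz. -/
lemma lipschitzWith_of_eventually {u : E d → ℝ} {L : ℝ≥0}
    (h : ∀ x, ∀ᶠ y in 𝓝 x, dist (u y) (u x) ≤ L * dist y x) : LipschitzWith L u := by
  have hcont : Continuous u := by
    rw [continuous_iff_continuousAt]
    intro x
    rw [ContinuousAt, tendsto_iff_dist_tendsto_zero]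
    have h1 : Tendsto (fun y => (L : ℝ) * dist y x) (𝓝 x) (𝓝 0) := by
      have : Continuous fun y => (L : ℝ) * dist y x := by fun_prop
      simpa using this.tendsto x
    exact squeeze_zero' (Eventually.of_forall fun _ => dist_nonneg) (h x) h1
  have key : ∀ x y, u y - u x ≤ L * dist y x := by
    intro x y
    set K : ℝ := L * dist y x with hK
    let γ : ℝ → E d := fun t => x + t • (y - x)
    have hγ : Continuous γ := by fun_prop
    have hγd : ∀ s t, dist (γ s) (γ t) = |s - t| * dist y x := by
      intro s t
      simp only [γ]
      rw [dist_eq_norm, add_sub_add_left_eq_sub, ← sub_smul, norm_smul, Real.norm_eq_abs,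
        ← dist_eq_norm]
    -- Along a segment, the local bound controls the right slopes of `u`, and the comparison
    -- principle with a linear function turns this into the global bound.
    have := image_le_of_liminf_slope_right_le_deriv_boundary (f := fun t => u (γ t) - u x)
      (a := 0) (b := 1) (B := fun t => K * t) (B' := fun _ => K)
      ((hcont.comp hγ).sub continuous_const).continuousOn (by simp [γ])
      (by fun_prop) (fun t _ => by simpa using ((hasDerivAt_id t).const_mul K).hasDerivWithinAt) ?_
      (x := 1) (by simp)
    · simpa [γ] using this
    · intro t _ r hr
      refine Eventually.frequently ?_
      have h1 : ∀ᶠ s in 𝓝[>] t, dist (u (γ s)) (u (γ t)) ≤ L * dist (γ s) (γ t) :=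
        (hγ.continuousAt.eventually (h (γ t))).filter_mono nhdsWithin_le_nhds
      filter_upwards [h1, self_mem_nhdsWithin] with s hs hst
      have hst : 0 < s - t := sub_pos.2 hst
      rw [slope_def_field, div_lt_iff₀ hst]
      have h2 : u (γ s) - u x - (u (γ t) - u x) ≤ K * (s - t) := by
        rw [hγd, abs_of_pos hst] at hs
        have h3 := le_abs_self (u (γ s) - u (γ t))
        rw [Real.dist_eq] at hs
        calc _ = u (γ s) - u (γ t) := by ring
          _ ≤ _ := h3.trans hs
          _ = _ := by rw [hK]; ring
      nlinarith
  refine LipschitzWith.of_dist_le_mul fun x y => ?_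
  rw [Real.dist_eq, abs_le]
  have h1 := key x y
  have h2 := key y x
  rw [dist_comm y x] at h1
  constructor <;> linarith

namespace Mesh

variable {Ω : Set (E d)} {𝒯 : Mesh Ω}

/-- A local check suffices. A point `y` near `x` either lies in `Ω` and shares an element with `x`,
or lies outside, and then `x` is outside too and both values are zero. No geometry of the boundary
is needed. -/
lemma exists_lipschitzWith (𝒯 : Mesh Ω) (hΩ : IsOpen Ω) {u : E d → ℝ} (h0 : ∀ x ∉ Ω, u x = 0)
    (h : ∀ T ∈ 𝒯.elems, ∃ L : ℝ≥0, LipschitzOnWith L u (convexHull ℝ (T : Set (E d)))) :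
    ∃ L, LipschitzWith L u := by
  choose! L hL using h
  refine ⟨𝒯.elems.sup L, lipschitzWith_of_eventually fun x => ?_⟩
  have h1 : ∀ᶠ y in 𝓝 x, x ∈ Ω → y ∈ Ω := by
    by_cases hx : x ∈ Ω
    · filter_upwards [hΩ.mem_nhds hx] with y hy _ using hy
    · exact Eventually.of_forall fun _ h => absurd h hx
  filter_upwards [𝒯.eventually_mem_simplex x, h1] with y hy hy1
  by_cases hyΩ : y ∈ Ω
  · obtain ⟨T, hT, hyT⟩ := 𝒯.exists_simplex (subset_closure hyΩ)
    refine ((hL T hT).dist_le_mul y hyT x (hy T hT hyT)).trans ?_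
    gcongr
    exact Finset.le_sup hT
  · rw [h0 y hyΩ, h0 x fun hx => hyΩ (hy1 hx), dist_self]
    positivity

/-! ### Decomposition of integrals -/

/-- Both the frontier of `Ω` and the overlaps of the elements are null sets. -/
lemma restrict_eq_sum (𝒯 : Mesh Ω) (hΩ : IsOpen Ω) (hreg : interior (closure Ω) ⊆ Ω) :
    (volume.restrict Ω : Measure (E d)) =
      ∑ T ∈ 𝒯.elems, volume.restrict (convexHull ℝ (T : Set (E d))) := by
  have h1 : (Ω : Set (E d)) =ᵐ[volume] closure Ω := by
    refine (ae_eq_set).2 ⟨by simp [Set.sdiff_eq_empty.2 subset_closure], ?_⟩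
    rw [← hΩ.frontier_eq]
    exact 𝒯.volume_frontier_eq_zero hΩ hreg
  have h2 : (⋃ T ∈ 𝒯.elems, convexHull ℝ (T : Set (E d))) =
      ⋃ T : 𝒯.elems, convexHull ℝ ((T : Finset (E d)) : Set (E d)) := by
    ext; simp
  rw [Measure.restrict_congr_set h1, ← 𝒯.cover, h2, Measure.restrict_iUnion_ae,
    Measure.sum_fintype]
  · exact Finset.sum_coe_sort 𝒯.elems
      fun T : Finset (E d) => volume.restrict (convexHull ℝ (T : Set (E d)))
  · intro T T' hne
    exact volume_inter_eq_zero T.2 T'.2 fun h => hne (Subtype.ext h)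
  · exact fun T => (measurableSet_simplex _).nullMeasurableSet

lemma restrict_le (𝒯 : Mesh Ω) (hΩ : IsOpen Ω) (hreg : interior (closure Ω) ⊆ Ω)
    {T : Finset (E d)} (hT : T ∈ 𝒯.elems) :
    (volume.restrict (convexHull ℝ (T : Set (E d))) : Measure (E d)) ≤ volume.restrict Ω := by
  rw [𝒯.restrict_eq_sum hΩ hreg]
  exact Finset.single_le_sum (f := fun T : Finset (E d) =>
    (volume.restrict (convexHull ℝ (T : Set (E d))) : Measure (E d))) (fun _ _ => Measure.zero_le _) hT

lemma ae_of_forall_simplex (𝒯 : Mesh Ω) (hΩ : IsOpen Ω) (hreg : interior (closure Ω) ⊆ Ω)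
    {p : E d → Prop}
    (h : ∀ T ∈ 𝒯.elems, ∀ᵐ x ∂(volume.restrict (convexHull ℝ (T : Set (E d)))), p x) :
    ∀ᵐ x ∂(volume.restrict Ω), p x := by
  rw [𝒯.restrict_eq_sum hΩ hreg, ae_iff, Measure.finsetSum_apply]
  exact Finset.sum_eq_zero fun T hT => ae_iff.1 (h T hT)

lemma ae_mem_interior (T : Finset (E d)) :
    ∀ᵐ x ∂(volume.restrict (convexHull ℝ (T : Set (E d)))),
      x ∈ interior (convexHull ℝ (T : Set (E d))) := by
  rw [ae_restrict_iff' (measurableSet_simplex T)]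
  have : ∀ᵐ x ∂(volume : Measure (E d)), x ∉ frontier (convexHull ℝ (T : Set (E d))) :=
    measure_eq_zero_iff_ae_notMem.1 ((convex_convexHull ℝ _).addHaar_frontier _)
  filter_upwards [this] with x hx hxT
  by_contra hi
  exact hx ⟨subset_closure hxT, hi⟩

lemma aestronglyMeasurable_of_forall_simplex {F : Type*} [TopologicalSpace F]
    [TopologicalSpace.PseudoMetrizableSpace F] (𝒯 : Mesh Ω) (hΩ : IsOpen Ω)
    (hreg : interior (closure Ω) ⊆ Ω) {f : E d → F}
    (h : ∀ T ∈ 𝒯.elems,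
      AEStronglyMeasurable f (volume.restrict (convexHull ℝ (T : Set (E d))))) :
    AEStronglyMeasurable f (volume.restrict Ω) := by
  rw [𝒯.restrict_eq_sum hΩ hreg, ← Finset.sum_coe_sort, ← Measure.sum_fintype,
    aestronglyMeasurable_sum_measure_iff]
  exact fun T => h T T.2

lemma integrable_of_forall_simplex {F : Type*} [NormedAddCommGroup F] (𝒯 : Mesh Ω) (hΩ : IsOpen Ω)
    (hreg : interior (closure Ω) ⊆ Ω) {f : E d → F}
    (h : ∀ T ∈ 𝒯.elems, IntegrableOn f (convexHull ℝ (T : Set (E d)))) :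
    IntegrableOn f Ω := by
  rw [IntegrableOn, 𝒯.restrict_eq_sum hΩ hreg, integrable_finsetSum_measure]
  exact h

lemma integral_eq_sum {F : Type*} [NormedAddCommGroup F] [NormedSpace ℝ F] (𝒯 : Mesh Ω)
    (hΩ : IsOpen Ω) (hreg : interior (closure Ω) ⊆ Ω) {f : E d → F} (hf : IntegrableOn f Ω) :
    ∫ x in Ω, f x = ∑ T ∈ 𝒯.elems, ∫ x in convexHull ℝ (T : Set (E d)), f x := by
  rw [𝒯.restrict_eq_sum hΩ hreg]
  rw [IntegrableOn, 𝒯.restrict_eq_sum hΩ hreg, integrable_finsetSum_measure] at hf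
  exact integral_finsetSum_measure hf

/-! ### Piecewise affine functions -/

/-- `v` is affine on each simplex, with gradient `b T` on `T`. -/
def PwAffine (𝒯 : Mesh Ω) (v : E d → ℝ) (b : Finset (E d) → E d) : Prop :=
  ∀ T ∈ 𝒯.elems, ∃ c : ℝ, ∀ x ∈ convexHull ℝ (T : Set (E d)), v x = ⟪b T, x⟫ + c

variable {v : E d → ℝ} {b : Finset (E d) → E d}

lemma _root_.SemilinearFEM.hasGradientAt_affine (b : E d) (c : ℝ) (x : E d) :
    HasGradientAt (fun x => ⟪b, x⟫ + c) b x := by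
  rw [hasGradientAt_iff_hasFDerivAt]
  exact ((InnerProductSpace.toDual ℝ (E d) b).hasFDerivAt).add_const c

lemma PwAffine.hasGradientAt (h : 𝒯.PwAffine v b) {T : Finset (E d)} (hT : T ∈ 𝒯.elems) {x : E d}
    (hx : x ∈ interior (convexHull ℝ (T : Set (E d)))) : HasGradientAt v (b T) x := by
  obtain ⟨c, hc⟩ := h T hT
  have h1 := hasGradientAt_affine (b T) c x
  rw [hasGradientAt_iff_hasFDerivAt] at h1 ⊢
  refine h1.congr_of_eventuallyEq ?_
  filter_upwards [mem_interior_iff_mem_nhds.1 hx] with y hy using hc y hy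

lemma PwAffine.gradient_ae (h : 𝒯.PwAffine v b) {T : Finset (E d)} (hT : T ∈ 𝒯.elems) :
    ∀ᵐ x ∂(volume.restrict (convexHull ℝ (T : Set (E d)))), gradient v x = b T := by
  filter_upwards [ae_mem_interior T] with x hx using (h.hasGradientAt hT hx).gradient

lemma PwAffine.elementGradient_eq (h : 𝒯.PwAffine v b) {T : Finset (E d)} (hT : T ∈ 𝒯.elems) :
    elementGradient v T = b T :=
  (h.hasGradientAt hT (barycenter_mem_interior (𝒯.isSimplex hT))).gradient

lemma PwAffine.continuousOn_simplex (h : 𝒯.PwAffine v b) {T : Finset (E d)} (hT : T ∈ 𝒯.elems) :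
    ContinuousOn v (convexHull ℝ (T : Set (E d))) := by
  obtain ⟨c, hc⟩ := h T hT
  exact (by fun_prop : ContinuousOn (fun x => ⟪b T, x⟫ + c) _).congr hc

lemma PwAffine.continuousOn (h : 𝒯.PwAffine v b) : ContinuousOn v (closure Ω) := by
  intro x hx
  have h1 : ContinuousWithinAt v
      (⋃ T ∈ ((𝒯.elems.filter fun T : Finset (E d) => x ∈ convexHull ℝ (T : Set (E d)) :
        Finset (Finset (E d))) : Set (Finset (E d))), convexHull ℝ (T : Set (E d))) x := by
    rw [ContinuousWithinAt, nhdsWithin_biUnion (Finset.finite_toSet _)]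
    simp only [tendsto_iSup]
    intro T hT
    obtain ⟨hT, hxT⟩ := Finset.mem_filter.1 (Finset.mem_coe.1 hT)
    exact h.continuousOn_simplex hT x hxT
  refine h1.mono_of_mem_nhdsWithin ?_
  filter_upwards [(𝒯.eventually_mem_simplex x).filter_mono nhdsWithin_le_nhds,
    self_mem_nhdsWithin] with y hy hyc
  obtain ⟨T, hT, hyT⟩ := 𝒯.exists_simplex hyc
  exact Set.mem_biUnion (Finset.mem_coe.2 (Finset.mem_filter.2 ⟨hT, hy T hT hyT⟩)) hyT

lemma PwAffine.exists_bound (h : 𝒯.PwAffine v b) : ∃ M : ℝ, 0 < M ∧ ∀ x ∈ closure Ω, |v x| ≤ M := by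
  have : ∀ T ∈ 𝒯.elems, ∃ M : ℝ, ∀ x ∈ convexHull ℝ (T : Set (E d)), |v x| ≤ M := fun T hT =>
    (isCompact_simplex T).exists_bound_of_continuousOn (h.continuousOn_simplex hT)
  choose! M hM using this
  refine ⟨∑ T ∈ 𝒯.elems, |M T| + 1, by positivity, fun x hx => ?_⟩
  obtain ⟨T, hT, hxT⟩ := 𝒯.exists_simplex hx
  have h1 := hM T hT x hxT
  have h2 := Finset.single_le_sum (f := fun T => |M T|) (fun _ _ => abs_nonneg _) hT
  have h3 := le_abs_self (M T)
  linarith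

end Mesh

end SemilinearFEM

namespace SemilinearFEM

open scoped Classical

variable {d : ℕ}

/-! ### Gradients, test functions and weak gradients of piecewise affine functions -/

lemma inner_gradient (f : E d → ℝ) (x w : E d) : ⟪gradient f x, w⟫ = fderiv ℝ f x w := by
  rw [gradient, InnerProductSpace.toDual_symm_apply]

lemma norm_gradient (f : E d → ℝ) (x : E d) : ‖gradient f x‖ = ‖fderiv ℝ f x‖ := by
  rw [gradient, LinearIsometryEquiv.norm_map]

lemma continuous_gradient {f : E d → ℝ} (hf : ContDiff ℝ 1 f) : Continuous (gradient f) :=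
  (InnerProductSpace.toDual ℝ (E d)).symm.continuous.comp (hf.continuous_fderiv one_ne_zero)

lemma gradient_eq_zero_of_notMem_tsupport {f : E d → ℝ} {x : E d} (hx : x ∉ tsupport f) :
    gradient f x = 0 := by
  have : fderiv ℝ f x = 0 := by
    by_contra h
    exact hx (support_fderiv_subset ℝ (Function.mem_support.2 h))
  rw [gradient, this, map_zero]

lemma IsTestFunction.continuous_gradient {Ω : Set (E d)} {φ : E d → ℝ} (h : IsTestFunction Ω φ) :
    Continuous (gradient φ) := SemilinearFEM.continuous_gradient (h.contDiff.of_le (by simp))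

lemma IsTestFunction.hasCompactSupport_gradient {Ω : Set (E d)} {φ : E d → ℝ}
    (h : IsTestFunction Ω φ) : HasCompactSupport (gradient φ) :=
  HasCompactSupport.of_support_subset_isCompact h.hasCompactSupport fun x hx => by
    by_contra hn
    exact hx (gradient_eq_zero_of_notMem_tsupport hn)

lemma IsTestFunction.eq_zero {Ω : Set (E d)} {φ : E d → ℝ} (h : IsTestFunction Ω φ) {x : E d}
    (hx : x ∉ Ω) : φ x = 0 := image_eq_zero_of_notMem_tsupport fun hn => hx (h.tsupport_subset hn)

lemma IsTestFunction.gradient_eq_zero {Ω : Set (E d)} {φ : E d → ℝ} (h : IsTestFunction Ω φ)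
    {x : E d} (hx : x ∉ Ω) : gradient φ x = 0 :=
  gradient_eq_zero_of_notMem_tsupport fun hn => hx (h.tsupport_subset hn)

namespace Mesh

variable {Ω : Set (E d)} {𝒯 : Mesh Ω} {v : E d → ℝ} {b : Finset (E d) → E d}

lemma PwAffine.integrableOn_mul_gradient (h : 𝒯.PwAffine v b) (hΩ : IsOpen Ω)
    (hreg : interior (closure Ω) ⊆ Ω) {φ : E d → ℝ} (hφ : ContDiff ℝ 1 φ) :
    IntegrableOn (fun x => v x • gradient φ x) Ω :=
  𝒯.integrable_of_forall_simplex hΩ hreg fun T hT =>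
    ((h.continuousOn_simplex hT).smul
      (continuous_gradient hφ).continuousOn).integrableOn_compact (isCompact_simplex T)

lemma PwAffine.integrableOn_gradient_mul (h : 𝒯.PwAffine v b) (hΩ : IsOpen Ω)
    (hreg : interior (closure Ω) ⊆ Ω) {φ : E d → ℝ} (hφ : Continuous φ) :
    IntegrableOn (fun x => φ x • gradient v x) Ω :=
  𝒯.integrable_of_forall_simplex hΩ hreg fun T hT => by
    have h1 : IntegrableOn (fun x => φ x • b T) (convexHull ℝ (T : Set (E d))) :=
      (hφ.smul continuous_const).continuousOn.integrableOn_compact (isCompact_simplex T)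
    refine h1.congr ?_
    filter_upwards [h.gradient_ae hT] with x hx
    simp only [hx]

/-- The product of a piecewise affine function and a test function, extended by zero, has a
derivative with vanishing mean. -/
lemma PwAffine.integral_derivative_eq_zero (h : 𝒯.PwAffine v b) (hΩ : IsOpen Ω)
    (hreg : interior (closure Ω) ⊆ Ω) {φ : E d → ℝ} (hφ : IsTestFunction Ω φ) (w : E d) :
    ∫ x in Ω, (φ x * ⟪gradient v x, w⟫ + v x * ⟪gradient φ x, w⟫) = 0 := by
  have hφ1 : ContDiff ℝ 1 φ := hφ.contDiff.of_le (by simp)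
  set u : E d → ℝ := fun x => v x * φ x with hu
  have hu0 : ∀ x ∉ tsupport φ, u x = 0 := fun x hx => by
    simp [hu, image_eq_zero_of_notMem_tsupport hx]
  have hus : HasCompactSupport u :=
    HasCompactSupport.of_support_subset_isCompact hφ.hasCompactSupport fun x hx => by
      by_contra hn
      exact hx (hu0 x hn)
  obtain ⟨L, hL⟩ : ∃ L, LipschitzWith L u := by
    refine 𝒯.exists_lipschitzWith hΩ (fun x hx => hu0 x fun hn => hx (hφ.tsupport_subset hn)) ?_
    intro T hT
    obtain ⟨c, hc⟩ := h T hT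
    have h1 : ContDiff ℝ 1 fun x => (⟪b T, x⟫ + c) * φ x :=
      ((contDiff_const.inner ℝ contDiff_id).add contDiff_const).mul hφ1
    obtain ⟨L, hL⟩ := h1.lipschitzWith_of_hasCompactSupport hφ.hasCompactSupport.mul_left one_ne_zero
    refine ⟨L, fun x hx y hy => ?_⟩
    have := hL x y
    simpa [hu, hc x hx, hc y hy] using this
  have h1 : ∫ x, lineDeriv ℝ u x w = 0 := by
    -- Integration by parts for Lipschitz functions, against the constant `1`: directional
    -- derivatives of a compactly supported Lipschitz function have mean zero.
    have := (LipschitzWith.const (1 : ℝ)).integral_lineDeriv_mul_eq (μ := volume) hL hus (-w)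
    simp only [neg_neg, mul_one] at this
    rw [← this]
    simp [lineDeriv]
  have h2 : ∫ x in Ω, lineDeriv ℝ u x w = 0 := by
    rw [setIntegral_eq_integral_of_forall_compl_eq_zero, h1]
    intro x hx
    have hev : u =ᶠ[𝓝 x] fun _ => 0 := by
      filter_upwards [(isClosed_tsupport φ).isOpen_compl.mem_nhds
        fun hn => hx (hφ.tsupport_subset hn)] with y hy using hu0 y hy
    rw [hev.lineDeriv_eq]
    simp [lineDeriv]
  rw [← h2]
  refine integral_congr_ae (𝒯.ae_of_forall_simplex hΩ hreg fun T hT => ?_)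
  filter_upwards [ae_mem_interior T] with x hx
  have hv := h.hasGradientAt hT hx
  have hφx : HasFDerivAt φ (fderiv ℝ φ x) x := (hφ1.differentiable one_ne_zero x).hasFDerivAt
  have h3 := hv.hasFDerivAt.mul hφx
  change _ = lineDeriv ℝ (v * φ) x w
  rw [(h3.hasLineDerivAt w).lineDeriv, hv.gradient, inner_gradient]
  simp
  ring

/-- The elementwise gradient of a piecewise affine function is its weak gradient. -/
lemma PwAffine.hasWeakGradient (h : 𝒯.PwAffine v b) (hΩ : IsOpen Ω)
    (hreg : interior (closure Ω) ⊆ Ω) : HasWeakGradient Ω v (gradient v) := by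
  intro φ hφ
  have hφ1 : ContDiff ℝ 1 φ := hφ.contDiff.of_le (by simp)
  have i1 := h.integrableOn_mul_gradient hΩ hreg hφ1
  have i2 := h.integrableOn_gradient_mul hΩ hreg hφ1.continuous
  rw [← add_eq_zero_iff_eq_neg, ← integral_add i1 i2]
  refine ext_inner_right ℝ fun w => ?_
  have e1 := integral_inner (𝕜 := ℝ) (i1.add i2) w
  simp only [Pi.add_apply] at e1
  rw [inner_zero_left, real_inner_comm, ← e1,
    ← h.integral_derivative_eq_zero hΩ hreg hφ w]
  refine integral_congr_ae (Eventually.of_forall fun x => ?_)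
  simp only [inner_add_right, inner_smul_right, real_inner_comm w]
  ring

/-- Weak gradients of piecewise affine functions are elementwise gradients. -/
lemma PwAffine.ae_eq_of_memH1 (h : 𝒯.PwAffine v b) (hΩ : IsOpen Ω)
    (hreg : interior (closure Ω) ⊆ Ω) {g : E d → E d} (hg : MemLp g 2 (volume.restrict Ω))
    (hw : HasWeakGradient Ω v g) {T : Finset (E d)} (hT : T ∈ 𝒯.elems) :
    ∀ᵐ x ∂(volume.restrict (convexHull ℝ (T : Set (E d)))), g x = b T := by
  have hloc : LocallyIntegrableOn (fun x => g x - gradient v x) Ω := by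
    refine LocallyIntegrableOn.sub ?_ ?_
    · exact locallyIntegrableOn_of_locallyIntegrable_restrict (hg.locallyIntegrable (by norm_num))
    · have := h.integrableOn_gradient_mul hΩ hreg (continuous_const (y := (1 : ℝ)))
      simp only [one_smul] at this
      exact this.locallyIntegrableOn
  -- The two weak gradients have the same pairings with test functions, so the fundamental lemma of
  -- the calculus of variations identifies them.
  have key := hΩ.ae_eq_zero_of_integral_contDiff_smul_eq_zero hloc ?_
  · rw [← ae_restrict_iff' hΩ.measurableSet] at key
    filter_upwards [ae_mono (𝒯.restrict_le hΩ hreg hT) key, h.gradient_ae hT] with x hx hx'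
    rw [← hx', sub_eq_zero.1 hx]
  · intro φ h1 h2 h3
    have hφ : IsTestFunction Ω φ := ⟨h1, h2, h3⟩
    have e1 := hw φ hφ
    rw [h.hasWeakGradient hΩ hreg φ hφ, neg_inj] at e1
    rw [← setIntegral_eq_integral_of_forall_compl_eq_zero (s := Ω)
      (fun x hx => by rw [hφ.eq_zero hx, zero_smul])]
    have i2 := h.integrableOn_gradient_mul hΩ hreg h1.continuous
    have i1 : IntegrableOn (fun x => φ x • g x) Ω := by
      have : MemLp φ 2 (volume.restrict Ω) :=
        (h1.continuous.memLp_of_hasCompactSupport h2).restrict _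
      exact memLp_one_iff_integrable.1 (hg.smul this)
    simp only [smul_sub]
    rw [integral_sub i1 i2, e1, sub_self]

/-! ### Hat functions -/

/-- The continuous piecewise affine function with value `1` at the vertex `z` and `0` at the other
vertices, extended by zero. -/
def hat (𝒯 : Mesh Ω) (z x : E d) : ℝ :=
  if h : ∃ T ∈ 𝒯.elems, x ∈ convexHull ℝ (T : Set (E d)) then bc h.choose z x else 0

lemma hat_eq {T : Finset (E d)} (hT : T ∈ 𝒯.elems) {x : E d}
    (hx : x ∈ convexHull ℝ (T : Set (E d))) (z : E d) : 𝒯.hat z x = bc T z x := by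
  have h : ∃ T ∈ 𝒯.elems, x ∈ convexHull ℝ (T : Set (E d)) := ⟨T, hT, hx⟩
  rw [hat, dif_pos h]
  exact bc_congr h.choose_spec.1 hT h.choose_spec.2 hx z

lemma hat_of_notMem_closure {x : E d} (hx : x ∉ closure Ω) (z : E d) : 𝒯.hat z x = 0 := by
  rw [hat, dif_neg]
  rintro ⟨T, hT, h⟩
  exact hx (𝒯.simplex_subset hT h)

lemma hat_nonneg (z x : E d) : 0 ≤ 𝒯.hat z x := by
  by_cases h : ∃ T ∈ 𝒯.elems, x ∈ convexHull ℝ (T : Set (E d))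
  · obtain ⟨T, hT, hx⟩ := h
    rw [hat_eq hT hx]
    exact (mem_convexHull_iff (𝒯.isSimplex hT)).1 hx z
  · rw [hat, dif_neg h]

lemma hat_le_one (z x : E d) : 𝒯.hat z x ≤ 1 := by
  by_cases h : ∃ T ∈ 𝒯.elems, x ∈ convexHull ℝ (T : Set (E d))
  · obtain ⟨T, hT, hx⟩ := h
    rw [hat_eq hT hx]
    exact bc_le_one (𝒯.isSimplex hT) hx z
  · rw [hat, dif_neg h]; exact zero_le_one

lemma pwAffine_hat (𝒯 : Mesh Ω) (z : E d) : 𝒯.PwAffine (𝒯.hat z) fun T => bg T z :=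
  fun T hT => ⟨bc T z 0, fun x hx => by rw [hat_eq hT hx, bc_eq]⟩

lemma hat_eq_zero (hΩ : IsOpen Ω) (hreg : interior (closure Ω) ⊆ Ω) {z : E d} (hz : z ∈ Ω)
    {x : E d} (hx : x ∉ Ω) : 𝒯.hat z x = 0 := by
  by_cases hc : x ∈ closure Ω
  · obtain ⟨T, hT, hxT⟩ := 𝒯.exists_simplex hc
    rw [hat_eq hT hxT]
    refine le_antisymm ?_ ((mem_convexHull_iff (𝒯.isSimplex hT)).1 hxT z)
    by_contra! hp
    exact hx (mem_of_bc_pos_of_vertex_mem hΩ hreg hz hT hxT hp)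
  · exact hat_of_notMem_closure hc z

end Mesh

/-! ### Mollification -/

section Mollify

open scoped Convolution

variable {f : E d → ℝ} {L : ℝ≥0}

/-- The mollification of `f`. -/
def mollify (η : ContDiffBump (0 : E d)) (f : E d → ℝ) : E d → ℝ :=
  η.normed volume ⋆[ContinuousLinearMap.lsmul ℝ ℝ, volume] f

lemma mollify_apply (η : ContDiffBump (0 : E d)) (x : E d) :
    mollify η f x = ∫ t, η.normed volume t * f (x - t) := by
  simp [mollify, convolution_def]

lemma contDiff_mollify (η : ContDiffBump (0 : E d)) (hf : Continuous f) :
    ContDiff ℝ ∞ (mollify η f) :=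
  η.hasCompactSupport_normed.contDiff_convolution_left _ η.contDiff_normed hf.locallyIntegrable

lemma abs_mollify_sub_le (η : ContDiffBump (0 : E d)) (hf : Continuous f) {x : E d} {c : ℝ}
    (h : ∀ y ∈ Metric.ball x η.rOut, |f y - f x| ≤ c) : |mollify η f x - f x| ≤ c :=
  η.dist_normed_convolution_le hf.aestronglyMeasurable h

lemma mollify_sub (η : ContDiffBump (0 : E d)) (hf : Continuous f) (x y : E d) :
    mollify η f x - mollify η f y = ∫ t, η.normed volume t * (f (x - t) - f (y - t)) := by
  have hi : ∀ x, Integrable fun t => η.normed volume t * f (x - t) := fun x =>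
    (η.continuous_normed.mul (by fun_prop)).integrable_of_hasCompactSupport
      η.hasCompactSupport_normed.mul_right
  rw [mollify_apply, mollify_apply, ← integral_sub (hi x) (hi y)]
  simp only [mul_sub]

lemma lipschitzWith_mollify (η : ContDiffBump (0 : E d)) (hf : LipschitzWith L f) :
    LipschitzWith L (mollify η f) := by
  refine LipschitzWith.of_dist_le_mul fun x y => ?_
  rw [Real.dist_eq, mollify_sub η hf.continuous, ← Real.norm_eq_abs]
  have hi : Integrable fun t => η.normed volume t * (L * dist x y) :=
    η.integrable_normed.mul_const _
  refine (norm_integral_le_of_norm_le hi (Eventually.of_forall fun t => ?_)).trans ?_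
  · rw [norm_mul, Real.norm_of_nonneg (η.nonneg_normed t)]
    refine mul_le_mul_of_nonneg_left ?_ (η.nonneg_normed t)
    have := hf.dist_le_mul (x - t) (y - t)
    rwa [dist_sub_right] at this
  · rw [integral_mul_const, η.integral_normed, one_mul]

/-- Near `x`, the increments of the mollification are averages, with total mass one, of increments
of an affine function. The gradient is therefore reproduced exactly, not only approximated. -/
lemma gradient_mollify (η : ContDiffBump (0 : E d)) (hf : Continuous f) {x b : E d} {R c : ℝ}
    (hR : ∀ y ∈ Metric.ball x R, f y = ⟪b, y⟫ + c) (hη : 2 * η.rOut ≤ R) :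
    gradient (mollify η f) x = b := by
  have hpos := η.rOut_pos
  have h1 : ∀ y ∈ Metric.ball x (R / 2), mollify η f y = ⟪b, y⟫ + (mollify η f x - ⟪b, x⟫) := by
    intro y hy
    have : mollify η f y - mollify η f x = ⟪b, y - x⟫ := by
      rw [mollify_sub η hf]
      calc ∫ t, η.normed volume t * (f (y - t) - f (x - t))
          = ∫ t, η.normed volume t * ⟪b, y - x⟫ := by
            refine integral_congr_ae (Eventually.of_forall fun t => ?_)
            by_cases ht : t ∈ Metric.ball (0 : E d) η.rOut
            · rw [mem_ball_zero_iff] at ht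
              rw [Metric.mem_ball] at hy
              have m1 : x - t ∈ Metric.ball x R := by
                rw [Metric.mem_ball, dist_eq_norm, sub_sub_cancel_left, norm_neg]; linarith
              have m2 : y - t ∈ Metric.ball x R := by
                have := norm_sub_le (y - x) t
                rw [← dist_eq_norm y x] at this
                rw [Metric.mem_ball, dist_eq_norm, sub_right_comm]
                linarith
              simp only [hR _ m1, hR _ m2, inner_sub_right]
              ring
            · have : η.normed volume t = 0 := by
                rw [← Function.notMem_support, η.support_normed_eq]; exact ht
              simp [this]
        _ = ⟪b, y - x⟫ := by rw [integral_mul_const, η.integral_normed, one_mul]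
    rw [inner_sub_right] at this
    linarith
  have h2 : HasGradientAt (mollify η f) b x := by
    have h3 := hasGradientAt_affine b (mollify η f x - ⟪b, x⟫) x
    rw [hasGradientAt_iff_hasFDerivAt] at h3 ⊢
    refine h3.congr_of_eventuallyEq ?_
    filter_upwards [Metric.ball_mem_nhds x (show 0 < R / 2 by linarith)] with y hy using h1 y hy
  exact h2.gradient

end Mollify

lemma tendsto_eLpNorm_of_bounded {α F : Type*} [MeasurableSpace α] [NormedAddCommGroup F]
    {μ : Measure α} [IsFiniteMeasure μ] {f : ℕ → α → F} {C : ℝ≥0}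
    (hm : ∀ n, AEStronglyMeasurable (f n) μ) (hb : ∀ n, ∀ᵐ x ∂μ, ‖f n x‖₊ ≤ C)
    (h : ∀ᵐ x ∂μ, Tendsto (fun n => f n x) atTop (𝓝 0)) :
    Tendsto (fun n => eLpNorm (f n) 2 μ) atTop (𝓝 0) := by
  have h1 : Tendsto (fun n => ∫⁻ x, ‖f n x‖ₑ ^ (2 : ℝ) ∂μ) atTop (𝓝 (∫⁻ _, 0 ∂μ)) := by
    refine tendsto_lintegral_of_dominated_convergence' (fun _ => (C : ℝ≥0∞) ^ (2 : ℝ))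
      (fun n => (hm n).enorm.pow_const _) (fun n => ?_) ?_ ?_
    · filter_upwards [hb n] with x hx
      gcongr
      exact ENNReal.coe_le_coe.2 hx
    · rw [lintegral_const]
      exact ENNReal.mul_ne_top (by simp) (measure_ne_top _ _)
    · filter_upwards [h] with x hx
      have h2 := (ENNReal.continuous_rpow_const (y := 2)).tendsto 0 |>.comp
        ((continuous_enorm.tendsto (0 : F)).comp hx |>.trans (by simp))
      simpa [Function.comp_def] using h2
  have h2 := (ENNReal.continuous_rpow_const (y := 1 / 2)).tendsto _ |>.comp h1
  simp only [lintegral_zero] at h2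
  rw [ENNReal.zero_rpow_of_pos (by norm_num)] at h2
  refine h2.congr fun n => ?_
  rw [eLpNorm_eq_lintegral_rpow_enorm_toReal two_ne_zero ENNReal.ofNat_ne_top]
  simp

end SemilinearFEM

namespace SemilinearFEM

open scoped Classical

variable {d : ℕ}

/-! ### Hat functions in `H₀¹(Ω)` -/

namespace Mesh

variable {Ω : Set (E d)} {𝒯 : Mesh Ω} {v : E d → ℝ} {b : Finset (E d) → E d}

lemma PwAffine.aestronglyMeasurable_gradient (h : 𝒯.PwAffine v b) (hΩ : IsOpen Ω)
    (hreg : interior (closure Ω) ⊆ Ω) :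
    AEStronglyMeasurable (gradient v) (volume.restrict Ω) :=
  𝒯.aestronglyMeasurable_of_forall_simplex hΩ hreg fun T hT =>
    (aestronglyMeasurable_const (b := b T)).congr (by
      filter_upwards [h.gradient_ae hT] with x hx using hx.symm)

lemma PwAffine.aestronglyMeasurable (h : 𝒯.PwAffine v b) (hΩ : IsOpen Ω) :
    AEStronglyMeasurable v (volume.restrict Ω) :=
  (h.continuousOn.mono subset_closure).aestronglyMeasurable hΩ.measurableSet

/-- A nonnegative piecewise affine function that vanishes outside of `Ω` belongs to `H₀¹(Ω)`. -/
lemma PwAffine.memH10 (h : 𝒯.PwAffine v b) (hΩ : IsOpen Ω) (hbdd : Bornology.IsBounded Ω)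
    (hreg : interior (closure Ω) ⊆ Ω) (h0 : ∀ x ∉ Ω, v x = 0) (hnn : ∀ x, 0 ≤ v x) :
    MemH10 Ω v (gradient v) := by
  have hfin : IsFiniteMeasure (volume.restrict Ω : Measure (E d)) :=
    ⟨by rw [Measure.restrict_apply_univ]; exact hbdd.measure_lt_top⟩
  obtain ⟨L, hL⟩ : ∃ L, LipschitzWith L v := by
    refine 𝒯.exists_lipschitzWith hΩ h0 fun T hT => ?_
    obtain ⟨c, hc⟩ := h T hT
    refine ⟨‖b T‖₊, LipschitzOnWith.of_dist_le_mul fun x hx y hy => ?_⟩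
    rw [hc x hx, hc y hy, Real.dist_eq, add_sub_add_right_eq_sub, ← inner_sub_right, dist_eq_norm]
    exact abs_real_inner_le_norm _ _
  have hgrad : ∀ x, ‖gradient v x‖ ≤ L := fun x => by
    rw [norm_gradient]; exact norm_fderiv_le_of_lipschitz ℝ hL
  have hgm := h.aestronglyMeasurable_gradient hΩ hreg
  obtain ⟨M, -, hM⟩ := h.exists_bound
  refine ⟨⟨?_, ?_, h.hasWeakGradient hΩ hreg⟩, ?_⟩
  · refine MemLp.of_bound (h.aestronglyMeasurable hΩ) M ?_
    filter_upwards [ae_restrict_mem hΩ.measurableSet] with x hx using hM x (subset_closure hx)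
  · exact MemLp.of_bound hgm L (Eventually.of_forall hgrad)
  let ε : ℕ → ℝ := fun n => 1 / ((n : ℝ) + 1)
  have hε : ∀ n, 0 < ε n := fun n => by positivity
  have hεlim : Tendsto ε atTop (𝓝 0) := tendsto_one_div_add_atTop_nhds_zero_nat
  have hL1 : (0 : ℝ) < 2 * (L + 1) := by positivity
  let η : ℕ → ContDiffBump (0 : E d) := fun n =>
    ⟨ε n / (2 * (L + 1)) / 2, ε n / (2 * (L + 1)), by have := hε n; positivity,
      half_lt_self (div_pos (hε n) hL1)⟩
  have hηε : ∀ n, (L : ℝ) * (η n).rOut ≤ ε n / 2 := by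
    intro n
    change (L : ℝ) * (ε n / (2 * (L + 1))) ≤ ε n / 2
    rw [mul_div_assoc', div_le_div_iff₀ hL1 two_pos]
    nlinarith [hε n, L.2]
  have hηlim : Tendsto (fun n => (η n).rOut) atTop (𝓝 0) := by
    simpa using hεlim.div_const (2 * ((L : ℝ) + 1))
  -- Lowering `v` by `ε` and taking the positive part moves the support away from the boundary
  -- without any cut-off function. The mollification radius is chosen so that `v` varies by at most
  -- `ε / 2` over it.
  let w : ℕ → E d → ℝ := fun n x => max (v x - ε n) 0
  have hwL : ∀ n, LipschitzWith L (w n) := by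
    intro n
    have : LipschitzWith L fun x => v x - ε n := by
      simpa using hL.sub (LipschitzWith.const (ε n))
    exact this.max_const 0
  have hwv : ∀ n x, |w n x - v x| ≤ ε n := by
    intro n x
    have h1 := hnn x
    have h2 := hε n
    simp only [w]
    rcases le_total (v x - ε n) 0 with h3 | h3
    · rw [max_eq_right h3, abs_le]; constructor <;> linarith
    · rw [max_eq_left h3, abs_le]; constructor <;> linarith
  have hmv : ∀ n x, |mollify (η n) (w n) x - v x| ≤ 2 * ε n := by
    intro n x
    have h1 := abs_mollify_sub_le (η n) (hwL n).continuous (x := x) (c := ε n / 2) fun y hy => by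
      refine ((hwL n).dist_le_mul y x).trans (le_trans ?_ (hηε n))
      have := (Metric.mem_ball.1 hy).le
      gcongr
    have h2 := hwv n x
    have h3 := abs_sub_le (mollify (η n) (w n) x) (w n x) (v x)
    have := hε n
    linarith
  have hsupp : ∀ n, tsupport (mollify (η n) (w n)) ⊆ {x | ε n / 2 ≤ v x} := by
    intro n
    refine closure_minimal ?_ (isClosed_le continuous_const hL.continuous)
    intro x hx
    by_contra hlt
    simp only [Set.mem_ofPred_eq, not_le] at hlt
    have hwx : ∀ y ∈ Metric.ball x (η n).rOut, w n y = 0 := by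
      intro y hy
      have h1 := hL.dist_le_mul y x
      have h2 := le_abs_self (v y - v x)
      rw [Real.dist_eq] at h1
      have h3 : (L : ℝ) * dist y x ≤ ε n / 2 := by
        refine le_trans ?_ (hηε n)
        have := (Metric.mem_ball.1 hy).le
        gcongr
      exact max_eq_right (by linarith)
    have hwx0 := hwx x (Metric.mem_ball_self (η n).rOut_pos)
    have h1 := abs_mollify_sub_le (η n) (hwL n).continuous (x := x) (c := 0) fun y hy => by
      rw [hwx y hy, hwx0]; simp
    rw [hwx0, sub_zero] at h1
    exact hx (abs_nonpos_iff.1 h1)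
  have hsub : ∀ n, tsupport (mollify (η n) (w n)) ⊆ Ω := fun n x hx => by
    by_contra hn
    have h1 : ε n / 2 ≤ v x := hsupp n hx
    have := hε n
    rw [h0 x hn] at h1
    linarith
  have htest : ∀ n, IsTestFunction Ω (mollify (η n) (w n)) := fun n =>
    ⟨contDiff_mollify (η n) (hwL n).continuous,
      Metric.isCompact_of_isClosed_isBounded (isClosed_tsupport _) (hbdd.subset (hsub n)), hsub n⟩
  refine ⟨fun n => mollify (η n) (w n), htest, ?_, ?_⟩
  · refine tendsto_eLpNorm_of_bounded (C := 2) (fun n => (h.aestronglyMeasurable hΩ).sub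
      (htest n).contDiff.continuous.aestronglyMeasurable) (fun n => Eventually.of_forall fun x => ?_)
      (Eventually.of_forall fun x => ?_)
    · have h1 := hmv n x
      rw [abs_sub_comm] at h1
      have h2 : ε n ≤ 1 := by
        simp only [ε]
        rw [div_le_one (by positivity)]
        have : (0 : ℝ) ≤ n := Nat.cast_nonneg n
        linarith
      rw [← NNReal.coe_le_coe, coe_nnnorm, Real.norm_eq_abs]
      push_cast
      linarith
    · refine squeeze_zero_norm (a := fun n => 2 * ε n) (fun n => ?_) (by simpa using hεlim.const_mul 2)
      rw [Real.norm_eq_abs, abs_sub_comm]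
      exact hmv n x
  · refine tendsto_eLpNorm_of_bounded (C := L + L) (fun n => hgm.sub
      (htest n).continuous_gradient.aestronglyMeasurable)
      (fun n => Eventually.of_forall fun x => ?_) (𝒯.ae_of_forall_simplex hΩ hreg fun T hT => ?_)
    · rw [← NNReal.coe_le_coe, coe_nnnorm]
      push_cast
      refine (norm_sub_le _ _).trans (add_le_add (hgrad x) ?_)
      rw [norm_gradient]
      exact norm_fderiv_le_of_lipschitz ℝ (lipschitzWith_mollify (η n) (hwL n))
    · filter_upwards [ae_mem_interior T] with x hx
      obtain ⟨c, hc⟩ := h T hT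
      have hgx := h.hasGradientAt hT hx
      obtain ⟨R, hR, hRT⟩ := Metric.isOpen_iff.1 isOpen_interior x hx
      have hηR : ∀ R : ℝ, 0 < R → ∀ᶠ n in atTop, 2 * (η n).rOut ≤ R := fun R hR => by
        have : Tendsto (fun n => 2 * (η n).rOut) atTop (𝓝 0) := by simpa using hηlim.const_mul 2
        exact this.eventually_le_const hR
      refine tendsto_const_nhds.congr' (EventuallyEq.symm ?_)
      -- Gradients converge at interior points of the elements. Where `v x = 0` there is a local
      -- minimum, so `v` vanishes on the whole element and so do the nearby truncations; where `v x
      -- > 0` the truncation is eventually just a shift by `ε`.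
      rcases (hnn x).eq_or_lt with hx0 | hx0
      · have hb0 : b T = 0 := by
          have hmin : IsLocalMin v x := Eventually.of_forall fun y => by rw [← hx0]; exact hnn y
          have := hmin.hasFDerivAt_eq_zero hgx.hasFDerivAt
          simpa using this
        have hc0 : c = 0 := by
          have := hc x (interior_subset hx)
          rw [hb0, inner_zero_left, zero_add, ← hx0] at this
          exact this.symm
        filter_upwards [hηR R hR] with n hn
        rw [hgx.gradient, gradient_mollify (η n) (hwL n).continuous (b := 0) (c := 0) (R := R) ?_ hn,
          hb0, sub_zero]
        intro y hy
        have : v y = 0 := by rw [hc y (interior_subset (hRT hy)), hb0, hc0]; simp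
        simp [w, this, (hε n).le]
      · have h1 : ∀ᶠ y in 𝓝 x, v x / 2 < v y :=
          hL.continuous.continuousAt.eventually_const_lt (half_lt_self hx0)
        obtain ⟨R', hR', hball⟩ := Metric.eventually_nhds_iff_ball.1 h1
        filter_upwards [hηR (min R R') (lt_min hR hR'),
          hεlim.eventually_le_const (half_pos hx0)] with n hn hn2
        rw [hgx.gradient, gradient_mollify (η n) (hwL n).continuous (b := b T) (c := c - ε n)
          (R := min R R') ?_ hn, sub_self]
        intro y hy
        have h2 := hball y (Metric.ball_subset_ball (min_le_right _ _) hy)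
        have h3 := hc y (interior_subset (hRT (Metric.ball_subset_ball (min_le_left _ _) hy)))
        change max (v y - ε n) 0 = _
        rw [max_eq_left (by linarith), h3]
        ring

/-- The hat functions of the interior vertices belong to the discrete space. -/
lemma memV_hat (hΩ : IsOpen Ω) (hbdd : Bornology.IsBounded Ω)
    (hreg : interior (closure Ω) ⊆ Ω) {z : E d} (hz : z ∈ Ω) :
    𝒯.MemV (𝒯.hat z) (gradient (𝒯.hat z)) :=
  ⟨(𝒯.pwAffine_hat z).continuousOn,
    fun T hT => ⟨bg T z, 𝒯.pwAffine_hat z T hT⟩,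
    (𝒯.pwAffine_hat z).memH10 hΩ hbdd hreg (fun _ hx => hat_eq_zero hΩ hreg hz hx) (hat_nonneg z)⟩

lemma MemV.pwAffine {g : E d → E d} (h : 𝒯.MemV v g) :
    𝒯.PwAffine v fun T => elementGradient v T := by
  intro T hT
  obtain ⟨b, c, hc⟩ := h.affine T hT
  have : elementGradient v T = b := by
    have h1 := hasGradientAt_affine b c (barycenter T)
    refine HasGradientAt.gradient ?_
    rw [hasGradientAt_iff_hasFDerivAt] at h1 ⊢
    refine h1.congr_of_eventuallyEq ?_
    filter_upwards [mem_interior_iff_mem_nhds.1 (barycenter_mem_interior (𝒯.isSimplex hT))]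
      with y hy using hc y hy
  exact ⟨c, fun x hx => by simp only [this, hc x hx]⟩

/-- The gradient of an interior hat function has vanishing mean. -/
lemma integral_gradient_hat (hΩ : IsOpen Ω) (hbdd : Bornology.IsBounded Ω)
    (hreg : interior (closure Ω) ⊆ Ω) {z : E d} (hz : z ∈ Ω) :
    ∫ x in Ω, gradient (𝒯.hat z) x = 0 := by
  have hfin : IsFiniteMeasure (volume.restrict Ω : Measure (E d)) :=
    ⟨by rw [Measure.restrict_apply_univ]; exact hbdd.measure_lt_top⟩
  have hH := (𝒯.pwAffine_hat z).memH10 hΩ hbdd hreg (fun _ hx => hat_eq_zero hΩ hreg hz hx)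
    (hat_nonneg z)
  -- Gradients of test functions have mean zero, and on the bounded set `Ω` convergence in `L²`
  -- implies convergence in `L¹`, hence of the means.
  obtain ⟨φ, hφ, -, hlim⟩ := hH.exists_approx
  have hint : Integrable (gradient (𝒯.hat z)) (volume.restrict Ω) :=
    hH.memLp_grad.integrable (by norm_num)
  have hgi : ∀ n, Integrable (gradient (φ n)) := fun n =>
    (hφ n).continuous_gradient.integrable_of_hasCompactSupport (hφ n).hasCompactSupport_gradient
  have hzero : ∀ n, ∫ x in Ω, gradient (φ n) x = 0 := by
    intro n
    rw [setIntegral_eq_integral_of_forall_compl_eq_zero fun x hx => (hφ n).gradient_eq_zero hx]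
    refine ext_inner_right ℝ fun w => ?_
    have e1 := integral_inner (𝕜 := ℝ) (hgi n) w
    rw [real_inner_comm, ← e1, inner_zero_left]
    simp only [real_inner_comm _ w, inner_gradient]
    have h1 : ContDiff ℝ 1 (φ n) := (hφ n).contDiff.of_le (by simp)
    obtain ⟨L, hL⟩ := h1.lipschitzWith_of_hasCompactSupport (hφ n).hasCompactSupport one_ne_zero
    have h2 := (LipschitzWith.const (1 : ℝ)).integral_lineDeriv_mul_eq (μ := volume) hL
      (hφ n).hasCompactSupport (-w)
    simp only [neg_neg, mul_one] at h2
    have h3 : ∀ x, lineDeriv ℝ (φ n) x w = fderiv ℝ (φ n) x w := fun x =>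
      (h1.differentiable one_ne_zero x).lineDeriv_eq_fderiv
    simp only [h3] at h2
    rw [← h2]
    simp [lineDeriv]
  have hl1 : Tendsto (fun n => ∫⁻ x in Ω, ‖gradient (φ n) x - gradient (𝒯.hat z) x‖ₑ) atTop
      (𝓝 0) := by
    have hc : Tendsto (fun n => eLpNorm (fun x => gradient (𝒯.hat z) x - gradient (φ n) x) 2
        (volume.restrict Ω) * (volume.restrict Ω Set.univ) ^ (1 / 2 : ℝ)) atTop (𝓝 0) := by
      have := ENNReal.Tendsto.mul_const (b := (volume.restrict Ω Set.univ) ^ (1 / 2 : ℝ)) hlim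
        (Or.inr (ENNReal.rpow_ne_top_of_nonneg (by norm_num) (measure_ne_top _ _)))
      simpa using this
    refine tendsto_of_tendsto_of_tendsto_of_le_of_le tendsto_const_nhds hc (fun _ => zero_le) ?_
    intro n
    have h1 := eLpNorm_le_eLpNorm_mul_rpow_measure_univ (p := 1) (q := 2) (by norm_num)
      (hint.aestronglyMeasurable.sub (hgi n).restrict.aestronglyMeasurable)
      (f := fun x => gradient (𝒯.hat z) x - gradient (φ n) x) (μ := volume.restrict Ω)
    rw [eLpNorm_one_eq_lintegral_enorm] at h1
    norm_num at h1
    simp only [enorm_sub_rev (gradient (φ n) _)]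
    simpa using h1
  have := tendsto_integral_of_L1 (gradient (𝒯.hat z)) hint.aestronglyMeasurable
    (Eventually.of_forall fun n => (hgi n).restrict) hl1
  simp only [hzero] at this
  exact (tendsto_nhds_unique this tendsto_const_nhds)

end Mesh

end SemilinearFEM

namespace SemilinearFEM

open scoped Classical

variable {d : ℕ}

/-! ### Sides, normals and jumps -/

lemma mem_orthogonal_vectorSpan {S : Set (E d)} {n : E d}
    (h : ∀ p ∈ S, ∀ q ∈ S, ⟪n, p⟫ = ⟪n, q⟫) : n ∈ (vectorSpan ℝ S)ᗮ := by
  rw [Submodule.mem_orthogonal, vectorSpan_def]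
  intro u hu
  induction hu using Submodule.span_induction with
  | mem u hu =>
    obtain ⟨p, hp, q, hq, rfl⟩ := hu
    change ⟪p - q, n⟫ = 0
    rw [real_inner_comm, inner_sub_right, h p hp q hq, sub_self]
  | zero => simp
  | add u v _ _ hu hv => rw [inner_add_left, hu, hv, add_zero]
  | smul a u _ hu => rw [inner_smul_left, hu, mul_zero]

lemma inner_eq_of_mem_orthogonal {S : Set (E d)} {n : E d} (hn : n ∈ (vectorSpan ℝ S)ᗮ)
    {p q : E d} (hp : p ∈ S) (hq : q ∈ S) : ⟪n, p⟫ = ⟪n, q⟫ := by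
  have := (Submodule.mem_orthogonal' _ _).1 hn (p - q) (vsub_mem_vectorSpan ℝ hp hq)
  rw [inner_sub_right] at this
  linarith

/-- `S` is the side of the simplex `T` opposite to the vertex `p`. -/
structure IsSide (T S : Finset (E d)) (p : E d) : Prop where
  simplex : IsSimplex T
  notMem : p ∉ S
  eq_insert : T = insert p S
  nonempty : S.Nonempty

namespace IsSide

variable {T S : Finset (E d)} {p : E d}

lemma mem (h : IsSide T S p) : p ∈ T := by rw [h.eq_insert]; exact Finset.mem_insert_self _ _

lemma subset (h : IsSide T S p) : S ⊆ T := by rw [h.eq_insert]; exact Finset.subset_insert _ _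

lemma bc_opposite (h : IsSide T S p) {q : E d} (hq : q ∈ S) : bc T p q = 0 := by
  rw [bc_vertex h.simplex (h.subset hq), if_neg]
  rintro rfl
  exact h.notMem hq

lemma bg_mem_orthogonal (h : IsSide T S p) : bg T p ∈ (vectorSpan ℝ (S : Set (E d)))ᗮ := by
  refine mem_orthogonal_vectorSpan fun q hq q' hq' => ?_
  have h1 := bc_eq T p q
  have h2 := bc_eq T p q'
  rw [h.bc_opposite hq] at h1
  rw [h.bc_opposite hq'] at h2
  linarith

/-- The orthogonal complement of a side is spanned by the gradient of the opposite coordinate. -/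
lemma exists_eq_smul (h : IsSide T S p) {n : E d} (hn : n ∈ (vectorSpan ℝ (S : Set (E d)))ᗮ) :
    ∃ α : ℝ, n = α • bg T p := by
  obtain ⟨q₀, hq₀⟩ := h.nonempty
  refine ⟨⟪n, p⟫ - ⟪n, q₀⟫, ?_⟩
  -- Pairing with `n` is constant on the vertices of `S`, so in barycentric coordinates it depends
  -- only on the coordinate of the opposite vertex.
  have key : ∀ x, ⟪n, x⟫ = ⟪n, q₀⟫ + bc T p x * (⟪n, p⟫ - ⟪n, q₀⟫) := by
    intro x
    have h1 : ∑ q ∈ S, bc T q x = 1 - bc T p x := by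
      have := sum_bc h.simplex x
      conv at this => lhs; rw [h.eq_insert, Finset.sum_insert h.notMem, ← h.eq_insert]
      linarith
    conv_lhs => rw [← sum_bc_smul h.simplex x]
    rw [inner_sum]
    conv_lhs => rw [h.eq_insert, Finset.sum_insert h.notMem, ← h.eq_insert]
    rw [inner_smul_right]
    have h2 : ∑ q ∈ S, ⟪n, bc T q x • q⟫ = (1 - bc T p x) * ⟪n, q₀⟫ := by
      rw [← h1, Finset.sum_mul]
      exact Finset.sum_congr rfl fun q hq => by
        rw [inner_smul_right, inner_eq_of_mem_orthogonal hn hq hq₀]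
    rw [h2]; ring
  refine ext_inner_right ℝ fun x => ?_
  have h1 := key x
  have h2 := key 0
  have h3 := bc_sub T p x 0
  rw [sub_zero] at h3
  rw [inner_zero_right] at h2
  rw [inner_smul_left, ← h3]
  simp only [conj_trivial]
  linarith

/-- The coordinate of `p` is zero at the barycenter of the side and positive at that of `T`. This
fixes the sign of the normal. -/
lemma inner_bg_barycenter (h : IsSide T S p) :
    0 < ⟪bg T p, barycenter T - barycenter S⟫ := by
  rw [← bc_sub, bc_barycenter h.simplex subset_rfl h.simplex.nonempty, if_pos h.mem,
    bc_barycenter h.simplex h.subset h.nonempty, if_neg h.notMem, sub_zero]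
  have := h.simplex.nonempty.card_pos
  positivity

lemma bg_ne_zero (h : IsSide T S p) : bg T p ≠ 0 := by
  intro h0
  have := h.inner_bg_barycenter
  rw [h0, inner_zero_left] at this
  exact lt_irrefl _ this

/-- The projection onto the normal line is a multiple of `bg T p`. It is self-adjoint and fixes `bg
T p`, so the sign of that multiple is the one given by `inner_bg_barycenter`. -/
lemma unitNormal_eq (h : IsSide T S p) : unitNormal S T = ‖bg T p‖⁻¹ • bg T p := by
  set w : E d := (vectorSpan ℝ (S : Set (E d)))ᗮ.starProjection (barycenter T - barycenter S) with hw
  obtain ⟨α, hα⟩ := h.exists_eq_smul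
    (Submodule.starProjection_apply_mem (vectorSpan ℝ (S : Set (E d)))ᗮ
      (barycenter T - barycenter S))
  have h1 : ⟪bg T p, w⟫ = ⟪bg T p, barycenter T - barycenter S⟫ := by
    rw [hw, ← Submodule.inner_starProjection_left_eq_right,
      Submodule.starProjection_eq_self_iff.2 h.bg_mem_orthogonal]
  have h2 := h.inner_bg_barycenter
  have hb : 0 < ‖bg T p‖ := norm_pos_iff.2 h.bg_ne_zero
  rw [← h1, hw, hα, inner_smul_right, real_inner_self_eq_norm_sq] at h2
  have hα0 : 0 < α := by
    by_contra! hn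
    nlinarith [sq_nonneg ‖bg T p‖]
  change ‖w‖⁻¹ • w = _
  rw [hw, hα, norm_smul, Real.norm_of_nonneg hα0.le, smul_smul]
  congr 1
  field_simp

end IsSide

lemma exists_isSide {T S : Finset (E d)} (hT : IsSimplex T) (hS : S ⊆ T) (hcard : S.card = d)
    (hd : 0 < d) : ∃ p, IsSide T S p := by
  have h1 : (T \ S).card = 1 := by rw [Finset.card_sdiff_of_subset hS, hT.card_eq, hcard]; omega
  obtain ⟨p, hp⟩ := Finset.card_eq_one.1 h1
  have hpm : p ∈ T \ S := by rw [hp]; exact Finset.mem_singleton_self p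
  refine ⟨p, hT, (Finset.mem_sdiff.1 hpm).2, ?_, Finset.card_pos.1 (by omega)⟩
  rw [Finset.insert_eq, ← hp, Finset.sdiff_union_of_subset hS]

namespace Mesh

variable {Ω : Set (E d)} {𝒯 : Mesh Ω} {v : E d → ℝ} {b : Finset (E d) → E d}

lemma exists_isSide_of_neighbor (hd : 0 < d) {T T' : Finset (E d)} (hT : T ∈ 𝒯.elems)
    (h : T' ∈ 𝒯.neighbors T) : ∃ p p', IsSide T (T ∩ T') p ∧ IsSide T' (T ∩ T') p' := by
  obtain ⟨hT', -, hc⟩ := mem_neighbors.1 h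
  obtain ⟨p, hp⟩ := exists_isSide (𝒯.isSimplex hT) Finset.inter_subset_left hc hd
  obtain ⟨p', hp'⟩ := exists_isSide (𝒯.isSimplex hT') Finset.inter_subset_right hc hd
  exact ⟨p, p', hp, hp'⟩

/-- Two simplices that share a side lie on opposite sides of it. -/
lemma exists_bg_eq_neg_smul {T T' : Finset (E d)} (hT : T ∈ 𝒯.elems)
    (h : T' ∈ 𝒯.neighbors T) {p p' : E d} (hp : IsSide T (T ∩ T') p)
    (hp' : IsSide T' (T ∩ T') p') : ∃ α : ℝ, 0 < α ∧ bg T' p' = -(α • bg T p) := by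
  obtain ⟨hT', hne, hc⟩ := mem_neighbors.1 h
  obtain ⟨β, hβ⟩ := hp.exists_eq_smul hp'.bg_mem_orthogonal
  refine ⟨-β, ?_, by rw [hβ]; simp⟩
  by_contra! hβ0
  have hβ1 : 0 < β := by
    refine lt_of_le_of_ne (by linarith) ?_
    rintro rfl
    exact hp'.bg_ne_zero (by rw [hβ, zero_smul])
  set S := T ∩ T' with hS
  set m := barycenter S with hm
  have hb : 0 < ‖bg T p‖ ^ 2 := by have := norm_pos_iff.2 hp.bg_ne_zero; positivity
  -- If both opposite coordinates grew in the direction `bg T p`, a small step from the barycenter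
  -- of the side would enter both interiors, although the simplices overlap in a null set.
  have aux : ∀ (T₁ : Finset (E d)) (p₁ : E d), IsSide T₁ S p₁ → 0 < ⟪bg T₁ p₁, bg T p⟫ →
      ∀ᶠ t : ℝ in 𝓝[>] 0, m + t • bg T p ∈ interior (convexHull ℝ (T₁ : Set (E d))) := by
    intro T₁ p₁ h₁ hpos
    have h2 : ∀ᶠ t : ℝ in 𝓝[>] 0, ∀ z ∈ T₁, 0 < bc T₁ z (m + t • bg T p) := by
      rw [Filter.eventually_all_finset]
      intro z hz
      by_cases hzS : z ∈ S
      · have hcont : Tendsto (fun t : ℝ => bc T₁ z (m + t • bg T p)) (𝓝[>] 0)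
            (𝓝 (bc T₁ z (m + (0 : ℝ) • bg T p))) :=
          (((continuous_bc T₁ z).comp (by fun_prop : Continuous fun t : ℝ => m + t • bg T p)).tendsto
            0).mono_left nhdsWithin_le_nhds
        refine hcont.eventually_const_lt ?_
        rw [zero_smul, add_zero, hm, bc_barycenter h₁.simplex h₁.subset h₁.nonempty, if_pos hzS]
        have := h₁.nonempty.card_pos
        positivity
      · have hzp : z = p₁ := by
          rw [h₁.eq_insert, Finset.mem_insert] at hz
          exact hz.resolve_right hzS
        subst hzp
        filter_upwards [self_mem_nhdsWithin] with t ht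
        have h3 := bc_sub T₁ z (m + t • bg T p) m
        rw [add_sub_cancel_left, inner_smul_right, hm,
          bc_barycenter h₁.simplex h₁.subset h₁.nonempty, if_neg hzS, sub_zero] at h3
        rw [h3]
        exact mul_pos ht hpos
    filter_upwards [h2] with t ht using (mem_interior_convexHull_iff h₁.simplex).2 ht
  have e1 := aux T p hp (by rw [real_inner_self_eq_norm_sq]; exact hb)
  have e2 := aux T' p' hp' (by
    rw [hβ, inner_smul_left, real_inner_self_eq_norm_sq]; exact mul_pos hβ1 hb)
  obtain ⟨t, ht1, ht2⟩ := (e1.and e2).exists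
  obtain ⟨y, ⟨hy1, hy2⟩, hyN⟩ := exists_mem_notMem_of_null
    (isOpen_interior.inter isOpen_interior) ⟨_, ht1, ht2⟩
    (volume_inter_eq_zero hT hT' hne.symm)
  exact hyN ⟨interior_subset hy1, interior_subset hy2⟩

/-- The jump of the normal derivative of a continuous piecewise affine function controls the jump
of its gradient. -/
lemma PwAffine.norm_sub_eq_abs_jump (hv : 𝒯.PwAffine v b) (hd : 0 < d) {T T' : Finset (E d)}
    (hT : T ∈ 𝒯.elems) (h : T' ∈ 𝒯.neighbors T) :
    ‖b T - b T'‖ = |jump v (T ∩ T') T T'| := by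
  obtain ⟨hT', hne, hc⟩ := mem_neighbors.1 h
  obtain ⟨p, p', hp, hp'⟩ := exists_isSide_of_neighbor hd hT h
  obtain ⟨α, hα, hαb⟩ := exists_bg_eq_neg_smul hT h hp hp'
  have hb : 0 < ‖bg T p‖ := norm_pos_iff.2 hp.bg_ne_zero
  have hn : unitNormal (T ∩ T') T' = -unitNormal (T ∩ T') T := by
    rw [hp.unitNormal_eq, hp'.unitNormal_eq, hαb, norm_neg, norm_smul, Real.norm_of_nonneg hα.le,
      smul_neg, smul_smul]
    congr 2
    field_simp
  -- Both affine pieces take the values of `v` at the common vertices, so the tangential parts of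
  -- the gradients agree and the difference is normal to the side.
  have horth : b T - b T' ∈ (vectorSpan ℝ ((T ∩ T' : Finset (E d)) : Set (E d)))ᗮ := by
    obtain ⟨c, hc⟩ := hv T hT
    obtain ⟨c', hc'⟩ := hv T' hT'
    have key : ∀ q ∈ ((T ∩ T' : Finset (E d)) : Set (E d)), ⟪b T - b T', q⟫ = c' - c := by
      intro q hq
      have hq := Finset.mem_inter.1 (Finset.mem_coe.1 hq)
      have h1 := hc q (subset_convexHull ℝ _ hq.1)
      have h2 := hc' q (subset_convexHull ℝ _ hq.2)
      rw [inner_sub_left]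
      linarith
    exact mem_orthogonal_vectorSpan fun q hq q' hq' => by rw [key q hq, key q' hq']
  obtain ⟨β, hβ⟩ := hp.exists_eq_smul horth
  have hj : jump v (T ∩ T') T T' = ⟪unitNormal (T ∩ T') T, b T - b T'⟫ := by
    rw [jump, hv.elementGradient_eq hT, hv.elementGradient_eq hT', hn, inner_neg_left,
      inner_sub_right]
    ring
  rw [hj, hβ, hp.unitNormal_eq, inner_smul_left, inner_smul_right, real_inner_self_eq_norm_sq,
    norm_smul, Real.norm_eq_abs]
  simp only [conj_trivial]
  rw [show ‖bg T p‖⁻¹ * (β * ‖bg T p‖ ^ 2) = β * ‖bg T p‖ by field_simp, abs_mul, abs_norm]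

end Mesh

/-! ### The measure of a side -/

lemma IsSide.finrank_vectorSpan {T S : Finset (E d)} {p : E d} (h : IsSide T S p) :
    Module.finrank ℝ (vectorSpan ℝ (S : Set (E d))) = d - 1 := by
  have hcard : S.card = d := by
    have := h.simplex.card_eq
    rw [h.eq_insert, Finset.card_insert_of_notMem h.notMem] at this
    omega
  have hind : AffineIndependent ℝ ((↑) : S → E d) :=
    h.simplex.indep.mono (Finset.coe_subset.2 h.subset)
  have hd : 0 < d := by rw [← hcard]; exact h.nonempty.card_pos
  have := hind.finrank_vectorSpan (n := d - 1) (by simp [hcard]; omega)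
  have e : Set.range ((↑) : S → E d) = S := by simp
  rwa [e] at this

/-- Isometric coordinates on the hyperplane of the side turn its Hausdorff measure into Lebesgue
measure on `E (d - 1)`. -/
lemma IsSide.exists_isometry {T S : Finset (E d)} {p : E d} (h : IsSide T S p) :
    ∃ Φ : E (d - 1) → E d, Isometry Φ ∧ Φ 0 = barycenter S ∧
      Set.range Φ = {x | x - barycenter S ∈ vectorSpan ℝ (S : Set (E d))} := by
  let W := vectorSpan ℝ (S : Set (E d))
  let ψ : W ≃ₗᵢ[ℝ] E (d - 1) :=
    ((stdOrthonormalBasis ℝ W).reindex (finCongr h.finrank_vectorSpan)).repr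
  refine ⟨fun y => barycenter S + (ψ.symm y : E d), ?_, by simp, ?_⟩
  · refine Isometry.of_dist_eq fun x y => ?_
    rw [dist_add_left, ← Subtype.dist_eq]
    exact ψ.symm.isometry.dist_eq x y
  · ext x
    constructor
    · rintro ⟨y, rfl⟩
      simp
    · intro hx
      exact ⟨ψ ⟨_, hx⟩, by simp⟩

lemma IsSide.measure_lt_top {T S : Finset (E d)} {p : E d} (h : IsSide T S p) :
    Measure.euclideanHausdorffMeasure (d - 1) (convexHull ℝ (S : Set (E d))) < ⊤ := by
  obtain ⟨Φ, hΦ, hΦ0, hrange⟩ := h.exists_isometry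
  have hsub : convexHull ℝ (S : Set (E d)) ⊆ Φ '' Metric.closedBall 0 (size S) := by
    intro x hx
    have hm := barycenter_mem_convexHull h.nonempty
    have : x ∈ Set.range Φ := by
      rw [hrange]
      exact AffineSubspace.vsub_mem_direction (convexHull_subset_affineSpan _ hx)
        (convexHull_subset_affineSpan _ hm) |> fun h => by rwa [direction_affineSpan] at h
    obtain ⟨y, rfl⟩ := this
    refine ⟨y, ?_, rfl⟩
    rw [Metric.mem_closedBall, ← hΦ.dist_eq, hΦ0]
    exact dist_le_size hx hm
  refine (measure_mono hsub).trans_lt ?_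
  rw [hΦ.euclideanHausdorffMeasure_image, EuclideanSpace.euclideanHausdorffMeasure_eq_volume]
  exact measure_closedBall_lt_top

/-- At the barycenter of `S` the coordinates of its vertices are `1 / S.card`, and their slopes are
at most `1 / ρ`. Within distance `ρ / S.card` in the hyperplane they stay nonnegative, so that ball
lies in the side. -/
lemma IsSide.volume_ball_le {T S : Finset (E d)} {p : E d} (h : IsSide T S p) {c : E d} {ρ : ℝ}
    (hρ : 0 < ρ) (hb : Metric.ball c ρ ⊆ convexHull ℝ (T : Set (E d))) :
    volume (Metric.ball (0 : E (d - 1)) (ρ / S.card)) ≤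
      Measure.euclideanHausdorffMeasure (d - 1) (convexHull ℝ (S : Set (E d))) := by
  obtain ⟨Φ, hΦ, hΦ0, hrange⟩ := h.exists_isometry
  rw [← EuclideanSpace.euclideanHausdorffMeasure_eq_volume, ← hΦ.euclideanHausdorffMeasure_image]
  refine measure_mono ?_
  rintro _ ⟨y, hy, rfl⟩
  have hcard : (0 : ℝ) < S.card := by exact_mod_cast h.nonempty.card_pos
  rw [Metric.mem_ball, ← hΦ.dist_eq, hΦ0, dist_eq_norm] at hy
  have hyW : Φ y - barycenter S ∈ vectorSpan ℝ (S : Set (E d)) := by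
    have : Φ y ∈ Set.range Φ := Set.mem_range_self y
    rwa [hrange] at this
  have hbc := bc_barycenter h.simplex h.subset h.nonempty
  have h0 : bc T p (Φ y) = 0 := by
    have h1 := bc_sub T p (Φ y) (barycenter S)
    rw [hbc, if_neg h.notMem, sub_zero] at h1
    rw [h1]
    exact (Submodule.mem_orthogonal' _ _).1 h.bg_mem_orthogonal _ hyW
  have hmem : Φ y ∈ convexHull ℝ (T : Set (E d)) := by
    rw [mem_convexHull_iff h.simplex]
    intro z
    by_cases hz : z ∈ S
    · have h1 := bc_sub T z (Φ y) (barycenter S)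
      rw [hbc, if_pos hz] at h1
      have h2 := abs_real_inner_le_norm (bg T z) (Φ y - barycenter S)
      have h3 : ‖bg T z‖ * ‖Φ y - barycenter S‖ ≤ ρ⁻¹ * (ρ / S.card) := by
        gcongr
        exact norm_bg_le h.simplex hρ hb z
      have h4 : ρ⁻¹ * (ρ / S.card) = (S.card : ℝ)⁻¹ := by field_simp
      have := (abs_le.1 h2).1
      linarith
    · by_cases hzp : z = p
      · rw [hzp, h0]
      · rw [bc_of_notMem (by rw [h.eq_insert, Finset.mem_insert]; tauto)]
        simp
  refine mem_convexHull_of_bc h.simplex hmem fun z hz hzS => ?_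
  rw [h.eq_insert, Finset.mem_insert] at hz
  rw [hz.resolve_right hzS, h0]

namespace Mesh

variable {Ω : Set (E d)} {𝒯 : Mesh Ω} {v : E d → ℝ} {b : Finset (E d) → E d}

/-- The jump part of the indicator controls the jumps of the gradient. -/
lemma PwAffine.norm_sub_sq_le_jumpNormSq (hv : 𝒯.PwAffine v b) (hd : 0 < d) {σ : ℝ} (hσ : 0 < σ)
    (hreg : 𝒯.IsShapeRegular σ) {T T' : Finset (E d)} (hT : T ∈ 𝒯.elems)
    (h : T' ∈ 𝒯.neighbors T) :
    ‖b T - b T'‖ ^ 2 * ((volume : Measure (E (d - 1))).real (Metric.ball 0 1) *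
      ((σ * d)⁻¹ ^ (d - 1) * size T ^ d)) ≤ size T * jumpNormSq 𝒯 v T := by
  obtain ⟨p, p', hp, hp'⟩ := exists_isSide_of_neighbor hd hT h
  obtain ⟨c, ρ, hρ, hb, hs⟩ := hreg T hT
  have hcard : (T ∩ T').card = d := (mem_neighbors.1 h).2.2
  have hsz := size_nonneg T
  set μ : Measure (E d) := (Measure.euclideanHausdorffMeasure (d - 1)).restrict
        (convexHull ℝ ((T ∩ T' : Finset (E d)) : Set (E d))) with hμ
  -- A side is at least as large as a `(d - 1)`-ball of radius `size T / (σ d)`, since the inradius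
  -- is at least `size T / σ`.
  have hlow : (volume : Measure (E (d - 1))).real (Metric.ball 0 1) * ((σ * d)⁻¹ * size T) ^ (d - 1) ≤
      μ.real Set.univ := by
    have h1 := hp.volume_ball_le hρ hb
    rw [hcard] at h1
    have h2 : volume (Metric.ball (0 : E (d - 1)) ((σ * d)⁻¹ * size T)) ≤ μ Set.univ := by
      rw [hμ, Measure.restrict_apply_univ]
      refine le_trans (measure_mono (Metric.ball_subset_ball ?_)) h1
      have hd' : (0 : ℝ) < d := by exact_mod_cast hd
      rw [inv_mul_le_iff₀ (by positivity)]
      calc size T ≤ σ * ρ := hs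
        _ = σ * d * (ρ / d) := by field_simp
    have h3 := ENNReal.toReal_mono (by
      rw [hμ, Measure.restrict_apply_univ]; exact hp.measure_lt_top.ne) h2
    have hsz0 := hreg.size_pos hd hT
    rw [Measure.addHaar_ball_of_pos _ _ (by positivity), ENNReal.toReal_mul,
      ENNReal.toReal_ofReal (by positivity), finrank_euclideanSpace_fin, mul_comm] at h3
    exact h3
  have hterm : lpNorm (fun _ : E d => jump v (T ∩ T') T T') 2 μ ^ 2 =
      ‖b T - b T'‖ ^ 2 * μ.real Set.univ := by
    rw [lpNorm_const' two_ne_zero ENNReal.ofNat_ne_top, mul_pow, Real.norm_eq_abs,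
      hv.norm_sub_eq_abs_jump hd hT h]
    congr 1
    rw [← Real.rpow_natCast, ← Real.rpow_mul measureReal_nonneg]
    simp
  have hle : ‖b T - b T'‖ ^ 2 * μ.real Set.univ ≤ jumpNormSq 𝒯 v T := by
    rw [← hterm]
    exact Finset.single_le_sum (f := fun T' => lpNorm (fun _ : E d => jump v (T ∩ T') T T') 2
      ((Measure.euclideanHausdorffMeasure (d - 1)).restrict
        (convexHull ℝ ((T ∩ T' : Finset (E d)) : Set (E d)))) ^ 2) (fun _ _ => sq_nonneg _) h
  have hpow : (σ * d)⁻¹ ^ (d - 1) * size T ^ d = size T * ((σ * d)⁻¹ * size T) ^ (d - 1) := by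
    rw [mul_pow, ← mul_pow_sub_one hd.ne' (size T)]
    ring
  calc _ = size T * (‖b T - b T'‖ ^ 2 * ((volume : Measure (E (d - 1))).real (Metric.ball 0 1) *
        ((σ * d)⁻¹ * size T) ^ (d - 1))) := by rw [hpow]; ring
    _ ≤ size T * (‖b T - b T'‖ ^ 2 * μ.real Set.univ) := by gcongr
    _ ≤ size T * jumpNormSq 𝒯 v T := by gcongr

end Mesh

end SemilinearFEM

namespace SemilinearFEM

open scoped Classical

variable {d : ℕ}

/-! ### Poincaré inequalities -/

lemma enorm_integral_sq_le {α F : Type*} [MeasurableSpace α] [NormedAddCommGroup F]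
    [NormedSpace ℝ F] {μ : Measure α} [IsProbabilityMeasure μ] {f : α → F}
    (hf : AEStronglyMeasurable f μ) : ‖∫ x, f x ∂μ‖ₑ ^ 2 ≤ ∫⁻ x, ‖f x‖ₑ ^ 2 ∂μ := by
  have h1 := eLpNorm_le_eLpNorm_of_exponent_le (p := 1) (q := 2) (by norm_num) hf
  rw [eLpNorm_one_eq_lintegral_enorm] at h1
  have h2 := (enorm_integral_le_lintegral_enorm f).trans h1
  calc ‖∫ x, f x ∂μ‖ₑ ^ 2 ≤ (eLpNorm f 2 μ) ^ 2 := by gcongr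
    _ = ∫⁻ x, ‖f x‖ₑ ^ 2 ∂μ := by
      rw [eLpNorm_eq_lintegral_rpow_enorm_toReal two_ne_zero ENNReal.ofNat_ne_top,
        ← ENNReal.rpow_natCast, ← ENNReal.rpow_mul]
      simp

lemma measurable_enorm_gradient_sq {φ : E d → ℝ} (hφ : ContDiff ℝ 1 φ) :
    Measurable fun x => ‖gradient φ x‖ₑ ^ 2 :=
  (continuous_gradient hφ).measurable.enorm.pow_const 2

/-- Fundamental theorem of calculus along the segment, then Jensen on the unit interval. -/
lemma enorm_sub_sq_le {φ : E d → ℝ} (hφ : ContDiff ℝ 1 φ) (x y : E d) :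
    ‖φ y - φ x‖ₑ ^ 2 ≤
      ‖y - x‖ₑ ^ 2 * ∫⁻ s in Set.Ioc (0 : ℝ) 1, ‖gradient φ (x + s • (y - x))‖ₑ ^ 2 := by
  have hprob : IsProbabilityMeasure (volume.restrict (Set.Ioc (0 : ℝ) 1)) :=
    ⟨by simp⟩
  have hc : Continuous fun s : ℝ => ⟪gradient φ (x + s • (y - x)), y - x⟫ := by
    have := (continuous_gradient hφ).comp (by fun_prop : Continuous fun s : ℝ => x + s • (y - x))
    exact this.inner continuous_const
  have h1 : φ y - φ x = ∫ s in Set.Ioc (0 : ℝ) 1, ⟪gradient φ (x + s • (y - x)), y - x⟫ := by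
    rw [← intervalIntegral.integral_of_le zero_le_one]
    have hderiv : ∀ s ∈ Set.uIcc (0 : ℝ) 1, HasDerivAt (fun s : ℝ => φ (x + s • (y - x)))
        ⟪gradient φ (x + s • (y - x)), y - x⟫ s := by
      intro s _
      have h2 : HasDerivAt (fun s : ℝ => x + s • (y - x)) (y - x) s := by
        simpa using ((hasDerivAt_id s).smul_const (y - x)).const_add x
      rw [inner_gradient]
      exact (hφ.differentiable one_ne_zero (x + s • (y - x))).hasFDerivAt.comp_hasDerivAt s h2
    rw [intervalIntegral.integral_eq_sub_of_hasDerivAt hderiv (hc.intervalIntegrable 0 1)]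
    simp
  rw [h1]
  refine (enorm_integral_sq_le hc.aestronglyMeasurable).trans ?_
  rw [← lintegral_const_mul']
  · refine lintegral_mono fun s => ?_
    rw [← mul_pow]
    gcongr
    rw [mul_comm, ← ofReal_norm, ← ofReal_norm, ← ofReal_norm,
      ← ENNReal.ofReal_mul (norm_nonneg _)]
    exact ENNReal.ofReal_le_ofReal (norm_inner_le_norm _ _)
  · exact ENNReal.pow_ne_top enorm_ne_top

/-- Integrals under homotheties. -/
lemma setLIntegral_homothety_le {g : E d → ℝ≥0∞} (hg : Measurable g) {A B : Set (E d)}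
    (hA : MeasurableSet A) (hB : MeasurableSet B) (z : E d) {τ : ℝ} (hτ : 0 < τ)
    (h : ∀ x ∈ A, z + τ • (x - z) ∈ B) :
    ∫⁻ x in A, g (z + τ • (x - z)) ≤ ENNReal.ofReal ((τ ^ d)⁻¹) * ∫⁻ x in B, g x := by
  have h1 : ∫⁻ x in A, g (z + τ • (x - z)) ≤ ∫⁻ x, B.indicator g (z + τ • (x - z)) :=
    (setLIntegral_mono' hA fun x hx => by rw [Set.indicator_of_mem (h x hx)]).trans
      (setLIntegral_le_lintegral _ _)
  refine h1.trans (le_of_eq ?_)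
  have hF : Measurable fun x => B.indicator g (z + x) :=
    (hg.indicator hB).comp (measurable_const_add z)
  rw [lintegral_sub_right_eq_self (fun x => B.indicator g (z + τ • x)) z,
    ← lintegral_map (f := fun x => B.indicator g (z + x)) hF (measurable_const_smul τ),
    Measure.map_addHaar_smul _ hτ.ne', lintegral_smul_measure,
    lintegral_add_left_eq_self (B.indicator g) z, lintegral_indicator hB,
    finrank_euclideanSpace_fin, abs_of_pos (by positivity)]
  rfl

/-- The segment from `z + t (x - z)` to `x` consists of images of `x` under homotheties of ratio at
least `t` centred at `z`. These map `T` into itself, and changing variables costs at most `t⁻ᵈ`. -/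
lemma lintegral_homothety_sub_le {φ : E d → ℝ} (hφ : ContDiff ℝ 1 φ) {T : Set (E d)}
    (hT : MeasurableSet T) (hconv : Convex ℝ T) {z : E d} (hz : z ∈ T) {h t : ℝ} (hh : 0 ≤ h)
    (hball : ∀ x ∈ T, dist x z ≤ h) (ht0 : 0 < t) (ht1 : t ≤ 1) :
    ∫⁻ x in T, ‖φ x - φ (z + t • (x - z))‖ₑ ^ 2 ≤
      ENNReal.ofReal (h ^ 2 * (t ^ d)⁻¹) * ∫⁻ x in T, ‖gradient φ x‖ₑ ^ 2 := by
  set G : E d → ℝ≥0∞ := fun x => ‖gradient φ x‖ₑ ^ 2 with hG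
  have hGm : Measurable G := measurable_enorm_gradient_sq hφ
  have h1 : ∀ x ∈ T, ‖φ x - φ (z + t • (x - z))‖ₑ ^ 2 ≤
      ENNReal.ofReal (h ^ 2) * ∫⁻ s in Set.Ioc (0 : ℝ) 1, G (z + (t + s * (1 - t)) • (x - z)) := by
    intro x hx
    have h2 := enorm_sub_sq_le hφ (z + t • (x - z)) x
    have e1 : x - (z + t • (x - z)) = (1 - t) • (x - z) := by module
    have e2 : ∀ s : ℝ, z + t • (x - z) + s • ((1 - t) • (x - z)) =
        z + (t + s * (1 - t)) • (x - z) := fun s => by module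
    rw [e1] at h2
    simp only [e2] at h2
    refine h2.trans ?_
    gcongr
    rw [ENNReal.ofReal_pow hh, ← ofReal_norm]
    gcongr
    rw [norm_smul, Real.norm_of_nonneg (by linarith), ← dist_eq_norm]
    have := hball x hx
    have := dist_nonneg (x := x) (y := z)
    nlinarith
  have hm : Measurable (fun q : E d × ℝ => G (z + (t + q.2 * (1 - t)) • (q.1 - z))) :=
    hGm.comp (by fun_prop)
  calc ∫⁻ x in T, ‖φ x - φ (z + t • (x - z))‖ₑ ^ 2
      ≤ ∫⁻ x in T, ENNReal.ofReal (h ^ 2) *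
          ∫⁻ s in Set.Ioc (0 : ℝ) 1, G (z + (t + s * (1 - t)) • (x - z)) :=
        setLIntegral_mono' hT h1
    _ = ENNReal.ofReal (h ^ 2) * ∫⁻ s in Set.Ioc (0 : ℝ) 1, ∫⁻ x in T,
          G (z + (t + s * (1 - t)) • (x - z)) := by
        rw [lintegral_const_mul' _ _ ENNReal.ofReal_ne_top, lintegral_lintegral_swap hm.aemeasurable]
    _ ≤ ENNReal.ofReal (h ^ 2) * ∫⁻ s in Set.Ioc (0 : ℝ) 1,
          ENNReal.ofReal ((t ^ d)⁻¹) * ∫⁻ x in T, G x := by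
        refine mul_le_mul' le_rfl (setLIntegral_mono' measurableSet_Ioc fun s hs => ?_)
        have hτ : t ≤ t + s * (1 - t) := by nlinarith [hs.1, sub_nonneg.2 ht1]
        have hτ1 : t + s * (1 - t) ≤ 1 := by nlinarith [hs.2, sub_nonneg.2 ht1]
        refine (setLIntegral_homothety_le hGm hT hT z (ht0.trans_le hτ) fun x hx =>
          hconv.add_smul_sub_mem hz hx ⟨ht0.le.trans hτ, hτ1⟩).trans ?_
        gcongr
    _ = ENNReal.ofReal (h ^ 2 * (t ^ d)⁻¹) * ∫⁻ x in T, G x := by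
        rw [setLIntegral_const, Real.volume_Ioc, ENNReal.ofReal_mul (by positivity)]
        simp [mul_assoc]

/-- The Poincaré inequality on convex sets, in difference form. -/
lemma lintegral_lintegral_sub_le {φ : E d → ℝ} (hφ : ContDiff ℝ 1 φ) {K : Set (E d)}
    (hK : MeasurableSet K) (hconv : Convex ℝ K) {D : ℝ} (hD : 0 ≤ D)
    (hdiam : ∀ x ∈ K, ∀ y ∈ K, dist x y ≤ D) :
    ∫⁻ x in K, ∫⁻ y in K, ‖φ y - φ x‖ₑ ^ 2 ≤
      ENNReal.ofReal (D ^ 2 * 2 ^ d) * (volume K * ∫⁻ x in K, ‖gradient φ x‖ₑ ^ 2) := by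
  set G : E d → ℝ≥0∞ := fun x => ‖gradient φ x‖ₑ ^ 2 with hG
  have hGm : Measurable G := measurable_enorm_gradient_sq hφ
  have hstep : ∀ (x : E d) (s : ℝ), x ∈ K → 1 / 2 ≤ s → s ≤ 1 →
      ∫⁻ y in K, G (x + s • (y - x)) ≤ ENNReal.ofReal (2 ^ d) * ∫⁻ y in K, G y := by
    intro x s hx hs hs1
    refine (setLIntegral_homothety_le hGm hK hK x (by linarith) fun y hy =>
      hconv.add_smul_sub_mem hx hy ⟨by linarith, hs1⟩).trans ?_
    gcongr
    rw [← inv_pow]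
    gcongr
    rw [inv_le_comm₀ (by linarith) two_pos]
    linarith
  have hm3 : Measurable (fun q : (E d × E d) × ℝ => G (q.1.1 + q.2 • (q.1.2 - q.1.1))) :=
    hGm.comp (by fun_prop)
  have hJ : ∀ s ∈ Set.Ioc (0 : ℝ) 1, ∫⁻ x in K, ∫⁻ y in K, G (x + s • (y - x)) ≤
      ENNReal.ofReal (2 ^ d) * (volume K * ∫⁻ y in K, G y) := by
    intro s hs
    have hconst : ∫⁻ _ in K, ENNReal.ofReal (2 ^ d) * ∫⁻ y in K, G y =
        ENNReal.ofReal (2 ^ d) * (volume K * ∫⁻ y in K, G y) := by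
      rw [setLIntegral_const]; ring
    rw [← hconst]
    -- The change of variables degenerates as `s` tends to `0`. Integrating in `y` for `s ≥ 1/2`,
    -- and in `x` otherwise, keeps the Jacobian factor below `2ᵈ`.
    rcases le_total (1 / 2) s with hs2 | hs2
    · exact setLIntegral_mono' hK fun x hx => hstep x s hx hs2 hs.2
    · have hm2 : Measurable (fun q : E d × E d => G (q.1 + s • (q.2 - q.1))) :=
        hGm.comp (by fun_prop)
      rw [lintegral_lintegral_swap hm2.aemeasurable]
      refine setLIntegral_mono' hK fun y hy => ?_
      have e : ∀ x : E d, x + s • (y - x) = y + (1 - s) • (x - y) := fun x => by module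
      simp only [e]
      exact hstep y (1 - s) hy (by linarith) (by linarith [hs.1])
  calc ∫⁻ x in K, ∫⁻ y in K, ‖φ y - φ x‖ₑ ^ 2
      ≤ ∫⁻ x in K, ∫⁻ y in K, ENNReal.ofReal (D ^ 2) *
          ∫⁻ s in Set.Ioc (0 : ℝ) 1, G (x + s • (y - x)) := by
        refine setLIntegral_mono' hK fun x hx => setLIntegral_mono' hK fun y hy => ?_
        refine (enorm_sub_sq_le hφ x y).trans ?_
        gcongr
        rw [ENNReal.ofReal_pow hD, ← ofReal_norm, ← dist_eq_norm]
        gcongr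
        exact hdiam y hy x hx
    _ = ENNReal.ofReal (D ^ 2) * ∫⁻ s in Set.Ioc (0 : ℝ) 1, ∫⁻ x in K, ∫⁻ y in K,
          G (x + s • (y - x)) := by
        have e1 : ∀ x, ∫⁻ y in K, ENNReal.ofReal (D ^ 2) *
            ∫⁻ s in Set.Ioc (0 : ℝ) 1, G (x + s • (y - x)) = ENNReal.ofReal (D ^ 2) *
            ∫⁻ s in Set.Ioc (0 : ℝ) 1, ∫⁻ y in K, G (x + s • (y - x)) := by
          intro x
          have hm2 : Measurable (fun q : E d × ℝ => G (x + q.2 • (q.1 - x))) :=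
            hGm.comp (by fun_prop)
          rw [lintegral_const_mul' _ _ ENNReal.ofReal_ne_top,
            lintegral_lintegral_swap hm2.aemeasurable]
        simp only [e1]
        rw [lintegral_const_mul' _ _ ENNReal.ofReal_ne_top, lintegral_lintegral_swap]
        have hm4 : Measurable (fun q : (E d × ℝ) × E d => G (q.1.1 + q.1.2 • (q.2 - q.1.1))) :=
          hGm.comp (by fun_prop)
        exact hm4.lintegral_prod_right'.aemeasurable
    _ ≤ ENNReal.ofReal (D ^ 2) * ∫⁻ s in Set.Ioc (0 : ℝ) 1,
          ENNReal.ofReal (2 ^ d) * (volume K * ∫⁻ y in K, G y) := by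
        exact mul_le_mul' le_rfl (setLIntegral_mono' measurableSet_Ioc hJ)
    _ = _ := by
        rw [setLIntegral_const, Real.volume_Ioc, ENNReal.ofReal_mul (by positivity)]
        simp [mul_assoc]

/-- By Jensen, the deviation from the average is at most a double integral of differences. Enlarging
the small ball to the big one costs the volume ratio, at most `κᵈ`. -/
lemma lintegral_sub_average_le {φ : E d → ℝ} (hφ : ContDiff ℝ 1 φ) {z c : E d} {ρ ρ' κ : ℝ}
    (hρ' : 0 < ρ') (hsub : Metric.ball c ρ' ⊆ Metric.ball z ρ) (hκ : ρ ≤ κ * ρ') :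
    ∫⁻ x in Metric.ball z ρ, ‖φ x - ⨍ y in Metric.ball c ρ', φ y‖ₑ ^ 2 ≤
      ENNReal.ofReal (4 * (2 * κ) ^ d * ρ ^ 2) *
        ∫⁻ x in Metric.ball z ρ, ‖gradient φ x‖ₑ ^ 2 := by
  set B := Metric.ball z ρ with hB
  set B' := Metric.ball c ρ' with hB'
  have hρ : 0 < ρ := by
    have := hsub (Metric.mem_ball_self hρ')
    exact dist_nonneg.trans_lt this
  have hκ0 : 0 < κ := by
    by_contra! h
    nlinarith
  have hv0 : volume B' ≠ 0 := (Metric.measure_ball_pos volume c hρ').ne'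
  have hvt : volume B' ≠ ⊤ := measure_ball_lt_top.ne
  have hprob : IsProbabilityMeasure ((volume B')⁻¹ • volume.restrict B') :=
    ⟨by rw [Measure.smul_apply, Measure.restrict_apply_univ, smul_eq_mul,
      ENNReal.inv_mul_cancel hv0 hvt]⟩
  have hint : Integrable φ ((volume B')⁻¹ • volume.restrict B') := by
    refine Integrable.smul_measure ?_ (ENNReal.inv_ne_top.2 hv0)
    exact (hφ.continuous.continuousOn.integrableOn_compact
      (isCompact_closedBall c ρ')).mono_set Metric.ball_subset_closedBall
  have h1 : ∀ x, ‖φ x - ⨍ y in B', φ y‖ₑ ^ 2 ≤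
      (volume B')⁻¹ * ∫⁻ y in B, ‖φ y - φ x‖ₑ ^ 2 := by
    intro x
    have e : φ x - ⨍ y in B', φ y = ∫ y, (φ x - φ y) ∂((volume B')⁻¹ • volume.restrict B') := by
      rw [integral_sub (integrable_const _) hint, integral_const, setAverage_eq']
      simp
    rw [e]
    refine (enorm_integral_sq_le (aestronglyMeasurable_const.sub hint.aestronglyMeasurable)).trans ?_
    rw [lintegral_smul_measure, smul_eq_mul]
    refine mul_le_mul' le_rfl ?_
    simp only [Pi.sub_apply, enorm_sub_rev (φ x)]
    exact lintegral_mono_set hsub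
  have h2 := lintegral_lintegral_sub_le hφ (K := B) Metric.isOpen_ball.measurableSet (convex_ball z ρ)
    (D := 2 * ρ) (by positivity) fun x hx y hy => by
      have h3 := Metric.mem_ball.1 hx
      have h4 := Metric.mem_ball'.1 hy
      have := dist_triangle x z y
      linarith
  have hvol : (volume B')⁻¹ * volume B ≤ ENNReal.ofReal (κ ^ d) := by
    rw [hB, hB', Measure.addHaar_ball_of_pos _ _ hρ, Measure.addHaar_ball_of_pos _ _ hρ',
      finrank_euclideanSpace_fin]
    have hω0 : volume (Metric.ball (0 : E d) 1) ≠ 0 := (Metric.measure_ball_pos volume _ one_pos).ne'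
    have hωt : volume (Metric.ball (0 : E d) 1) ≠ ⊤ := measure_ball_lt_top.ne
    rw [mul_comm, ← div_eq_mul_inv, ENNReal.mul_div_mul_right _ _ hω0 hωt,
      ← ENNReal.ofReal_div_of_pos (by positivity)]
    refine ENNReal.ofReal_le_ofReal ?_
    rw [← div_pow]
    gcongr
    rwa [div_le_iff₀ hρ']
  calc ∫⁻ x in B, ‖φ x - ⨍ y in B', φ y‖ₑ ^ 2
      ≤ ∫⁻ x in B, (volume B')⁻¹ * ∫⁻ y in B, ‖φ y - φ x‖ₑ ^ 2 := lintegral_mono fun x => h1 x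
    _ = (volume B')⁻¹ * ∫⁻ x in B, ∫⁻ y in B, ‖φ y - φ x‖ₑ ^ 2 :=
        lintegral_const_mul' _ _ (ENNReal.inv_ne_top.2 hv0)
    _ ≤ (volume B')⁻¹ * (ENNReal.ofReal ((2 * ρ) ^ 2 * 2 ^ d) *
          (volume B * ∫⁻ x in B, ‖gradient φ x‖ₑ ^ 2)) := by gcongr
    _ = ENNReal.ofReal ((2 * ρ) ^ 2 * 2 ^ d) * ((volume B')⁻¹ * volume B) *
          ∫⁻ x in B, ‖gradient φ x‖ₑ ^ 2 := by ring
    _ ≤ ENNReal.ofReal ((2 * ρ) ^ 2 * 2 ^ d) * ENNReal.ofReal (κ ^ d) *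
          ∫⁻ x in B, ‖gradient φ x‖ₑ ^ 2 := by gcongr
    _ = _ := by
        rw [← ENNReal.ofReal_mul (by positivity)]
        congr 2
        rw [mul_pow 2 κ]
        ring

lemma ennreal_add_sq_le (a b : ℝ≥0∞) : (a + b) ^ 2 ≤ 2 * (a ^ 2 + b ^ 2) := by
  rcases eq_or_ne a ∞ with rfl | ha
  · simp
  rcases eq_or_ne b ∞ with rfl | hb
  · simp
  lift a to ℝ≥0 using ha
  lift b to ℝ≥0 using hb
  exact_mod_cast (add_sq_le : (a + b) ^ 2 ≤ 2 * (a ^ 2 + b ^ 2))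

/-- A Poincaré inequality on a convex set with the average over a ball near one of its points. -/
lemma lintegral_convex_sub_average_le {φ : E d → ℝ} (hφ : ContDiff ℝ 1 φ) {T : Set (E d)}
    (hT : MeasurableSet T) (hconv : Convex ℝ T) {z c : E d} (hz : z ∈ T) {h ρ ρ' κ : ℝ}
    (hball : ∀ x ∈ T, dist x z ≤ h) (hρ' : 0 < ρ') (hsub : Metric.ball c ρ' ⊆ Metric.ball z ρ)
    (hκ : ρ ≤ κ * ρ') (hρh : ρ ≤ h) (hhρ : h ≤ κ * ρ) :
    ∫⁻ x in T, ‖φ x - ⨍ y in Metric.ball c ρ', φ y‖ₑ ^ 2 ≤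
      ENNReal.ofReal (2 * (2 * κ) ^ d * (1 + 4 * (2 * κ) ^ d) * h ^ 2) *
        ((∫⁻ x in T, ‖gradient φ x‖ₑ ^ 2) + ∫⁻ x in Metric.ball z ρ, ‖gradient φ x‖ₑ ^ 2) := by
  set m := ⨍ y in Metric.ball c ρ', φ y with hm
  have hρ : 0 < ρ := by
    have := hsub (Metric.mem_ball_self hρ')
    exact dist_nonneg.trans_lt this
  have hh : 0 < h := hρ.trans_le hρh
  have hκ0 : 0 < κ := by
    by_contra! h
    nlinarith
  -- This ratio shrinks `T` into the ball of radius `ρ` around `z`. The deviation of `φ` from `m` on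
  -- `T` splits into the change along the homothety and the deviation on the ball.
  set t := (2 * κ)⁻¹ with ht
  have ht0 : 0 < t := by positivity
  have hκ1 : 1 ≤ κ := by
    by_contra! h1
    nlinarith
  have ht1 : t ≤ 1 := inv_le_one_of_one_le₀ (by linarith)
  have htd : (t ^ d)⁻¹ = (2 * κ) ^ d := by rw [ht, inv_pow, inv_inv]
  have h1 := lintegral_homothety_sub_le hφ hT hconv hz hh.le hball ht0 ht1
  have h2 : ∫⁻ x in T, ‖φ (z + t • (x - z)) - m‖ₑ ^ 2 ≤
      ENNReal.ofReal ((t ^ d)⁻¹) * ∫⁻ x in Metric.ball z ρ, ‖φ x - m‖ₑ ^ 2 := by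
    refine setLIntegral_homothety_le (g := fun x => ‖φ x - m‖ₑ ^ 2)
      ((hφ.continuous.measurable.sub_const m).enorm.pow_const 2) hT
      Metric.isOpen_ball.measurableSet z ht0 fun x hx => ?_
    rw [Metric.mem_ball, dist_eq_norm, add_sub_cancel_left, norm_smul, Real.norm_of_nonneg ht0.le,
      ← dist_eq_norm]
    calc t * dist x z ≤ t * h := by gcongr; exact hball x hx
      _ ≤ t * (κ * ρ) := by gcongr
      _ = ρ / 2 := by rw [ht]; field_simp
      _ < ρ := half_lt_self hρ
  have h3 := lintegral_sub_average_le hφ hρ' hsub hκ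
  have hpt : ∀ x, ‖φ x - m‖ₑ ^ 2 ≤ 2 * ‖φ x - φ (z + t • (x - z))‖ₑ ^ 2 +
      2 * ‖φ (z + t • (x - z)) - m‖ₑ ^ 2 := by
    intro x
    have e1 : ‖φ x - m‖ₑ ≤ ‖φ x - φ (z + t • (x - z))‖ₑ + ‖φ (z + t • (x - z)) - m‖ₑ := by
      have := enorm_add_le (φ x - φ (z + t • (x - z))) (φ (z + t • (x - z)) - m)
      rwa [sub_add_sub_cancel] at this
    calc ‖φ x - m‖ₑ ^ 2 ≤ (‖φ x - φ (z + t • (x - z))‖ₑ + ‖φ (z + t • (x - z)) - m‖ₑ) ^ 2 := by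
          gcongr
      _ ≤ _ := by
        rw [← mul_add]
        exact ennreal_add_sq_le _ _
  set IT := ∫⁻ x in T, ‖gradient φ x‖ₑ ^ 2
  set IB := ∫⁻ x in Metric.ball z ρ, ‖gradient φ x‖ₑ ^ 2
  have hmeas : Measurable fun x => 2 * ‖φ x - φ (z + t • (x - z))‖ₑ ^ 2 := by
    have := hφ.continuous.measurable
    have h4 : Measurable fun x : E d => φ (z + t • (x - z)) := this.comp (by fun_prop)
    exact ((this.sub h4).enorm.pow_const 2).const_mul 2
  calc ∫⁻ x in T, ‖φ x - m‖ₑ ^ 2 ≤ ∫⁻ x in T, (2 * ‖φ x - φ (z + t • (x - z))‖ₑ ^ 2 +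
        2 * ‖φ (z + t • (x - z)) - m‖ₑ ^ 2) := lintegral_mono hpt
    _ = 2 * (∫⁻ x in T, ‖φ x - φ (z + t • (x - z))‖ₑ ^ 2) +
          2 * ∫⁻ x in T, ‖φ (z + t • (x - z)) - m‖ₑ ^ 2 := by
        rw [lintegral_add_left hmeas, lintegral_const_mul' _ _ ENNReal.ofNat_ne_top,
          lintegral_const_mul' _ _ ENNReal.ofNat_ne_top]
    _ ≤ 2 * (ENNReal.ofReal (h ^ 2 * (t ^ d)⁻¹) * IT) +
          2 * (ENNReal.ofReal ((t ^ d)⁻¹) * (ENNReal.ofReal (4 * (2 * κ) ^ d * ρ ^ 2) * IB)) := by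
        gcongr
        exact h2.trans (by gcongr)
    _ = ENNReal.ofReal (2 * (h ^ 2 * (t ^ d)⁻¹)) * IT +
          ENNReal.ofReal (2 * ((t ^ d)⁻¹ * (4 * (2 * κ) ^ d * ρ ^ 2))) * IB := by
        rw [ENNReal.ofReal_mul (p := 2) (by norm_num), ENNReal.ofReal_mul (p := 2) (by norm_num),
          ENNReal.ofReal_mul (p := (t ^ d)⁻¹) (by positivity), ENNReal.ofReal_ofNat]
        ring
    _ ≤ _ := by
        rw [mul_add, htd]
        gcongr ENNReal.ofReal ?_ * _ + ENNReal.ofReal ?_ * _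
        · have : 0 ≤ (2 * κ) ^ d * (2 * κ) ^ d * h ^ 2 := by positivity
          nlinarith
        · have h5 : ρ ^ 2 ≤ h ^ 2 := by gcongr
          calc 2 * ((2 * κ) ^ d * (4 * (2 * κ) ^ d * ρ ^ 2))
              ≤ 2 * ((2 * κ) ^ d * (4 * (2 * κ) ^ d * h ^ 2)) := by gcongr
            _ ≤ _ := by
              have : 0 ≤ (2 * κ) ^ d * h ^ 2 := by positivity
              nlinarith

end SemilinearFEM

namespace SemilinearFEM

open scoped Classical

variable {d : ℕ}

/-! ### Local scales and the Poincaré inequality on vertex stars -/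

namespace Mesh

variable {Ω : Set (E d)} {𝒯 : Mesh Ω}

lemma size_le_diam (hbdd : Bornology.IsBounded Ω) {T : Finset (E d)} (hT : T ∈ 𝒯.elems) :
    size T ≤ Metric.diam (closure Ω) :=
  Metric.diam_mono (𝒯.simplex_subset hT) hbdd.closure

/-- A length scale `ρ`, and a ball `B(c, ρ')`, at the vertex `z`, adapted to the star of `z`. -/
structure IsLocalScale (𝒯 : Mesh Ω) (κ : ℝ) (z : E d) (ρ : ℝ) (c : E d) (ρ' : ℝ) : Prop where
  pos : 0 < ρ'
  ball_subset : Metric.ball c ρ' ⊆ Metric.ball z ρ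
  le_mul : ρ ≤ κ * ρ'
  le_size : ∀ T ∈ 𝒯.star z, ρ ≤ size T
  size_le : ∀ T ∈ 𝒯.star z, size T ≤ κ * ρ
  subset_star : ∀ x ∈ Metric.ball z ρ, x ∈ closure Ω → ∃ T ∈ 𝒯.star z, x ∈ convexHull ℝ (T : Set (E d))
  notMem : z ∉ Ω → ∀ x ∈ Metric.ball c ρ', x ∉ Ω
  card_le : ((𝒯.star z).card : ℝ) ≤ κ

/-- The constant `κ` is chosen before the mesh: it depends only on `σ`, `d`, the chart data `r`, `L`
and the diameter of the domain. The scale `ρ` is a fixed fraction of the size of one element of the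
star. -/
lemma exists_isLocalScale (hd : 2 ≤ d) (hΩ : IsOpen Ω) (hbdd : Bornology.IsBounded Ω)
    (hreg : interior (closure Ω) ⊆ Ω) {r : ℝ} {L : ℝ≥0} (hr : 0 < r) (hL : 1 ≤ L)
    (hgraph : ∀ z ∈ closure Ω, ∃ e F, IsGraphDomain Ω z r L e F) {σ : ℝ} (hσ : 1 ≤ σ) :
    ∃ κ : ℝ, 1 ≤ κ ∧ ∀ 𝒯 : Mesh Ω, 𝒯.IsShapeRegular σ → ∀ z, (𝒯.star z).Nonempty →
      ∃ ρ c ρ', 𝒯.IsLocalScale κ z ρ c ρ' := by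
  have hL1 : (1 : ℝ) ≤ L := by exact_mod_cast hL
  obtain ⟨N, hN⟩ := exists_nat_ge ((2 * σ) ^ d)
  have hσ0 : 0 < σ := by linarith
  set Λ := σ ^ N with hΛ
  have hΛ1 : 1 ≤ Λ := one_le_pow₀ hσ
  have hΛ0 : 0 < Λ := by linarith
  set D := Metric.diam (closure Ω) + 1 with hD
  have hD0 : 0 < D := by have := Metric.diam_nonneg (s := closure Ω); linarith
  -- The first bound keeps the connecting paths of `exists_mem_star` below the inradii in the star,
  -- the second keeps them inside the chart of radius `r`.
  set c₀ := min ((1 + 2 * L) * Λ * σ)⁻¹ (r / ((1 + 2 * L) * D)) with hc₀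
  have hc0 : 0 < c₀ := by positivity
  have hc1 : (1 + 2 * L) * c₀ * (Λ * σ) ≤ 1 := by
    have : c₀ ≤ ((1 + 2 * L) * Λ * σ)⁻¹ := min_le_left _ _
    rw [← one_div, le_div_iff₀ (by positivity)] at this
    linarith
  have hc2 : (1 + 2 * L) * c₀ * D ≤ r := by
    have : c₀ ≤ r / ((1 + 2 * L) * D) := min_le_right _ _
    rw [le_div_iff₀ (by positivity)] at this
    linarith
  -- The summands bound, in turn, the element sizes relative to `ρ`, the ratio `ρ / ρ'`, and the
  -- number of elements in the star.
  refine ⟨Λ / c₀ + 2 * L + N, ?_, ?_⟩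
  · have : 0 < Λ / c₀ := by positivity
    have : (0 : ℝ) ≤ N := by positivity
    linarith
  intro 𝒯 h𝒯 z ⟨T₀, hT₀⟩
  have hzT₀ := mem_star.1 hT₀
  have hzc : z ∈ closure Ω := 𝒯.simplex_subset hzT₀.1 (subset_convexHull ℝ _ hzT₀.2)
  obtain ⟨e, F, hF⟩ := hgraph z hzc
  have hcard : (𝒯.star z).card ≤ N := by
    exact_mod_cast (h𝒯.card_star_le hσ (by omega) z).trans hN
  have hcomp : ∀ T ∈ 𝒯.star z, ∀ T' ∈ 𝒯.star z, size T' ≤ Λ * size T := fun T hT T' hT' =>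
    (h𝒯.size_le_of_star hσ hd hr hF hΩ hreg hT hT').trans
      (mul_le_mul_of_nonneg_right (pow_le_pow_right₀ hσ hcard) (size_nonneg T))
  have hH := h𝒯.size_pos (by omega) hzT₀.1
  set H := size T₀ with hHdef
  have hHD : H ≤ D := (size_le_diam hbdd hzT₀.1).trans (by linarith)
  have hρ : 0 < c₀ * H := by positivity
  have hc3 : c₀ * Λ ≤ 1 := by
    have h1 : 1 ≤ (1 + 2 * (L : ℝ)) := by linarith
    have : c₀ * Λ * 1 ≤ c₀ * Λ * ((1 + 2 * L) * σ) := by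
      gcongr
      nlinarith
    linarith
  have hδr : (1 + 2 * (L : ℝ)) * (c₀ * H) ≤ r := by
    calc (1 + 2 * (L : ℝ)) * (c₀ * H) = (1 + 2 * (L : ℝ)) * c₀ * H := by ring
      _ ≤ (1 + 2 * (L : ℝ)) * c₀ * D := by gcongr
      _ ≤ r := hc2
  have hNn : (0 : ℝ) ≤ N := by positivity
  have hle1 : c₀ * H ≤ r := by nlinarith
  have hLc : 0 < Λ / c₀ := by positivity
  -- At an interior vertex the averaging ball is the whole ball `B(z, ρ)`; otherwise it lies below
  -- the graph, outside `Ω`.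
  have hex : ∃ c ρ', 0 < ρ' ∧ Metric.ball c ρ' ⊆ Metric.ball z (c₀ * H) ∧ c₀ * H ≤ 2 * L * ρ' ∧
      (z ∉ Ω → ∀ x ∈ Metric.ball c ρ', x ∉ Ω) := by
    by_cases hz : z ∈ Ω
    · exact ⟨z, c₀ * H, hρ, subset_rfl, by nlinarith, fun h => absurd hz h⟩
    · have := hF.ball_disjoint hr hL hz (t := c₀ * H / 2) (by positivity) (by linarith)
      refine ⟨_, c₀ * H / 2 / L, by positivity, fun x hx => ?_, ?_, fun _ x hx => (this x hx).1⟩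
      · have h1 := (this x hx).2
        rwa [mul_div_cancel₀ _ (two_ne_zero)] at h1
      · apply le_of_eq; field_simp
  obtain ⟨c, ρ', hρ', hsub, hle, hnot⟩ := hex
  refine ⟨c₀ * H, c, ρ', hρ', hsub, ?_, ?_, ?_, ?_, hnot, ?_⟩
  · refine hle.trans (mul_le_mul_of_nonneg_right ?_ hρ'.le)
    linarith
  · intro T hT
    have h1 := hcomp T hT T₀ hT₀
    calc c₀ * H ≤ c₀ * (Λ * size T) := by gcongr
      _ = c₀ * Λ * size T := by ring
      _ ≤ 1 * size T := by gcongr; exact size_nonneg T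
      _ = size T := one_mul _
  · intro T hT
    calc size T ≤ Λ * H := hcomp T₀ hT₀ T hT
      _ = Λ / c₀ * (c₀ * H) := by field_simp
      _ ≤ _ := by gcongr; linarith
  · intro x hx hxc
    obtain ⟨T, hT, hxT⟩ := 𝒯.exists_simplex hxc
    refine ⟨T, mem_star.2 ⟨hT, ?_⟩, hxT⟩
    refine exists_mem_star hF hzT₀.1 hzT₀.2 (ρ := H / (Λ * σ)) (by positivity) ?_ hδr ?_ hx hxc T hT
      hxT
    · intro T' hT' hzT'
      obtain ⟨c', ρ'', hρ'', hb, hs⟩ := h𝒯 T' hT'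
      refine ⟨c', ρ'', ?_, hb⟩
      rw [div_le_iff₀ (by positivity)]
      calc H ≤ Λ * size T' := hcomp T' (mem_star.2 ⟨hT', hzT'⟩) T₀ hT₀
        _ ≤ Λ * (σ * ρ'') := by gcongr
        _ = _ := by ring
    · rw [le_div_iff₀ (by positivity)]
      calc (1 + 2 * (L : ℝ)) * (c₀ * H) * (Λ * σ) = (1 + 2 * L) * c₀ * (Λ * σ) * H := by ring
        _ ≤ 1 * H := by gcongr
        _ = H := one_mul H
  · have : ((𝒯.star z).card : ℝ) ≤ N := by exact_mod_cast hcard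
    linarith

/-- The squared `L²` norm of the gradient of `φ` on a simplex. -/
def gradSq (φ : E d → ℝ) (T : Finset (E d)) : ℝ :=
  ∫ x in convexHull ℝ (T : Set (E d)), ‖gradient φ x‖ ^ 2

lemma gradSq_nonneg (φ : E d → ℝ) (T : Finset (E d)) : 0 ≤ gradSq φ T :=
  integral_nonneg fun _ => by positivity

lemma ofReal_setIntegral_sq {F : Type*} [NormedAddCommGroup F] {g : E d → F} (hg : Continuous g)
    (T : Finset (E d)) :
    ENNReal.ofReal (∫ x in convexHull ℝ (T : Set (E d)), ‖g x‖ ^ 2) =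
      ∫⁻ x in convexHull ℝ (T : Set (E d)), ‖g x‖ₑ ^ 2 := by
  rw [ofReal_integral_eq_lintegral_ofReal]
  · exact lintegral_congr fun x => by rw [ENNReal.ofReal_pow (norm_nonneg _), ofReal_norm]
  · exact (hg.norm.pow 2).continuousOn.integrableOn_compact (isCompact_simplex T)
  · exact Eventually.of_forall fun x => by positivity

/-- The Poincaré inequality in the star of a vertex. -/
lemma IsLocalScale.exists_sub_le {κ : ℝ} {z : E d} {ρ : ℝ} {c : E d} {ρ' : ℝ}
    (h : 𝒯.IsLocalScale κ z ρ c ρ') (hκ : 1 ≤ κ) {φ : E d → ℝ} (hφ : IsTestFunction Ω φ) :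
    ∃ m : ℝ, (z ∉ Ω → m = 0) ∧ ∀ T ∈ 𝒯.star z,
      ∫ x in convexHull ℝ (T : Set (E d)), ‖φ x - m‖ ^ 2 ≤
        2 * (2 * (2 * κ) ^ d * (1 + 4 * (2 * κ) ^ d)) * size T ^ 2 *
          ∑ T' ∈ 𝒯.star z, gradSq φ T' := by
  have hφ1 : ContDiff ℝ 1 φ := hφ.contDiff.of_le (by simp)
  have hκ0 : 0 < κ := by linarith
  -- For a boundary vertex the averaging ball lies outside `Ω`, where `φ` vanishes, so the mean is
  -- zero.
  refine ⟨⨍ y in Metric.ball c ρ', φ y, fun hz => ?_, fun T hT => ?_⟩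
  · rw [setAverage_eq, setIntegral_congr_fun (g := fun _ => 0) Metric.isOpen_ball.measurableSet
      fun x hx => hφ.eq_zero (h.notMem hz x hx)]
    simp
  have hsz := size_nonneg T
  have hzT := mem_star.1 hT
  have key := lintegral_convex_sub_average_le hφ1 (measurableSet_simplex T) (convex_convexHull ℝ _)
    (subset_convexHull ℝ _ hzT.2 : z ∈ convexHull ℝ (T : Set (E d)))
    (fun x hx => dist_le_size hx (subset_convexHull ℝ _ hzT.2)) h.pos h.ball_subset h.le_mul
    (h.le_size T hT) (h.size_le T hT)
  set S : ℝ := ∑ T' ∈ 𝒯.star z, gradSq φ T' with hS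
  have hS0 : 0 ≤ S := Finset.sum_nonneg fun T' _ => gradSq_nonneg φ T'
  have hgT : ∫⁻ x in convexHull ℝ (T : Set (E d)), ‖gradient φ x‖ₑ ^ 2 ≤ ENNReal.ofReal S := by
    rw [← ofReal_setIntegral_sq hφ.continuous_gradient]
    exact ENNReal.ofReal_le_ofReal
      (Finset.single_le_sum (f := gradSq φ) (fun T' _ => gradSq_nonneg φ T') hT)
  -- The ball may leave `Ω`, but `∇φ` vanishes there, and the rest of the ball is covered by the
  -- star.
  have hgB : ∫⁻ x in Metric.ball z ρ, ‖gradient φ x‖ₑ ^ 2 ≤ ENNReal.ofReal S := by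
    rw [hS, ENNReal.ofReal_sum_of_nonneg fun T' _ => gradSq_nonneg φ T']
    calc ∫⁻ x in Metric.ball z ρ, ‖gradient φ x‖ₑ ^ 2
        = ∫⁻ x, (Metric.ball z ρ).indicator (fun x => ‖gradient φ x‖ₑ ^ 2) x :=
          (lintegral_indicator Metric.isOpen_ball.measurableSet _).symm
      _ ≤ ∫⁻ x, ∑ T' ∈ 𝒯.star z,
            (convexHull ℝ (T' : Set (E d))).indicator (fun x => ‖gradient φ x‖ₑ ^ 2) x := by
          refine lintegral_mono fun x => ?_
          by_cases hx : x ∈ Metric.ball z ρ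
          · rw [Set.indicator_of_mem hx]
            by_cases hxΩ : x ∈ Ω
            · obtain ⟨T', hT', hxT'⟩ := h.subset_star x hx (subset_closure hxΩ)
              refine le_trans (le_of_eq ?_) (Finset.single_le_sum (f := fun T' : Finset (E d) =>
                (convexHull ℝ (T' : Set (E d))).indicator (fun x => ‖gradient φ x‖ₑ ^ 2) x)
                (fun _ _ => zero_le) hT')
              rw [Set.indicator_of_mem hxT']
            · rw [hφ.gradient_eq_zero hxΩ]
              simp
          · rw [Set.indicator_of_notMem hx]
            exact zero_le
      _ = ∑ T' ∈ 𝒯.star z, ENNReal.ofReal (gradSq φ T') := by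
          rw [lintegral_finsetSum _ fun T' _ =>
            (measurable_enorm_gradient_sq hφ1).indicator (measurableSet_simplex T')]
          refine Finset.sum_congr rfl fun T' _ => ?_
          rw [lintegral_indicator (measurableSet_simplex T'), gradSq,
            ofReal_setIntegral_sq hφ.continuous_gradient]
  have hcont : Continuous fun x => φ x - ⨍ y in Metric.ball c ρ', φ y :=
    hφ1.continuous.sub continuous_const
  rw [← ofReal_setIntegral_sq hcont] at key
  refine (ENNReal.ofReal_le_ofReal_iff (by positivity)).1 (key.trans ?_)
  calc _ ≤ ENNReal.ofReal (2 * (2 * κ) ^ d * (1 + 4 * (2 * κ) ^ d) * size T ^ 2) *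
        (ENNReal.ofReal S + ENNReal.ofReal S) := by gcongr
    _ = _ := by
      rw [← ENNReal.ofReal_add hS0 hS0, ← ENNReal.ofReal_mul (by positivity)]
      congr 1
      ring

end Mesh

end SemilinearFEM

namespace SemilinearFEM

open scoped Classical

variable {d : ℕ}

/-! ### Residuals localized to the star of a vertex -/

lemma integral_norm_mul_norm_le {α F G : Type*} [MeasurableSpace α] [NormedAddCommGroup F]
    [NormedAddCommGroup G] {μ : Measure α} {f : α → F} {g : α → G} (hf : MemLp f 2 μ)
    (hg : MemLp g 2 μ) :
    ∫ x, ‖f x‖ * ‖g x‖ ∂μ ≤ √(∫ x, ‖f x‖ ^ 2 ∂μ) * √(∫ x, ‖g x‖ ^ 2 ∂μ) := by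
  have := integral_mul_norm_le_Lp_mul_Lq (μ := μ) (p := 2) (q := 2) (f := fun x => ‖f x‖)
    (g := fun x => ‖g x‖) ⟨by norm_num, by norm_num, by norm_num⟩ (by simpa using hf.norm)
    (by simpa using hg.norm)
  simpa [Real.sqrt_eq_rpow] using this

lemma volume_real_simplex_le {T : Finset (E d)} {z : E d} (hz : z ∈ T) {R : ℝ} (hR : size T ≤ R) :
    volume.real (convexHull ℝ (T : Set (E d))) ≤
      R ^ d * (volume : Measure (E d)).real (Metric.ball 0 1) := by
  have h0 : 0 ≤ R := (size_nonneg T).trans hR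
  calc volume.real (convexHull ℝ (T : Set (E d))) ≤ volume.real (Metric.closedBall z R) := by
        refine measureReal_mono (fun x hx => ?_) measure_closedBall_lt_top.ne
        exact Metric.mem_closedBall.2 ((dist_le_size hx (subset_convexHull ℝ _ hz)).trans hR)
    _ = _ := by
        rw [Measure.real, Measure.addHaar_closedBall _ _ h0, ENNReal.toReal_mul,
          ENNReal.toReal_ofReal (by positivity)]
        simp [Measure.real]

lemma memLp_simplex {F : Type*} [NormedAddCommGroup F] {g : E d → F} (hg : Continuous g)
    (T : Finset (E d)) (p : ℝ≥0∞) : MemLp g p (volume.restrict (convexHull ℝ (T : Set (E d)))) := by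
  have hfin : IsFiniteMeasure (volume.restrict (convexHull ℝ (T : Set (E d)))) :=
    ⟨by rw [Measure.restrict_apply_univ]; exact (isCompact_simplex T).measure_lt_top⟩
  obtain ⟨C, hC⟩ := (isCompact_simplex T).exists_bound_of_continuousOn hg.continuousOn
  refine MemLp.of_bound hg.aestronglyMeasurable C ?_
  rw [ae_restrict_iff' (measurableSet_simplex T)]
  exact Eventually.of_forall hC

/-- The coordinates add up to `1`, so their gradients cancel. Hence the hat gradients drop out when
the localized residuals are summed. -/
lemma sum_bg {T s : Finset (E d)} (hT : IsSimplex T) (hs : T ⊆ s) : ∑ z ∈ s, bg T z = 0 := by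
  rw [← Finset.sum_subset hs fun z _ hz => bg_of_notMem hz]
  refine ext_inner_right ℝ fun w => ?_
  have h1 : ∀ z, ⟪bg T z, w⟫ = bc T z w - bc T z 0 := fun z => by rw [bc_sub, sub_zero]
  rw [sum_inner, inner_zero_left, Finset.sum_congr rfl fun z _ => h1 z, Finset.sum_sub_distrib,
    sum_bc hT, sum_bc hT, sub_self]

namespace Mesh

variable {Ω : Set (E d)} {𝒯 : Mesh Ω}

/-- The gradient of the product of a hat function and `φ - m`. -/
def hatGrad (𝒯 : Mesh Ω) (z : E d) (φ : E d → ℝ) (m : ℝ) (x : E d) : E d :=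
  𝒯.hat z x • gradient φ x + (φ x - m) • gradient (𝒯.hat z) x

lemma hatGrad_ae (𝒯 : Mesh Ω) (z : E d) (φ : E d → ℝ) (m : ℝ) {T : Finset (E d)}
    (hT : T ∈ 𝒯.elems) : ∀ᵐ x ∂(volume.restrict (convexHull ℝ (T : Set (E d)))),
      𝒯.hatGrad z φ m x = bc T z x • gradient φ x + (φ x - m) • bg T z := by
  filter_upwards [(𝒯.pwAffine_hat z).gradient_ae hT,
    ae_restrict_mem (measurableSet_simplex T)] with x hx hxT
  rw [hatGrad, hx, hat_eq hT hxT]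

lemma integrableOn_hatGrad (𝒯 : Mesh Ω) (hΩ : IsOpen Ω) (hreg : interior (closure Ω) ⊆ Ω)
    (z : E d) {φ : E d → ℝ} (hφ : IsTestFunction Ω φ) (m : ℝ) :
    IntegrableOn (𝒯.hatGrad z φ m) Ω := by
  have hφ1 : ContDiff ℝ 1 φ := hφ.contDiff.of_le (by simp)
  exact ((𝒯.pwAffine_hat z).integrableOn_mul_gradient hΩ hreg hφ1).add
    ((𝒯.pwAffine_hat z).integrableOn_gradient_mul hΩ hreg (hφ1.continuous.sub continuous_const))

/-- The part with `φ` has mean zero because `gradient (𝒯.hat z)` is the weak gradient of the hat.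
The part with `m` is absent at boundary vertices and has mean zero at interior ones. This replaces
elementwise integration by parts. -/
lemma integral_hatGrad (𝒯 : Mesh Ω) (hΩ : IsOpen Ω) (hbdd : Bornology.IsBounded Ω)
    (hreg : interior (closure Ω) ⊆ Ω) {z : E d} {φ : E d → ℝ} (hφ : IsTestFunction Ω φ) {m : ℝ}
    (hm : z ∉ Ω → m = 0) : ∫ x in Ω, 𝒯.hatGrad z φ m x = 0 := by
  have hφ1 : ContDiff ℝ 1 φ := hφ.contDiff.of_le (by simp)
  have h := 𝒯.pwAffine_hat z
  have i1 := h.integrableOn_mul_gradient hΩ hreg hφ1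
  have i2 := h.integrableOn_gradient_mul hΩ hreg hφ1.continuous
  have i3 : IntegrableOn (fun x => m • gradient (𝒯.hat z) x) Ω :=
    h.integrableOn_gradient_mul hΩ hreg (continuous_const (y := m))
  have e : ∀ x, 𝒯.hatGrad z φ m x = 𝒯.hat z x • gradient φ x + φ x • gradient (𝒯.hat z) x -
      m • gradient (𝒯.hat z) x := fun x => by rw [hatGrad, sub_smul, add_sub_assoc]
  simp only [e]
  have i4 : IntegrableOn (fun x => 𝒯.hat z x • gradient φ x + φ x • gradient (𝒯.hat z) x) Ω :=
    i1.add i2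
  rw [integral_sub i4 i3, integral_add i1 i2, h.hasWeakGradient hΩ hreg φ hφ, neg_add_cancel,
    zero_sub, neg_eq_zero, integral_smul]
  by_cases hz : z ∈ Ω
  · rw [integral_gradient_hat hΩ hbdd hreg hz, smul_zero]
  · rw [hm hz, zero_smul]

/-- The integral of a function that vanishes on the elements off the star of `z`. -/
lemma integral_eq_sum_star {F : Type*} [NormedAddCommGroup F] [NormedSpace ℝ F] (𝒯 : Mesh Ω)
    (hΩ : IsOpen Ω) (hreg : interior (closure Ω) ⊆ Ω) {f : E d → F} (hf : IntegrableOn f Ω) (z : E d)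
    (h0 : ∀ T ∈ 𝒯.elems, z ∉ T → ∀ᵐ x ∂(volume.restrict (convexHull ℝ (T : Set (E d)))), f x = 0) :
    ∫ x in Ω, f x = ∑ T ∈ 𝒯.star z, ∫ x in convexHull ℝ (T : Set (E d)), f x := by
  rw [𝒯.integral_eq_sum hΩ hreg hf]
  refine (Finset.sum_subset (fun T hT => (mem_star.1 hT).1) fun T hT hn => ?_).symm
  exact integral_eq_zero_of_ae (h0 T hT fun hz => hn (mem_star.2 ⟨hT, hz⟩))

lemma hatGrad_ae_eq_zero (𝒯 : Mesh Ω) (z : E d) (φ : E d → ℝ) (m : ℝ) {T : Finset (E d)}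
    (hT : T ∈ 𝒯.elems) (hz : z ∉ T) :
    ∀ᵐ x ∂(volume.restrict (convexHull ℝ (T : Set (E d)))), 𝒯.hatGrad z φ m x = 0 := by
  filter_upwards [𝒯.hatGrad_ae z φ m hT] with x hx
  rw [hx, bc_of_notMem hz, bg_of_notMem hz]
  simp

/-- Bound for the mean of `hatGrad` on an element. -/
lemma norm_integral_hatGrad_le {σ : ℝ} (h𝒯 : 𝒯.IsShapeRegular σ) (hd : 0 < d) (hσ : 0 < σ)
    {T : Finset (E d)} (hT : T ∈ 𝒯.elems) (z : E d) {φ : E d → ℝ} (hφ : IsTestFunction Ω φ)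
    {m P Y : ℝ} (hY : √(gradSq φ T) ≤ Y)
    (hP : √(∫ x in convexHull ℝ (T : Set (E d)), ‖φ x - m‖ ^ 2) ≤ P * size T * Y) :
    ‖∫ x in convexHull ℝ (T : Set (E d)), 𝒯.hatGrad z φ m x‖ ≤
      √(volume.real (convexHull ℝ (T : Set (E d)))) * ((1 + σ * P) * Y) := by
  have hφ1 : ContDiff ℝ 1 φ := hφ.contDiff.of_le (by simp)
  have hTs := 𝒯.isSimplex hT
  have hs := h𝒯.size_pos hd hT
  obtain ⟨c, ρ, hρ, hb, hsz⟩ := h𝒯 T hT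
  -- The factor `1 / size T` of the hat gradient is compensated by the factor `size T` of the
  -- Poincaré bound `hP`.
  have hbg : ‖bg T z‖ ≤ σ / size T := by
    refine (norm_bg_le hTs hρ hb z).trans ?_
    rw [← one_div, div_le_div_iff₀ hρ hs]
    linarith
  have hfin : IsFiniteMeasure (volume.restrict (convexHull ℝ (T : Set (E d)))) :=
    ⟨by rw [Measure.restrict_apply_univ]; exact (isCompact_simplex T).measure_lt_top⟩
  have hone : ∀ {F : Type} [NormedAddCommGroup F] (g : E d → F), Continuous g →
      ∫ x in convexHull ℝ (T : Set (E d)), ‖g x‖ ≤ √(volume.real (convexHull ℝ (T : Set (E d)))) *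
        √(∫ x in convexHull ℝ (T : Set (E d)), ‖g x‖ ^ 2) := by
    intro F _ g hg
    have := integral_norm_mul_norm_le (memLp_const (1 : ℝ)) (memLp_simplex hg T 2)
    simpa using this
  have hint : ∀ {F : Type} [NormedAddCommGroup F] (g : E d → F), Continuous g →
      IntegrableOn (fun x => ‖g x‖) (convexHull ℝ (T : Set (E d))) := fun g hg =>
    hg.norm.continuousOn.integrableOn_compact (isCompact_simplex T)
  have hcφ : Continuous fun x => φ x - m := hφ1.continuous.sub continuous_const
  have i1 := hint _ hφ.continuous_gradient
  have i2 := hint _ hcφ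
  set V := √(volume.real (convexHull ℝ (T : Set (E d))))
  calc ‖∫ x in convexHull ℝ (T : Set (E d)), 𝒯.hatGrad z φ m x‖
      ≤ ∫ x in convexHull ℝ (T : Set (E d)), (‖gradient φ x‖ + ‖φ x - m‖ * (σ / size T)) := by
        refine norm_integral_le_of_norm_le (i1.add (i2.mul_const _)) ?_
        filter_upwards [𝒯.hatGrad_ae z φ m hT, ae_restrict_mem (measurableSet_simplex T)] with x hx hxT
        rw [hx]
        refine (norm_add_le _ _).trans (add_le_add ?_ ?_)
        · rw [norm_smul, Real.norm_of_nonneg ((mem_convexHull_iff hTs).1 hxT z)]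
          exact mul_le_of_le_one_left (norm_nonneg _) (bc_le_one hTs hxT z)
        · rw [norm_smul]
          gcongr
    _ = (∫ x in convexHull ℝ (T : Set (E d)), ‖gradient φ x‖) +
          (∫ x in convexHull ℝ (T : Set (E d)), ‖φ x - m‖) * (σ / size T) := by
        rw [integral_add i1 (i2.mul_const _), integral_mul_const]
    _ ≤ V * Y + V * (P * size T * Y) * (σ / size T) := by
        gcongr
        · exact (hone _ hφ.continuous_gradient).trans (by gcongr; exact hY)
        · exact (hone _ hcφ).trans (by gcongr)
    _ = V * ((1 + σ * P) * Y) := by field_simp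

end Mesh

end SemilinearFEM

namespace SemilinearFEM

open scoped Classical

variable {d : ℕ}

namespace Mesh

variable {Ω : Set (E d)} {𝒯 : Mesh Ω} {v : E d → ℝ} {b : Finset (E d) → E d} {g : E d → E d}

lemma jumpNormSq_nonneg (𝒯 : Mesh Ω) (v : E d → ℝ) (T : Finset (E d)) : 0 ≤ jumpNormSq 𝒯 v T :=
  Finset.sum_nonneg fun _ _ => sq_nonneg _

/-- The constant in the bound of gradient jumps by the jump terms of the estimator. -/
def sideConst (d : ℕ) (σ : ℝ) : ℝ :=
  (volume : Measure (E (d - 1))).real (Metric.ball 0 1) * (σ * d)⁻¹ ^ (d - 1)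

lemma sideConst_pos (hd : 0 < d) {σ : ℝ} (hσ : 0 < σ) : 0 < sideConst d σ := by
  have h1 : 0 < (volume : Measure (E (d - 1))).real (Metric.ball 0 1) := by
    rw [Measure.real]
    exact ENNReal.toReal_pos (Metric.measure_ball_pos _ _ one_pos).ne' measure_ball_lt_top.ne
  have h2 : (0 : ℝ) < d := by exact_mod_cast hd
  unfold sideConst
  positivity

/-- The gradients on the elements at a vertex differ by the jumps across the sides. -/
lemma IsLocalScale.norm_sub_mul_le {κ : ℝ} {z : E d} {ρ : ℝ} {c : E d} {ρ' : ℝ}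
    (h : 𝒯.IsLocalScale κ z ρ c ρ') (hd : 0 < d) (hΩ : IsOpen Ω) (hreg : interior (closure Ω) ⊆ Ω)
    {r : ℝ} (hr : 0 < r) {L : ℝ≥0} {e : E d} {F : E d → ℝ} (hF : IsGraphDomain Ω z r L e F)
    {σ : ℝ} (hσ : 0 < σ) (h𝒯 : 𝒯.IsShapeRegular σ) (hv : 𝒯.PwAffine v b) {T T' : Finset (E d)}
    (hT : T ∈ 𝒯.star z) (hT' : T' ∈ 𝒯.star z) {X : ℝ} (hX0 : 0 ≤ X)
    (hX : ∀ T ∈ 𝒯.star z, size T * jumpNormSq 𝒯 v T ≤ X ^ 2) :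
    ‖b T' - b T‖ * √(sideConst d σ * ρ ^ d) ≤ κ * X := by
  have hρ : 0 < ρ := dist_nonneg.trans_lt (h.ball_subset (Metric.mem_ball_self h.pos))
  have hs := sideConst_pos hd hσ
  -- On every element of the star, `w ^ 2` is at most the weight of a squared gradient jump in
  -- `norm_sub_sq_le_jumpNormSq`. Each passage through a side therefore costs at most `X`, and at
  -- most `κ` of them are counted.
  set w := √(sideConst d σ * ρ ^ d) with hw
  have hw0 : 0 ≤ w := Real.sqrt_nonneg _
  have key := star_induction hr hF hΩ hreg hT (fun n T' => ‖b T' - b T‖ * w ≤ n * X) (by simp) ?_ ?_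
    T' hT'
  · exact key.trans (mul_le_mul_of_nonneg_right h.card_le hX0)
  · intro n T₁ hn
    push_cast
    linarith
  · intro n T₁ hT₁ T₂ hT₂ hnb hn
    have h1 := hv.norm_sub_sq_le_jumpNormSq hd hσ h𝒯 (mem_star.1 hT₁).1 hnb
    have h2 : (‖b T₂ - b T₁‖ * w) ^ 2 ≤ X ^ 2 := by
      rw [mul_pow, hw, Real.sq_sqrt (by positivity), norm_sub_rev]
      refine le_trans ?_ (h1.trans (hX T₁ hT₁))
      rw [← mul_assoc (Measure.real _ _), ← sideConst]
      gcongr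
      exact h.le_size T₁ hT₁
    have h3 := abs_le_of_sq_le_sq' h2 hX0
    have h4 : ‖b T₂ - b T‖ ≤ ‖b T₂ - b T₁‖ + ‖b T₁ - b T‖ := norm_sub_le_norm_sub_add_norm_sub _ _ _
    have h5 := mul_le_mul_of_nonneg_right h4 hw0
    push_cast
    linarith [h3.2]

lemma integrableOn_simplex {G : Type*} [NormedAddCommGroup G] {f : E d → G} (hf : IntegrableOn f Ω)
    (hΩ : IsOpen Ω) (hreg : interior (closure Ω) ⊆ Ω) {T : Finset (E d)} (hT : T ∈ 𝒯.elems) :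
    IntegrableOn f (convexHull ℝ (T : Set (E d))) :=
  Integrable.mono_measure hf (𝒯.restrict_le hΩ hreg hT)

lemma integrableOn_inner_hatGrad (hΩ : IsOpen Ω) (hreg : interior (closure Ω) ⊆ Ω)
    (hg : ∀ T ∈ 𝒯.elems, ∀ᵐ x ∂(volume.restrict (convexHull ℝ (T : Set (E d)))), g x = b T)
    (z : E d) {φ : E d → ℝ} (hφ : IsTestFunction Ω φ) (m : ℝ) :
    IntegrableOn (fun x => ⟪g x, 𝒯.hatGrad z φ m x⟫) Ω :=
  𝒯.integrable_of_forall_simplex hΩ hreg fun T hT => by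
    have h1 : Continuous fun x => ⟪b T, bc T z x • gradient φ x + (φ x - m) • bg T z⟫ :=
      continuous_const.inner (((continuous_bc T z).smul hφ.continuous_gradient).add
        ((hφ.contDiff.continuous.sub continuous_const).smul continuous_const))
    refine (h1.continuousOn.integrableOn_compact (isCompact_simplex T)).congr ?_
    filter_upwards [hg T hT, 𝒯.hatGrad_ae z φ m hT] with x h1 h2
    rw [h1, h2]

lemma integrableOn_mul_hat_mul (hΩ : IsOpen Ω) (hreg : interior (closure Ω) ⊆ Ω)
    {q : E d → ℝ} (hq : IntegrableOn q Ω) (z : E d) {ψ : E d → ℝ} (hψ : Continuous ψ) :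
    IntegrableOn (fun x => q x * (𝒯.hat z x * ψ x)) Ω :=
  𝒯.integrable_of_forall_simplex hΩ hreg fun T hT =>
    (integrableOn_simplex hq hΩ hreg hT).mul_continuousOn
      (((𝒯.pwAffine_hat z).continuousOn_simplex hT).mul hψ.continuousOn) (isCompact_simplex T)

/-- The constant in the local residual estimate. -/
def localConst (d : ℕ) (σ κ P : ℝ) : ℝ :=
  κ * P + κ * (κ * √(κ ^ d * (volume : Measure (E d)).real (Metric.ball 0 1) / sideConst d σ) *
    (1 + σ * P))

/-- The residual, localized to the star of a vertex. -/
lemma IsLocalScale.abs_residual_le {κ : ℝ} {z : E d} {ρ : ℝ} {c : E d} {ρ' : ℝ}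
    (h : 𝒯.IsLocalScale κ z ρ c ρ') (hκ : 1 ≤ κ) (hd : 0 < d) (hΩ : IsOpen Ω)
    (hbdd : Bornology.IsBounded Ω) (hreg : interior (closure Ω) ⊆ Ω)
    {r : ℝ} (hr : 0 < r) {L : ℝ≥0} {e : E d} {F : E d → ℝ} (hF : IsGraphDomain Ω z r L e F)
    {σ : ℝ} (hσ : 0 < σ) (h𝒯 : 𝒯.IsShapeRegular σ) (hv : 𝒯.PwAffine v b)
    (hg : ∀ T ∈ 𝒯.elems, ∀ᵐ x ∂(volume.restrict (convexHull ℝ (T : Set (E d)))), g x = b T)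
    {q : E d → ℝ} (hq : MemLp q 2 (volume.restrict Ω)) {η : Finset (E d) → ℝ}
    (hη : ∀ T ∈ 𝒯.elems, size T ^ 2 * ∫ x in convexHull ℝ (T : Set (E d)), ‖q x‖ ^ 2 ≤ η T)
    (hη' : ∀ T ∈ 𝒯.elems, size T * jumpNormSq 𝒯 v T ≤ η T)
    {φ : E d → ℝ} (hφ : IsTestFunction Ω φ) {m : ℝ} (hm : z ∉ Ω → m = 0) {P : ℝ} (hP0 : 0 ≤ P)
    (hP : ∀ T ∈ 𝒯.star z, ∫ x in convexHull ℝ (T : Set (E d)), ‖φ x - m‖ ^ 2 ≤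
        P ^ 2 * size T ^ 2 * ∑ T' ∈ 𝒯.star z, gradSq φ T') :
    |(∫ x in Ω, q x * (𝒯.hat z x * (φ x - m))) - ∫ x in Ω, ⟪g x, 𝒯.hatGrad z φ m x⟫| ≤
      localConst d σ κ P * (√(∑ T ∈ 𝒯.star z, η T) * √(∑ T ∈ 𝒯.star z, gradSq φ T)) := by
  have hfin : IsFiniteMeasure (volume.restrict Ω : Measure (E d)) :=
    ⟨by rw [Measure.restrict_apply_univ]; exact hbdd.measure_lt_top⟩
  have hφc : Continuous fun x => φ x - m := hφ.contDiff.continuous.sub continuous_const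
  have hη0 : ∀ T ∈ 𝒯.star z, 0 ≤ η T := fun T hT =>
    (mul_nonneg (size_nonneg T) (jumpNormSq_nonneg 𝒯 v T)).trans (hη' T (mem_star.1 hT).1)
  set X := √(∑ T ∈ 𝒯.star z, η T) with hX
  set Y := √(∑ T ∈ 𝒯.star z, gradSq φ T) with hY
  have hX0 : 0 ≤ X := Real.sqrt_nonneg _
  have hY0 : 0 ≤ Y := Real.sqrt_nonneg _
  have hX2 : ∀ T ∈ 𝒯.star z, η T ≤ X ^ 2 := fun T hT => by
    rw [hX, Real.sq_sqrt (Finset.sum_nonneg hη0)]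
    exact Finset.single_le_sum (f := η) hη0 hT
  have hP' : ∀ T ∈ 𝒯.star z,
      √(∫ x in convexHull ℝ (T : Set (E d)), ‖φ x - m‖ ^ 2) ≤ P * size T * Y := by
    intro T hT
    have := size_nonneg T
    refine Real.sqrt_le_iff.2 ⟨by positivity, (hP T hT).trans (le_of_eq ?_)⟩
    rw [mul_pow, hY, Real.sq_sqrt (Finset.sum_nonneg fun T _ => gradSq_nonneg φ T)]
    ring
  have hgY : ∀ T ∈ 𝒯.star z, √(gradSq φ T) ≤ Y := fun T hT =>
    Real.sqrt_le_sqrt (Finset.single_le_sum (f := gradSq φ) (fun T _ => gradSq_nonneg φ T) hT)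
  have hρ : 0 < ρ := dist_nonneg.trans_lt (h.ball_subset (Metric.mem_ball_self h.pos))
  have hs := sideConst_pos hd hσ
  have hqi : IntegrableOn q Ω := hq.integrable (by norm_num)
  have first : |∫ x in Ω, q x * (𝒯.hat z x * (φ x - m))| ≤ κ * (P * (X * Y)) := by
    rw [𝒯.integral_eq_sum_star hΩ hreg (integrableOn_mul_hat_mul hΩ hreg hqi z hφc) z]
    · refine (Finset.abs_sum_le_sum_abs _ _).trans
        ((Finset.sum_le_card_nsmul _ _ (P * (X * Y)) fun T hT => ?_).trans ?_)
      · have hTe := (mem_star.1 hT).1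
        have hqT : MemLp q 2 (volume.restrict (convexHull ℝ (T : Set (E d)))) :=
          hq.mono_measure (𝒯.restrict_le hΩ hreg hTe)
        have hsz := size_nonneg T
        have hqX : size T * √(∫ x in convexHull ℝ (T : Set (E d)), ‖q x‖ ^ 2) ≤ X := by
          refine abs_le_of_sq_le_sq' ?_ hX0 |>.2
          rw [mul_pow, Real.sq_sqrt (integral_nonneg fun _ => by positivity)]
          exact (hη T hTe).trans (hX2 T hT)
        calc |∫ x in convexHull ℝ (T : Set (E d)), q x * (𝒯.hat z x * (φ x - m))|
            ≤ ∫ x in convexHull ℝ (T : Set (E d)), ‖q x‖ * ‖φ x - m‖ := by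
              rw [← Real.norm_eq_abs]
              refine norm_integral_le_of_norm_le ?_ (Eventually.of_forall fun x => ?_)
              · exact IntegrableOn.mul_continuousOn (integrableOn_simplex hqi hΩ hreg hTe).norm
                  hφc.norm.continuousOn (isCompact_simplex T)
              · rw [norm_mul, norm_mul, Real.norm_of_nonneg (hat_nonneg z x)]
                gcongr
                exact mul_le_of_le_one_left (norm_nonneg _) (hat_le_one z x)
          _ ≤ √(∫ x in convexHull ℝ (T : Set (E d)), ‖q x‖ ^ 2) *
                √(∫ x in convexHull ℝ (T : Set (E d)), ‖φ x - m‖ ^ 2) :=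
              integral_norm_mul_norm_le hqT (memLp_simplex hφc T 2)
          _ ≤ √(∫ x in convexHull ℝ (T : Set (E d)), ‖q x‖ ^ 2) * (P * size T * Y) := by
              gcongr
              exact hP' T hT
          _ = P * ((size T * √(∫ x in convexHull ℝ (T : Set (E d)), ‖q x‖ ^ 2)) * Y) := by ring
          _ ≤ P * (X * Y) := by gcongr
      · rw [nsmul_eq_mul]
        exact mul_le_mul_of_nonneg_right h.card_le (by positivity)
    · intro T hT hz
      filter_upwards [ae_restrict_mem (measurableSet_simplex T)] with x hx
      rw [hat_eq hT hx, bc_of_notMem hz]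
      simp
  set A := √(κ ^ d * (volume : Measure (E d)).real (Metric.ball 0 1) / sideConst d σ) with hA
  have second : |∫ x in Ω, ⟪g x, 𝒯.hatGrad z φ m x⟫| ≤ κ * (κ * A * (1 + σ * P) * (X * Y)) := by
    rw [𝒯.integral_eq_sum_star hΩ hreg (integrableOn_inner_hatGrad hΩ hreg hg z hφ m) z]
    · have hsum : ∑ T ∈ 𝒯.star z, ∫ x in convexHull ℝ (T : Set (E d)), 𝒯.hatGrad z φ m x = 0 := by
        rw [← 𝒯.integral_eq_sum_star hΩ hreg (𝒯.integrableOn_hatGrad hΩ hreg z hφ m) z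
          fun T hT hz => 𝒯.hatGrad_ae_eq_zero z φ m hT hz]
        exact 𝒯.integral_hatGrad hΩ hbdd hreg hφ hm
      have hin : ∀ T ∈ 𝒯.star z, ∫ x in convexHull ℝ (T : Set (E d)), ⟪g x, 𝒯.hatGrad z φ m x⟫ =
          ⟪b T, ∫ x in convexHull ℝ (T : Set (E d)), 𝒯.hatGrad z φ m x⟫ := by
        intro T hT
        have hTe := (mem_star.1 hT).1
        rw [← integral_inner (𝕜 := ℝ)
          (integrableOn_simplex (𝒯.integrableOn_hatGrad hΩ hreg z hφ m) hΩ hreg hTe)]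
        refine integral_congr_ae ?_
        filter_upwards [hg T hTe] with x hx
        rw [hx]
      rw [Finset.sum_congr rfl hin]
      rcases (𝒯.star z).eq_empty_or_nonempty with he | ⟨T₀, hT₀⟩
      · rw [he, Finset.sum_empty, abs_zero]
        positivity
      -- The element means add up to zero, so the gradient on a fixed `T₀` can be subtracted from
      -- all the others; only differences of gradients remain.
      have hsub : ∑ T ∈ 𝒯.star z, ⟪b T, ∫ x in convexHull ℝ (T : Set (E d)), 𝒯.hatGrad z φ m x⟫ =
          ∑ T ∈ 𝒯.star z,
            ⟪b T - b T₀, ∫ x in convexHull ℝ (T : Set (E d)), 𝒯.hatGrad z φ m x⟫ := by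
        simp only [inner_sub_left]
        rw [Finset.sum_sub_distrib, ← inner_sum, hsum, inner_zero_right, sub_zero]
      rw [hsub]
      refine (Finset.abs_sum_le_sum_abs _ _).trans
        ((Finset.sum_le_card_nsmul _ _ (κ * A * (1 + σ * P) * (X * Y)) fun T hT => ?_).trans ?_)
      · have hTe := mem_star.1 hT
        have h1 := h.norm_sub_mul_le hd hΩ hreg hr hF hσ h𝒯 hv hT₀ hT hX0
          fun T hT => (hη' T (mem_star.1 hT).1).trans (hX2 T hT)
        have h2 := norm_integral_hatGrad_le h𝒯 hd hσ hTe.1 z hφ (hgY T hT) (hP' T hT)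
        -- The element has volume at most that of a ball of radius `κ ρ`, and `A` is the resulting
        -- ratio to the weight `√(sideConst d σ * ρ ^ d)` of the gradient differences.
        have h3 : √(volume.real (convexHull ℝ (T : Set (E d)))) ≤ A * √(sideConst d σ * ρ ^ d) := by
          rw [hA, ← Real.sqrt_mul (by positivity)]
          refine Real.sqrt_le_sqrt ((volume_real_simplex_le hTe.2 (h.size_le T hT)).trans
            (le_of_eq ?_))
          rw [mul_pow]
          field_simp
        calc |⟪b T - b T₀, ∫ x in convexHull ℝ (T : Set (E d)), 𝒯.hatGrad z φ m x⟫|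
            ≤ ‖b T - b T₀‖ * ‖∫ x in convexHull ℝ (T : Set (E d)), 𝒯.hatGrad z φ m x‖ :=
              abs_real_inner_le_norm _ _
          _ ≤ ‖b T - b T₀‖ * (A * √(sideConst d σ * ρ ^ d) * ((1 + σ * P) * Y)) := by
              gcongr
              exact h2.trans (by gcongr)
          _ = ‖b T - b T₀‖ * √(sideConst d σ * ρ ^ d) * (A * ((1 + σ * P) * Y)) := by ring
          _ ≤ κ * X * (A * ((1 + σ * P) * Y)) := by gcongr
          _ = _ := by ring
      · rw [nsmul_eq_mul]
        exact mul_le_mul_of_nonneg_right h.card_le (by positivity)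
    · intro T hT hz
      filter_upwards [𝒯.hatGrad_ae_eq_zero z φ m hT hz] with x hx
      rw [hx, inner_zero_right]
  calc _ ≤ |∫ x in Ω, q x * (𝒯.hat z x * (φ x - m))| + |∫ x in Ω, ⟪g x, 𝒯.hatGrad z φ m x⟫| :=
        abs_sub _ _
    _ ≤ κ * (P * (X * Y)) + κ * (κ * A * (1 + σ * P) * (X * Y)) := add_le_add first second
    _ = _ := by rw [localConst]; ring

end Mesh

end SemilinearFEM

namespace SemilinearFEM

open scoped Classical

variable {d : ℕ}

/-! ### Summation over the vertices: the global residual bound -/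

namespace Mesh

variable {Ω : Set (E d)} {𝒯 : Mesh Ω} {v : E d → ℝ} {b : Finset (E d) → E d} {g : E d → E d}

/-- The vertices of a mesh. -/
def vertices (𝒯 : Mesh Ω) : Finset (E d) := 𝒯.elems.biUnion id

lemma subset_vertices {T : Finset (E d)} (hT : T ∈ 𝒯.elems) : T ⊆ 𝒯.vertices :=
  fun _ hz => Finset.mem_biUnion.2 ⟨T, hT, hz⟩

/-- Each element belongs to the stars of exactly its `d + 1` vertices. This is the finite overlap of
the localization. -/
lemma sum_star_eq (𝒯 : Mesh Ω) (η : Finset (E d) → ℝ) :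
    ∑ z ∈ 𝒯.vertices, ∑ T ∈ 𝒯.star z, η T = (d + 1) * ∑ T ∈ 𝒯.elems, η T := by
  rw [Finset.sum_comm' (t' := 𝒯.elems) (s' := fun T => T), Finset.mul_sum]
  · refine Finset.sum_congr rfl fun T hT => ?_
    rw [Finset.sum_const, 𝒯.card_eq T hT, nsmul_eq_mul]
    push_cast
    rfl
  · intro z T
    rw [mem_star]
    exact ⟨fun h => ⟨h.2.2, h.2.1⟩, fun h => ⟨subset_vertices h.2 h.1, h.2, h.1⟩⟩

lemma integrableOn_inner_gradient_hat (hΩ : IsOpen Ω) (hreg : interior (closure Ω) ⊆ Ω)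
    (hg : ∀ T ∈ 𝒯.elems, ∀ᵐ x ∂(volume.restrict (convexHull ℝ (T : Set (E d)))), g x = b T)
    (z : E d) : IntegrableOn (fun x => ⟪g x, gradient (𝒯.hat z) x⟫) Ω :=
  𝒯.integrable_of_forall_simplex hΩ hreg fun T hT => by
    have h1 : Continuous fun _ : E d => ⟪b T, bg T z⟫ := continuous_const
    refine (h1.continuousOn.integrableOn_compact (isCompact_simplex T)).congr ?_
    filter_upwards [hg T hT, (𝒯.pwAffine_hat z).gradient_ae hT] with x h1 h2
    rw [h1, h2]

/-- By Galerkin orthogonality, `φ` may be replaced by `φ - m` in the residual at interior vertices. -/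
lemma residual_sub_const (hΩ : IsOpen Ω) (hreg : interior (closure Ω) ⊆ Ω)
    (hg : ∀ T ∈ 𝒯.elems, ∀ᵐ x ∂(volume.restrict (convexHull ℝ (T : Set (E d)))), g x = b T)
    {q : E d → ℝ} (hq : IntegrableOn q Ω) {z : E d}
    (hgal : z ∈ Ω → ∫ x in Ω, q x * 𝒯.hat z x = ∫ x in Ω, ⟪g x, gradient (𝒯.hat z) x⟫)
    {φ : E d → ℝ} (hφ : IsTestFunction Ω φ) {m : ℝ} (hm : z ∉ Ω → m = 0) :
    (∫ x in Ω, q x * (𝒯.hat z x * (φ x - m))) - ∫ x in Ω, ⟪g x, 𝒯.hatGrad z φ m x⟫ =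
      (∫ x in Ω, q x * (𝒯.hat z x * φ x)) - ∫ x in Ω, ⟪g x, 𝒯.hatGrad z φ 0 x⟫ := by
  by_cases hz : z ∈ Ω
  swap
  · rw [hm hz]
    simp only [sub_zero]
  have i1 := integrableOn_mul_hat_mul (𝒯 := 𝒯) hΩ hreg hq z hφ.contDiff.continuous
  have i2 := integrableOn_mul_hat_mul (𝒯 := 𝒯) hΩ hreg hq z (continuous_const (y := (1 : ℝ)))
  simp only [mul_one] at i2
  have i3 := integrableOn_inner_hatGrad hΩ hreg hg z hφ 0
  have i4 := integrableOn_inner_gradient_hat hΩ hreg hg z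
  have e1 : ∀ x, q x * (𝒯.hat z x * (φ x - m)) =
      q x * (𝒯.hat z x * φ x) - m * (q x * 𝒯.hat z x) := fun x => by ring
  have e2 : ∀ x, ⟪g x, 𝒯.hatGrad z φ m x⟫ =
      ⟪g x, 𝒯.hatGrad z φ 0 x⟫ - m * ⟪g x, gradient (𝒯.hat z) x⟫ := fun x => by
    simp only [hatGrad, inner_add_right, inner_smul_right]
    ring
  simp only [e1, e2]
  rw [integral_sub i1 (i2.const_mul m), integral_sub i3 (i4.const_mul m), integral_const_mul,
    integral_const_mul, hgal hz]
  ring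

/-- The residual is the sum of its localizations by the hat functions. -/
lemma residual_eq_sum (hΩ : IsOpen Ω) (hreg : interior (closure Ω) ⊆ Ω)
    (hg : ∀ T ∈ 𝒯.elems, ∀ᵐ x ∂(volume.restrict (convexHull ℝ (T : Set (E d)))), g x = b T)
    {q : E d → ℝ} (hq : IntegrableOn q Ω) {φ : E d → ℝ} (hφ : IsTestFunction Ω φ) :
    (∫ x in Ω, q x * φ x) - ∫ x in Ω, ⟪g x, gradient φ x⟫ =
      ∑ z ∈ 𝒯.vertices, ((∫ x in Ω, q x * (𝒯.hat z x * φ x)) -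
        ∫ x in Ω, ⟪g x, 𝒯.hatGrad z φ 0 x⟫) := by
  rw [Finset.sum_sub_distrib, ← integral_finsetSum _ fun z _ =>
    integrableOn_mul_hat_mul (𝒯 := 𝒯) hΩ hreg hq z hφ.contDiff.continuous,
    ← integral_finsetSum _ fun z _ => integrableOn_inner_hatGrad hΩ hreg hg z hφ 0]
  congr 1
  · refine integral_congr_ae (𝒯.ae_of_forall_simplex hΩ hreg fun T hT => ?_)
    filter_upwards [ae_restrict_mem (measurableSet_simplex T)] with x hx
    rw [← Finset.mul_sum, ← Finset.sum_mul, Finset.sum_congr rfl fun z _ => hat_eq hT hx z,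
      ← Finset.sum_subset (subset_vertices hT) fun z _ hz => by rw [bc_of_notMem hz]; rfl,
      sum_bc (𝒯.isSimplex hT), one_mul]
  · refine integral_congr_ae (𝒯.ae_of_forall_simplex hΩ hreg fun T hT => ?_)
    have hall : ∀ᵐ x ∂(volume.restrict (convexHull ℝ (T : Set (E d)))), ∀ z ∈ 𝒯.vertices,
        𝒯.hatGrad z φ 0 x = bc T z x • gradient φ x + (φ x - 0) • bg T z :=
      (Finset.eventually_all _).2 fun z _ => 𝒯.hatGrad_ae z φ 0 hT
    filter_upwards [hall] with x hx
    rw [← inner_sum, Finset.sum_congr rfl hx, Finset.sum_add_distrib, ← Finset.sum_smul,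
      ← Finset.smul_sum, sum_bg (𝒯.isSimplex hT) (subset_vertices hT), smul_zero, add_zero,
      ← Finset.sum_subset (subset_vertices hT) fun z _ hz => by rw [bc_of_notMem hz]; rfl,
      sum_bc (𝒯.isSimplex hT), one_smul]

/-- The residual of a discrete function is bounded by the estimator, uniformly over shape regular
meshes. -/
lemma exists_residual_bound (hd : 2 ≤ d) (hΩ : IsOpen Ω) (hbdd : Bornology.IsBounded Ω)
    (hlip : HasLipschitzBoundary Ω) {σ : ℝ} (hσ : 1 ≤ σ) :
    ∃ C : ℝ, 0 < C ∧ ∀ 𝒯 : Mesh Ω, 𝒯.IsShapeRegular σ →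
      ∀ (v : E d → ℝ) (b : Finset (E d) → E d) (g : E d → E d), 𝒯.PwAffine v b →
      (∀ T ∈ 𝒯.elems, ∀ᵐ x ∂(volume.restrict (convexHull ℝ (T : Set (E d)))), g x = b T) →
      ∀ q : E d → ℝ, MemLp q 2 (volume.restrict Ω) →
      (∀ z ∈ Ω, ∫ x in Ω, q x * 𝒯.hat z x = ∫ x in Ω, ⟪g x, gradient (𝒯.hat z) x⟫) →
      ∀ η : Finset (E d) → ℝ,
      (∀ T ∈ 𝒯.elems, size T ^ 2 * ∫ x in convexHull ℝ (T : Set (E d)), ‖q x‖ ^ 2 ≤ η T) →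
      (∀ T ∈ 𝒯.elems, size T * jumpNormSq 𝒯 v T ≤ η T) →
      ∀ φ : E d → ℝ, IsTestFunction Ω φ →
        |(∫ x in Ω, q x * φ x) - ∫ x in Ω, ⟪g x, gradient φ x⟫| ≤
          C * (√(∑ T ∈ 𝒯.elems, η T) * √(∫ x in Ω, ‖gradient φ x‖ ^ 2)) := by
  obtain ⟨r, L, hr, hL, hgraph⟩ := exists_uniform_isGraphDomain (by omega) hΩ hbdd hlip
  have hreg : interior (closure Ω) ⊆ Ω := fun z hz => by
    obtain ⟨e, F, hF⟩ := hgraph z (interior_subset hz)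
    exact hF.mem_of_mem_interior_closure hr hz
  obtain ⟨κ, hκ, hscale⟩ := exists_isLocalScale hd hΩ hbdd hreg hr hL hgraph hσ
  have hσ0 : 0 < σ := by linarith
  have hκ0 : 0 < κ := by linarith
  set P := √(2 * (2 * (2 * κ) ^ d * (1 + 4 * (2 * κ) ^ d))) with hPdef
  have hP0 : 0 < P := Real.sqrt_pos.2 (by positivity)
  have hP2 : P ^ 2 = 2 * (2 * (2 * κ) ^ d * (1 + 4 * (2 * κ) ^ d)) := Real.sq_sqrt (by positivity)
  have hC0 : 0 < localConst d σ κ P := by unfold localConst; positivity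
  -- After Cauchy-Schwarz over the vertices, each of the two square roots contributes a factor `√(d
  -- + 1)` from the overlap of the stars.
  refine ⟨localConst d σ κ P * (d + 1), by positivity, ?_⟩
  intro 𝒯 h𝒯 v b g hv hg q hq hgal η hη hη' φ hφ
  have hfin : IsFiniteMeasure (volume.restrict Ω : Measure (E d)) :=
    ⟨by rw [Measure.restrict_apply_univ]; exact hbdd.measure_lt_top⟩
  have hqi : IntegrableOn q Ω := hq.integrable (by norm_num)
  have hloc : ∀ z ∈ 𝒯.vertices, |(∫ x in Ω, q x * (𝒯.hat z x * φ x)) -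
      ∫ x in Ω, ⟪g x, 𝒯.hatGrad z φ 0 x⟫| ≤
        localConst d σ κ P * (√(∑ T ∈ 𝒯.star z, η T) * √(∑ T ∈ 𝒯.star z, gradSq φ T)) := by
    intro z hz
    obtain ⟨T, hT, hzT⟩ := Finset.mem_biUnion.1 hz
    obtain ⟨ρ, c, ρ', hls⟩ := hscale 𝒯 h𝒯 z ⟨T, mem_star.2 ⟨hT, hzT⟩⟩
    obtain ⟨m, hm, hmP⟩ := hls.exists_sub_le hκ hφ
    obtain ⟨e, F, hF⟩ := hgraph z (𝒯.simplex_subset hT (subset_convexHull ℝ _ hzT))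
    rw [← residual_sub_const hΩ hreg hg hqi (hgal z) hφ hm]
    exact hls.abs_residual_le hκ (by omega) hΩ hbdd hreg hr hF hσ0 h𝒯 hv hg hq hη hη' hφ hm hP0.le
      (by rw [hP2]; exact hmP)
  have hη0 : ∀ T ∈ 𝒯.elems, 0 ≤ η T := fun T hT =>
    (mul_nonneg (size_nonneg T) (jumpNormSq_nonneg 𝒯 v T)).trans (hη' T hT)
  have hgrad : ∑ T ∈ 𝒯.elems, gradSq φ T = ∫ x in Ω, ‖gradient φ x‖ ^ 2 :=
    (𝒯.integral_eq_sum hΩ hreg (𝒯.integrable_of_forall_simplex hΩ hreg fun T _ =>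
      (hφ.continuous_gradient.norm.pow 2).continuousOn.integrableOn_compact
        (isCompact_simplex T))).symm
  calc _ ≤ ∑ z ∈ 𝒯.vertices, localConst d σ κ P *
        (√(∑ T ∈ 𝒯.star z, η T) * √(∑ T ∈ 𝒯.star z, gradSq φ T)) := by
        rw [residual_eq_sum hΩ hreg hg hqi hφ]
        exact (Finset.abs_sum_le_sum_abs _ _).trans (Finset.sum_le_sum hloc)
    _ ≤ localConst d σ κ P * (√(∑ z ∈ 𝒯.vertices, ∑ T ∈ 𝒯.star z, η T) *
          √(∑ z ∈ 𝒯.vertices, ∑ T ∈ 𝒯.star z, gradSq φ T)) := by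
        rw [← Finset.mul_sum]
        gcongr
        exact Real.sum_sqrt_mul_sqrt_le _
          (fun z => Finset.sum_nonneg fun T hT => hη0 T (mem_star.1 hT).1)
          (fun z => Finset.sum_nonneg fun T _ => gradSq_nonneg φ T)
    _ = _ := by
        have hd1 : (0 : ℝ) ≤ d + 1 := by positivity
        rw [sum_star_eq, sum_star_eq, hgrad, Real.sqrt_mul hd1, Real.sqrt_mul hd1]
        linear_combination localConst d σ κ P * √(∑ T ∈ 𝒯.elems, η T) *
          √(∫ x in Ω, ‖gradient φ x‖ ^ 2) * Real.mul_self_sqrt hd1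

end Mesh

end SemilinearFEM

namespace SemilinearFEM

open scoped Classical

variable {d : ℕ}

/-! ### Nemytskii operators -/

/-- Carathéodory functions preserve measurability. -/
lemma IsCaratheodory.aestronglyMeasurable_comp {Ω : Set (E d)} {a : E d → ℝ → ℝ}
    (ha : IsCaratheodory Ω a) {u : E d → ℝ} (hu : AEStronglyMeasurable u (volume.restrict Ω)) :
    AEStronglyMeasurable (fun x => a x (u x)) (volume.restrict Ω) := by
  obtain ⟨w, hw, huw⟩ := hu
  -- Measurability in `x` settles simple functions, where only finitely many values of `y` occur;
  -- continuity in `y` then passes to their limits.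
  have hsimple : ∀ s : SimpleFunc (E d) ℝ, AEMeasurable (fun x => a x (s x)) (volume.restrict Ω) := by
    intro s
    have e : (fun x => a x (s x)) =
        fun x => ∑ c ∈ s.range, (s ⁻¹' {c}).indicator (fun x => a x c) x := by
      funext x
      rw [Finset.sum_eq_single (s x)]
      · rw [Set.indicator_of_mem]; rfl
      · intro c _ hc
        exact Set.indicator_of_notMem (fun h => hc (Eq.symm h)) _
      · intro h
        exact absurd (s.mem_range_self x) h
    rw [e]
    exact Finset.aemeasurable_fun_sum _ fun c _ => (ha.aemeasurable c).indicator (s.measurableSet_fiber c)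
  have hlim : AEMeasurable (fun x => a x (w x)) (volume.restrict Ω) := by
    refine aemeasurable_of_tendsto_metrizable_ae atTop (fun n => hsimple (hw.approx n)) ?_
    filter_upwards [ha.continuous] with x hx
    exact (hx.tendsto _).comp (hw.tendsto_approx x)
  refine (hlim.congr ?_).aestronglyMeasurable
  filter_upwards [huw] with x hx
  rw [hx]

/-- For bounded `u`, the local Lipschitz bound makes `a(·, u) - a(·, 0)` bounded, hence square
integrable on the bounded set. -/
lemma memLp_comp {Ω : Set (E d)} (hbdd : Bornology.IsBounded Ω) {a : E d → ℝ → ℝ}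
    (ha : IsCaratheodory Ω a) (hlip : IsLocallyLipschitzInY Ω a)
    (ha0 : MemLp (fun x => a x 0) 2 (volume.restrict Ω)) {u : E d → ℝ}
    (hu : AEStronglyMeasurable u (volume.restrict Ω)) {M : ℝ} (hM : 0 < M)
    (huM : ∀ᵐ x ∂(volume.restrict Ω), |u x| ≤ M) :
    MemLp (fun x => a x (u x)) 2 (volume.restrict Ω) := by
  have hfin : IsFiniteMeasure (volume.restrict Ω : Measure (E d)) :=
    ⟨by rw [Measure.restrict_apply_univ]; exact hbdd.measure_lt_top⟩
  obtain ⟨C, hC, hCa⟩ := hlip M hM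
  have h1 : MemLp (fun x => a x (u x) - a x 0) 2 (volume.restrict Ω) := by
    refine MemLp.of_bound ((ha.aestronglyMeasurable_comp hu).sub ha0.1) (C * M) ?_
    filter_upwards [hCa, huM] with x hx hxM
    have := hx (u x) 0 hxM (by simpa using hM.le)
    rw [sub_zero] at this
    exact this.trans (by gcongr)
  refine (h1.add ha0).ae_eq (Eventually.of_forall fun x => ?_)
  simp

/-! ### The `L²` norm -/

lemma sqrt_integral_norm_sq {α F : Type*} [MeasurableSpace α] [NormedAddCommGroup F]
    {μ : Measure α} {f : α → F} (hf : AEStronglyMeasurable f μ) :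
    √(∫ x, ‖f x‖ ^ 2 ∂μ) = lpNorm f 2 μ := by
  rw [lpNorm_eq_integral_norm_rpow_toReal two_ne_zero ENNReal.ofNat_ne_top hf]
  simp [Real.sqrt_eq_rpow]

lemma lpNorm_sq {α F : Type*} [MeasurableSpace α] [NormedAddCommGroup F]
    {μ : Measure α} {f : α → F} (hf : AEStronglyMeasurable f μ) :
    lpNorm f 2 μ ^ 2 = ∫ x, ‖f x‖ ^ 2 ∂μ := by
  rw [← sqrt_integral_norm_sq hf, Real.sq_sqrt (integral_nonneg fun _ => by positivity)]

lemma integrable_mul_of_memLp {α : Type*} [MeasurableSpace α] {μ : Measure α} {f g : α → ℝ}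
    (hf : MemLp f 2 μ) (hg : MemLp g 2 μ) : Integrable (fun x => f x * g x) μ :=
  hf.integrable_mul hg

lemma integrable_inner_of_memLp {α F : Type*} [MeasurableSpace α] [NormedAddCommGroup F]
    [InnerProductSpace ℝ F] {μ : Measure α} {f g : α → F} (hf : MemLp f 2 μ) (hg : MemLp g 2 μ) :
    Integrable (fun x => ⟪f x, g x⟫) μ := by
  refine (hf.norm.integrable_mul hg.norm).mono (hf.1.inner hg.1) (Eventually.of_forall fun x => ?_)
  simpa using norm_inner_le_norm (𝕜 := ℝ) (f x) (g x)

lemma abs_integral_inner_le {α F : Type*} [MeasurableSpace α] [NormedAddCommGroup F]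
    [InnerProductSpace ℝ F] {μ : Measure α} {f g : α → F} (hf : MemLp f 2 μ) (hg : MemLp g 2 μ) :
    |∫ x, ⟪f x, g x⟫ ∂μ| ≤ lpNorm f 2 μ * lpNorm g 2 μ := by
  rw [← sqrt_integral_norm_sq hf.1, ← sqrt_integral_norm_sq hg.1, ← Real.norm_eq_abs]
  refine (norm_integral_le_of_norm_le (hf.norm.integrable_mul hg.norm)
    (Eventually.of_forall fun x => ?_)).trans (integral_norm_mul_norm_le hf hg)
  exact norm_inner_le_norm (f x) (g x)

/-! ### Density of test functions and the energy argument -/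

lemma IsTestFunction.sub {Ω : Set (E d)} {φ ψ : E d → ℝ} (hφ : IsTestFunction Ω φ)
    (hψ : IsTestFunction Ω ψ) : IsTestFunction Ω fun x => φ x - ψ x :=
  ⟨hφ.contDiff.sub hψ.contDiff, hφ.hasCompactSupport.sub hψ.hasCompactSupport,
    (tsupport_sub φ ψ).trans (Set.union_subset hφ.tsupport_subset hψ.tsupport_subset)⟩

lemma gradient_sub {f g : E d → ℝ} {x : E d} (hf : DifferentiableAt ℝ f x)
    (hg : DifferentiableAt ℝ g x) :
    gradient (fun x => f x - g x) x = gradient f x - gradient g x := by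
  rw [gradient, gradient, gradient, ← map_sub]
  congr 1
  exact fderiv_fun_sub hf hg

lemma tendsto_eLpNorm_sub_sub {α F : Type*} [MeasurableSpace α] [NormedAddCommGroup F]
    {μ : Measure α} {u v : α → F} {f g : ℕ → α → F} (hu : AEStronglyMeasurable u μ)
    (hv : AEStronglyMeasurable v μ) (hf : ∀ n, AEStronglyMeasurable (f n) μ)
    (hg : ∀ n, AEStronglyMeasurable (g n) μ)
    (h : Tendsto (fun n => eLpNorm (fun x => u x - f n x) 2 μ) atTop (𝓝 0))
    (h' : Tendsto (fun n => eLpNorm (fun x => v x - g n x) 2 μ) atTop (𝓝 0)) :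
    Tendsto (fun n => eLpNorm (fun x => (u x - v x) - (f n x - g n x)) 2 μ) atTop (𝓝 0) := by
  have h1 := h.add h'
  rw [add_zero] at h1
  refine tendsto_of_tendsto_of_tendsto_of_le_of_le tendsto_const_nhds h1 (fun _ => zero_le)
    fun n => ?_
  have e : (fun x => (u x - v x) - (f n x - g n x)) =
      (fun x => u x - f n x) - fun x => v x - g n x := by
    funext x
    simp only [Pi.sub_apply]
    abel
  rw [e]
  exact eLpNorm_sub_le (hu.sub (hf n)) (hv.sub (hg n)) (by norm_num)

/-- Differences of functions in `H₀¹(Ω)` belong to the closure of the test functions. -/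
lemma MemH10.exists_approx_sub {Ω : Set (E d)} {u v : E d → ℝ} {gu gv : E d → E d}
    (hu : MemH10 Ω u gu) (hv : MemH10 Ω v gv) :
    ∃ φ : ℕ → E d → ℝ, (∀ n, IsTestFunction Ω (φ n)) ∧
      Tendsto (fun n => eLpNorm (fun x => (u x - v x) - φ n x) 2 (volume.restrict Ω)) atTop (𝓝 0) ∧
      Tendsto (fun n => eLpNorm (fun x => (gu x - gv x) - gradient (φ n) x) 2 (volume.restrict Ω))
        atTop (𝓝 0) := by
  obtain ⟨φ, hφ, h1, h2⟩ := hu.exists_approx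
  obtain ⟨ψ, hψ, h3, h4⟩ := hv.exists_approx
  refine ⟨fun n x => φ n x - ψ n x, fun n => (hφ n).sub (hψ n), ?_, ?_⟩
  · exact tendsto_eLpNorm_sub_sub hu.memLp.1 hv.memLp.1
      (fun n => (hφ n).contDiff.continuous.aestronglyMeasurable)
      (fun n => (hψ n).contDiff.continuous.aestronglyMeasurable) h1 h3
  · have e : ∀ n x, gradient (fun x => φ n x - ψ n x) x = gradient (φ n) x - gradient (ψ n) x :=
      fun n x => gradient_sub ((hφ n).contDiff.differentiable (by simp) x)
        ((hψ n).contDiff.differentiable (by simp) x)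
    simp only [e]
    exact tendsto_eLpNorm_sub_sub hu.memLp_grad.1 hv.memLp_grad.1
      (fun n => (hφ n).continuous_gradient.aestronglyMeasurable)
      (fun n => (hψ n).continuous_gradient.aestronglyMeasurable) h2 h4

/-- Bounds of a functional on test functions extend to their `H¹` closure. -/
lemma abs_residual_le_of_tendsto {Ω : Set (E d)} {q u : E d → ℝ} {g w : E d → E d}
    (hq : MemLp q 2 (volume.restrict Ω)) (hg : MemLp g 2 (volume.restrict Ω))
    (hu : MemLp u 2 (volume.restrict Ω)) (hw : MemLp w 2 (volume.restrict Ω)) {K : ℝ} (hK : 0 ≤ K)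
    {φ : ℕ → E d → ℝ} (hφ : ∀ n, IsTestFunction Ω (φ n))
    (h1 : Tendsto (fun n => eLpNorm (fun x => u x - φ n x) 2 (volume.restrict Ω)) atTop (𝓝 0))
    (h2 : Tendsto (fun n => eLpNorm (fun x => w x - gradient (φ n) x) 2 (volume.restrict Ω))
      atTop (𝓝 0))
    (hbound : ∀ n, |(∫ x in Ω, q x * φ n x) - ∫ x in Ω, ⟪g x, gradient (φ n) x⟫| ≤
      K * √(∫ x in Ω, ‖gradient (φ n) x‖ ^ 2)) :
    |(∫ x in Ω, q x * u x) - ∫ x in Ω, ⟪g x, w x⟫| ≤ K * lpNorm w 2 (volume.restrict Ω) := by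
  set μ : Measure (E d) := volume.restrict Ω
  have mφ : ∀ n, MemLp (φ n) 2 μ := fun n =>
    ((hφ n).contDiff.continuous.memLp_of_hasCompactSupport (hφ n).hasCompactSupport).restrict _
  have mg : ∀ n, MemLp (gradient (φ n)) 2 μ := fun n =>
    ((hφ n).continuous_gradient.memLp_of_hasCompactSupport
      (hφ n).hasCompactSupport_gradient).restrict _
  have md : ∀ n, MemLp (fun x => u x - φ n x) 2 μ := fun n => hu.sub (mφ n)
  have mdg : ∀ n, MemLp (fun x => w x - gradient (φ n) x) 2 μ := fun n => hw.sub (mg n)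
  have t1 : Tendsto (fun n => lpNorm (fun x => u x - φ n x) 2 μ) atTop (𝓝 0) := by
    have := (ENNReal.tendsto_toReal ENNReal.zero_ne_top).comp h1
    refine this.congr fun n => ?_
    exact toReal_eLpNorm (md n).1
  have t2 : Tendsto (fun n => lpNorm (fun x => w x - gradient (φ n) x) 2 μ) atTop (𝓝 0) := by
    have := (ENNReal.tendsto_toReal ENNReal.zero_ne_top).comp h2
    refine this.congr fun n => ?_
    exact toReal_eLpNorm (mdg n).1
  -- The residual of `u` is that of `φ n` plus pairings with the approximation errors. Every error
  -- term on the right tends to zero.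
  have hn : ∀ n, |(∫ x in Ω, q x * u x) - ∫ x in Ω, ⟪g x, w x⟫| ≤
      K * (lpNorm w 2 μ + lpNorm (fun x => w x - gradient (φ n) x) 2 μ) +
        lpNorm q 2 μ * lpNorm (fun x => u x - φ n x) 2 μ +
        lpNorm g 2 μ * lpNorm (fun x => w x - gradient (φ n) x) 2 μ := by
    intro n
    have a1 : |∫ x, q x * (u x - φ n x) ∂μ| ≤ lpNorm q 2 μ * lpNorm (fun x => u x - φ n x) 2 μ := by
      have := abs_integral_inner_le hq (md n)
      simpa [mul_comm] using this
    have a2 := abs_integral_inner_le hg (mdg n)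
    have a3 : √(∫ x in Ω, ‖gradient (φ n) x‖ ^ 2) ≤
        lpNorm w 2 μ + lpNorm (fun x => w x - gradient (φ n) x) 2 μ := by
      rw [sqrt_integral_norm_sq (mg n).1]
      have e : gradient (φ n) = w - fun x => w x - gradient (φ n) x := by
        funext x
        simp
      conv_lhs => rw [e]
      exact lpNorm_sub_le hw (by norm_num)
    have b1 : ∫ x, q x * u x ∂μ = (∫ x, q x * φ n x ∂μ) + ∫ x, q x * (u x - φ n x) ∂μ := by
      rw [← integral_add (integrable_mul_of_memLp hq (mφ n)) (integrable_mul_of_memLp hq (md n))]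
      simp only [← mul_add, add_sub_cancel]
    have b2 : ∫ x, ⟪g x, w x⟫ ∂μ = (∫ x, ⟪g x, gradient (φ n) x⟫ ∂μ) +
        ∫ x, ⟪g x, w x - gradient (φ n) x⟫ ∂μ := by
      rw [← integral_add (integrable_inner_of_memLp hg (mg n))
        (integrable_inner_of_memLp hg (mdg n))]
      simp only [← inner_add_right, add_sub_cancel]
    have a4 := (hbound n).trans (mul_le_mul_of_nonneg_left a3 hK)
    rw [b1, b2]
    rw [abs_le] at a1 a2 a4 ⊢
    constructor <;> linarith [a1.1, a1.2, a2.1, a2.2, a4.1, a4.2]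
  have hlim := (((t2.const_add (lpNorm w 2 μ)).const_mul K).add (t1.const_mul (lpNorm q 2 μ))).add
    (t2.const_mul (lpNorm g 2 μ))
  simp only [add_zero, mul_zero] at hlim
  exact ge_of_tendsto' hlim hn

/-- The energy identity and monotonicity: the error is bounded by the residual. -/
lemma sq_lpNorm_le_residual {Ω : Set (E d)} {a : E d → ℝ → ℝ} {f y u : E d → ℝ}
    {gy gu : E d → E d} (hmono : ∀ᵐ x ∂(volume.restrict Ω), Monotone (a x))
    (hf : MemLp f 2 (volume.restrict Ω)) (hy : MemH10 Ω y gy) (hu : MemH10 Ω u gu)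
    (hay : MemLp (fun x => a x (y x)) 2 (volume.restrict Ω))
    (hau : MemLp (fun x => a x (u x)) 2 (volume.restrict Ω))
    (h1 : WeakEquation Ω a f y gy y gy) (h2 : WeakEquation Ω a f y gy u gu) :
    lpNorm (fun x => gy x - gu x) 2 (volume.restrict Ω) ^ 2 ≤
      (∫ x in Ω, (f x - a x (u x)) * (y x - u x)) - ∫ x in Ω, ⟪gu x, gy x - gu x⟫ := by
  set μ : Measure (E d) := volume.restrict Ω
  have me : MemLp (fun x => y x - u x) 2 μ := hy.memLp.sub hu.memLp
  have mge : MemLp (fun x => gy x - gu x) 2 μ := hy.memLp_grad.sub hu.memLp_grad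
  unfold WeakEquation at h1 h2
  have e1 : ∫ x, ⟪gy x, gy x - gu x⟫ ∂μ =
      (∫ x, ⟪gy x, gy x⟫ ∂μ) - ∫ x, ⟪gy x, gu x⟫ ∂μ := by
    rw [← integral_sub (integrable_inner_of_memLp hy.memLp_grad hy.memLp_grad)
      (integrable_inner_of_memLp hy.memLp_grad hu.memLp_grad)]
    simp only [inner_sub_right]
    rfl
  have e2 : ∫ x, a x (y x) * (y x - u x) ∂μ =
      (∫ x, a x (y x) * y x ∂μ) - ∫ x, a x (y x) * u x ∂μ := by
    rw [← integral_sub (integrable_mul_of_memLp hay hy.memLp) (integrable_mul_of_memLp hay hu.memLp)]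
    simp only [mul_sub]
  have e3 : ∫ x, f x * (y x - u x) ∂μ = (∫ x, f x * y x ∂μ) - ∫ x, f x * u x ∂μ := by
    rw [← integral_sub (integrable_mul_of_memLp hf hy.memLp) (integrable_mul_of_memLp hf hu.memLp)]
    simp only [mul_sub]
  have e4 : ∫ x, (f x - a x (u x)) * (y x - u x) ∂μ =
      (∫ x, f x * (y x - u x) ∂μ) - ∫ x, a x (u x) * (y x - u x) ∂μ := by
    rw [← integral_sub (integrable_mul_of_memLp hf me) (integrable_mul_of_memLp hau me)]
    simp only [sub_mul]
  have e5 : lpNorm (fun x => gy x - gu x) 2 μ ^ 2 =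
      (∫ x, ⟪gy x, gy x - gu x⟫ ∂μ) - ∫ x, ⟪gu x, gy x - gu x⟫ ∂μ := by
    rw [lpNorm_sq mge.1, ← integral_sub (integrable_inner_of_memLp hy.memLp_grad mge)
      (integrable_inner_of_memLp hu.memLp_grad mge)]
    simp only [← inner_sub_left, real_inner_self_eq_norm_sq]
    rfl
  -- Monotonicity: `a(·, y) - a(·, u)` and `y - u` have the same sign, so the nonlinear difference
  -- can be discarded.
  have e6 : ∫ x, a x (u x) * (y x - u x) ∂μ ≤ ∫ x, a x (y x) * (y x - u x) ∂μ := by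
    refine integral_mono_ae (integrable_mul_of_memLp hau me) (integrable_mul_of_memLp hay me) ?_
    filter_upwards [hmono] with x hx
    rcases le_total (y x) (u x) with h | h
    · exact mul_le_mul_of_nonpos_right (hx h) (sub_nonpos.2 h)
    · exact mul_le_mul_of_nonneg_right (hx h) (sub_nonneg.2 h)
  rw [e5, e4]
  linarith

end SemilinearFEM

end

/-! ### Assembly of the a posteriori estimate -/

theorem theorem3p2 (d : ℕ) (hd : d = 2 ∨ d = 3)
    (Ω : Set (SemilinearFEM.E d)) (hΩ_open : IsOpen Ω) (hΩ_bdd : Bornology.IsBounded Ω)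
    (hΩ_lip : SemilinearFEM.HasLipschitzBoundary Ω)
    (𝒯₀ : SemilinearFEM.Mesh Ω) (σ : ℝ) :
    ∃ C : ℝ, 0 < C ∧
      ∀ (a : SemilinearFEM.E d → ℝ → ℝ) (f : SemilinearFEM.E d → ℝ),
        SemilinearFEM.IsCaratheodory Ω a →
        (∀ᵐ x ∂(volume.restrict Ω), Monotone (a x)) →
        SemilinearFEM.IsLocallyLipschitzInY Ω a →
        MemLp (fun x => a x 0) 2 (volume.restrict Ω) →
        MemLp f 2 (volume.restrict Ω) →
        ∀ (y : SemilinearFEM.E d → ℝ) (gy : SemilinearFEM.E d → SemilinearFEM.E d),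
          MemLp y ∞ (volume.restrict Ω) →
          SemilinearFEM.IsWeakSolution Ω a f y gy →
          ∀ 𝒯 ∈ 𝒯₀.family σ,
            ∀ (yT : SemilinearFEM.E d → ℝ) (gyT : SemilinearFEM.E d → SemilinearFEM.E d),
              SemilinearFEM.IsGalerkinSolution 𝒯 a f yT gyT →
              lpNorm (fun x => gy x - gyT x) 2 (volume.restrict Ω) ≤
                C * SemilinearFEM.estimator 𝒯 a f yT := by
  have hd2 : 2 ≤ d := by omega
  -- Enlarging the parameter to `max σ 1` preserves shape regularity and provides the bound `1 ≤ σ`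
  -- assumed by the size comparisons.
  obtain ⟨C, hC, hres⟩ := SemilinearFEM.Mesh.exists_residual_bound hd2 hΩ_open hΩ_bdd hΩ_lip
    (le_max_right σ 1)
  obtain ⟨r, L, hr, -, hgraph⟩ :=
    SemilinearFEM.exists_uniform_isGraphDomain (by omega) hΩ_open hΩ_bdd hΩ_lip
  have hreg : interior (closure Ω) ⊆ Ω := fun z hz => by
    obtain ⟨e, F, hF⟩ := hgraph z (interior_subset hz)
    exact hF.mem_of_mem_interior_closure hr hz
  refine ⟨C, hC, ?_⟩
  intro a f ha hmono hlip ha0 hf y gy hyb hy 𝒯 h𝒯 yT gyT hyT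
  have hshape : 𝒯.IsShapeRegular (max σ 1) := fun T hT => by
    obtain ⟨c, ρ, hρ, hb, hs⟩ := h𝒯.2 T hT
    exact ⟨c, ρ, hρ, hb, hs.trans (mul_le_mul_of_nonneg_right (le_max_left _ _) hρ.le)⟩
  have hpw := hyT.1.pwAffine
  have hyTH := hyT.1.memH10
  have hgT := fun T hT => hpw.ae_eq_of_memH1 hΩ_open hreg hyTH.memLp_grad hyTH.hasWeakGradient
    (T := T) hT
  -- The `L∞` bound on `y` enters only here, to make `a(·, y)` square integrable. It does not
  -- influence `C`.
  have hay : MemLp (fun x => a x (y x)) 2 (volume.restrict Ω) := by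
    refine SemilinearFEM.memLp_comp hΩ_bdd ha hlip ha0 hyb.1
      (M := (eLpNorm y ∞ (volume.restrict Ω)).toReal + 1) (by positivity) ?_
    filter_upwards [ae_le_eLpNormEssSup (f := y) (μ := volume.restrict Ω)] with x hx
    have h1 := ENNReal.toReal_mono hyb.2.ne (hx.trans (le_of_eq eLpNorm_exponent_top.symm))
    rw [toReal_enorm, Real.norm_eq_abs] at h1
    linarith
  obtain ⟨M, hM, hMT⟩ := hpw.exists_bound
  have hayT : MemLp (fun x => a x (yT x)) 2 (volume.restrict Ω) := by
    refine SemilinearFEM.memLp_comp hΩ_bdd ha hlip ha0 hyTH.memLp.1 hM ?_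
    filter_upwards [ae_restrict_mem hΩ_open.measurableSet] with x hx
    exact hMT x (subset_closure hx)
  have hq : MemLp (fun x => f x - a x (yT x)) 2 (volume.restrict Ω) := hf.sub hayT
  have hgal : ∀ z ∈ Ω, ∫ x in Ω, (f x - a x (yT x)) * 𝒯.hat z x =
      ∫ x in Ω, ⟪gyT x, gradient (𝒯.hat z) x⟫ := by
    intro z hz
    have hV := SemilinearFEM.Mesh.memV_hat (𝒯 := 𝒯) hΩ_open hΩ_bdd hreg hz
    have hw := hyT.2 _ _ hV
    unfold SemilinearFEM.WeakEquation at hw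
    simp only [sub_mul]
    rw [integral_sub (SemilinearFEM.integrable_mul_of_memLp hf hV.memH10.memLp)
      (SemilinearFEM.integrable_mul_of_memLp hayT hV.memH10.memLp)]
    linarith
  have hbound := hres 𝒯 hshape yT _ gyT hpw hgT _ hq hgal
    -- The indicator dominates its volume part and its jump part separately, which is all that is
    -- asked of `η`.
    (SemilinearFEM.indicatorSq 𝒯 a f yT) (fun T hT => ?_) fun T hT => ?_
  · obtain ⟨φ, hφ, h1, h2⟩ := hy.1.exists_approx_sub hyTH
    have me : MemLp (fun x => y x - yT x) 2 (volume.restrict Ω) := hy.1.memLp.sub hyTH.memLp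
    have mge : MemLp (fun x => gy x - gyT x) 2 (volume.restrict Ω) :=
      hy.1.memLp_grad.sub hyTH.memLp_grad
    have hE : 0 ≤ C * SemilinearFEM.estimator 𝒯 a f yT := mul_nonneg hC.le (Real.sqrt_nonneg _)
    have hR := SemilinearFEM.abs_residual_le_of_tendsto hq hyTH.memLp_grad me mge hE hφ h1 h2
      fun n => (hbound (φ n) (hφ n)).trans (le_of_eq (mul_assoc _ _ _).symm)
    have hS := SemilinearFEM.sq_lpNorm_le_residual hmono hf hy.1 hyTH hay hayT
      (hy.2 y gy hy.1) (hy.2 yT gyT hyTH)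
    have hN : 0 ≤ lpNorm (fun x => gy x - gyT x) 2 (volume.restrict Ω) := lpNorm_nonneg
    have hfinal := hS.trans ((le_abs_self _).trans hR)
    -- The squared error is at most `C` times the estimator times the error, so one factor is
    -- cancelled unless the error is zero.
    rcases hN.eq_or_lt with h0 | h0
    · rw [← h0]
      exact hE
    · rw [sq] at hfinal
      exact le_of_mul_le_mul_right hfinal h0
  · have hqT := hq.1.mono_measure (𝒯.restrict_le hΩ_open hreg hT)
    rw [SemilinearFEM.indicatorSq, SemilinearFEM.lpNorm_sq hqT]
    exact le_add_of_nonneg_right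
      (mul_nonneg (SemilinearFEM.size_nonneg T) (SemilinearFEM.Mesh.jumpNormSq_nonneg 𝒯 yT T))
  · exact le_add_of_nonneg_left (by positivity)
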